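/- An automaton in dimension $d$ is a tuple $\mathcal A=(Q,A,E,T)$, where $Q$ is a finite set of locations, $A=\{A_q\}_{q\in Q}$ is a family of real $d\times d$ matrices, $E\subseteq Q\times\mathbb R^{d\times d}\times Q$ is a set of transitions, and each $T_q\subseteq\mathbb R^d$ ($q\in Q$) is an algebraic set; all entries of the matrices are algebraic numbers, and each $T_q$ is the set of common zeros of polynomials with algebraic coefficients. It is a *linear hybrid automaton* if $E$ is finite, and a *finite affine program* if moreover $A_q=0$ for all $q$. Its collecting semantics is the least family $\{S_q\}_{q\in Q}$ of subsets of $\mathbb R^d$ with $S_q\supseteq T_q$ for all $q$, $S_q\supseteq e^{A_qt}S_q$ for all $q$ and all $t\ge 0$, and $S_q\supseteq BS_p$ for all $(p,B,q)\in E$. Let $V(\mathcal A)=\{V_q\}_{q\in Q}$, where $V_q$ is the real Zariski closure of $S_q$. Linear hybrid automata are given to algorithms by finite codes: $d$, a numbering of $Q$, and lists of the matrices $A_q$, of the transitions, and of finite sets of polynomials defining the $T_q$, where each real algebraic number is given by a nonzero integer polynomial and an open interval with rational end points in which that number is the only root. Every linear hybrid automaton has such a code. **Proposition.** There is an algorithm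 that, given a code of any linear hybrid automaton $\mathcal A=(Q,A,E,T)$ of any dimension $d$, terminates and outputs a code (for the same numbering of $Q$) of a finite affine program $\mathcal A'$ with the same locations, the same dimension, the same sets of initial states $T_q$ and the same algebraic invariants, $V(\mathcal A)=V(\mathcal A')$. Moreover, $$\mathcal A'=(Q,A',E',T),\qquad A'_q=0\ \ (q\in Q),\qquad E'=E\cup\{(q,B_q,q):q\in Q\},$$ where each $B_q$ is an invertible real $d\times d$ matrix with algebraic entries such that the cyclic group $\{B_q^k:k\in\mathbb Z\}$ and the group $\{e^{A_qt}:t\in\mathbb R\}$ have the same complex Zariski closure in $\mathbb C^{d\times d}$. -/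

import Mathlib

open Matrix

noncomputable section

/-! ### Hybrid automata and their algebraic invariants -/

/-- The Zariski closure in affine space `K^σ` of a set of points: the common zeros of all
polynomials over `K` that vanish on the set. -/
def zariskiClosure {K σ : Type*} [Field K] (S : Set (σ → K)) : Set (σ → K) :=
  MvPolynomial.zeroLocus K (MvPolynomial.vanishingIdeal K S)

/-- All entries of the real matrix `M` are algebraic numbers. -/
def IsAlgebraicMatrix {d : ℕ} (M : Matrix (Fin d) (Fin d) ℝ) : Prop :=
  ∀ i j, IsAlgebraic ℚ (M i j)

/-- `X ⊆ ℝ^d` is the set of common zeros of a set of real polynomials with algebraic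
coefficients. -/
def IsAlgebraicSet {d : ℕ} (X : Set (Fin d → ℝ)) : Prop :=
  ∃ P : Set (MvPolynomial (Fin d) ℝ),
    (∀ p ∈ P, ∀ m, IsAlgebraic ℚ (p.coeff m)) ∧
      X = {x | ∀ p ∈ P, MvPolynomial.eval x p = 0}

/-- An unguarded automaton `(Q, A, E, T)` in dimension `d` with locations `Q`: in location `q` the
variables evolve according to `x' = A_q x`, an edge `(p, B, q)` updates them by `x ↦ B x`, and
`T_q` is the set of initial states in location `q`. All data are algebraic. -/
structure HybridAutomaton (Q : Type*) (d : ℕ) where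
  /-- the matrices `A_q` of the continuous dynamics -/
  flow : Q → Matrix (Fin d) (Fin d) ℝ
  /-- the set `E` of discrete transitions -/
  edges : Set (Q × Matrix (Fin d) (Fin d) ℝ × Q)
  /-- the sets `T_q` of initial states -/
  init : Q → Set (Fin d → ℝ)
  flow_algebraic : ∀ q, IsAlgebraicMatrix (flow q)
  edges_algebraic : ∀ e ∈ edges, IsAlgebraicMatrix e.2.1
  init_algebraic : ∀ q, IsAlgebraicSet (init q)

namespace HybridAutomaton

variable {Q : Type*} {d : ℕ}

/-- Linear hybrid automata: finitely many edges. -/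
def IsLinear (𝒜 : HybridAutomaton Q d) : Prop :=
  𝒜.edges.Finite

/-- (Finite) affine programs: no continuous dynamics and finitely many edges. -/
def IsFiniteAffineProgram (𝒜 : HybridAutomaton Q d) : Prop :=
  (∀ q, 𝒜.flow q = 0) ∧ 𝒜.edges.Finite

/-- The monotone operator
`Φ(S)_q = T_q ∪ ⋃_{t ≥ 0} e^{A_q t} S_q ∪ ⋃_{(p, B, q) ∈ E} B S_p`. -/
def step (𝒜 : HybridAutomaton Q d) :
    (Q → Set (Fin d → ℝ)) →o (Q → Set (Fin d → ℝ)) where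
  toFun S q :=
    𝒜.init q ∪
      {y | ∃ t : ℝ, 0 ≤ t ∧ ∃ x ∈ S q, y = NormedSpace.exp (t • 𝒜.flow q) *ᵥ x} ∪
      {y | ∃ p B, (p, B, q) ∈ 𝒜.edges ∧ ∃ x ∈ S p, y = B *ᵥ x}
  monotone' := by
    rintro S S' h q y ((hy | ⟨t, ht, x, hx, rfl⟩) | ⟨p, B, he, x, hx, rfl⟩)
    · exact Or.inl (Or.inl hy)
    · exact Or.inl (Or.inr ⟨t, ht, x, h q hx, rfl⟩)
    · exact Or.inr ⟨p, B, he, x, h p hx, rfl⟩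

/-- The collecting semantics: the least fixed point of `Φ`. -/
def collecting (𝒜 : HybridAutomaton Q d) : Q → Set (Fin d → ℝ) :=
  OrderHom.lfp 𝒜.step

/-- The strongest algebraic invariant `V(𝒜)`: in each location, the real Zariski closure of the
collecting semantics. -/
def strongestInvariant (𝒜 : HybridAutomaton Q d) (q : Q) : Set (Fin d → ℝ) :=
  zariskiClosure (𝒜.collecting q)

end HybridAutomaton

/-- The complex Zariski closure, in the affine space `ℂ^{d × d}`, of a set of real matrices. -/
def complexMatrixClosure {d : ℕ} (S : Set (Matrix (Fin d) (Fin d) ℝ)) :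
    Set (Fin d × Fin d → ℂ) :=
  zariskiClosure ((fun (M : Matrix (Fin d) (Fin d) ℝ) ij => (M ij.1 ij.2 : ℂ)) '' S)

/-- The cyclic group `⟨B⟩`, as a set of matrices. -/
def cyclicGroup {d : ℕ} (B : GL (Fin d) ℝ) : Set (Matrix (Fin d) (Fin d) ℝ) :=
  {M | ∃ k : ℤ, M = ((B ^ k : GL (Fin d) ℝ) : Matrix (Fin d) (Fin d) ℝ)}

/-- The one-parameter group `{e^{At} : t ∈ ℝ}`. -/
def flowGroup {d : ℕ} (A : Matrix (Fin d) (Fin d) ℝ) : Set (Matrix (Fin d) (Fin d) ℝ) :=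
  {M | ∃ t : ℝ, M = NormedSpace.exp (t • A)}

/-! ### Finite codes, on which algorithms operate -/

/-- A code `(a, b)` for the rational number `a / (b + 1)`. -/
abbrev RatCode := ℤ × ℕ

/-- The rational number with a given code. -/
def RatCode.val (r : RatCode) : ℚ := (r.1 : ℚ) / ((r.2 : ℚ) + 1)

/-- The integer polynomial with a given list of coefficients, constant coefficient first. -/
def polyOfList (l : List ℤ) : Polynomial ℤ :=
  l.foldr (fun a p => Polynomial.C a + Polynomial.X * p) 0

/-- A code for a real algebraic number: the coefficients of an integer polynomial, and the
end points of an isolating interval. -/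
abbrev RealAlgCode := List ℤ × RatCode × RatCode

/-- `c` is a code for `x`: `x` is the only root, in the open interval given by `c`, of the nonzero
polynomial given by `c`. -/
def RealAlgCode.Denotes (c : RealAlgCode) (x : ℝ) : Prop :=
  polyOfList c.1 ≠ 0 ∧
    ∀ y : ℝ, (Polynomial.aeval y (polyOfList c.1) = 0 ∧
      (RatCode.val c.2.1 : ℝ) < y ∧ y < (RatCode.val c.2.2 : ℝ)) ↔ y = x

/-- A code for a matrix: the list of its rows. -/
abbrev MatCode := List (List RealAlgCode)

/-- `c` is a code for the matrix `M`. -/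
def MatCode.Denotes {d : ℕ} (c : MatCode) (M : Matrix (Fin d) (Fin d) ℝ) : Prop :=
  List.Forall₂ (List.Forall₂ RealAlgCode.Denotes) c
    (List.ofFn fun i => List.ofFn fun j => M i j)

/-- A code for a multivariate polynomial: a list of terms, each given by the list of exponents and
the coefficient. -/
abbrev PolyCode := List (List ℕ × RealAlgCode)

/-- `c` is a code for the polynomial `p`. -/
def PolyCode.Denotes {d : ℕ} (c : PolyCode) (p : MvPolynomial (Fin d) ℝ) : Prop :=
  ∃ l : List ((Fin d →₀ ℕ) × ℝ),
    List.Forall₂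
      (fun (t : List ℕ × RealAlgCode) (m : (Fin d →₀ ℕ) × ℝ) =>
        t.1 = List.ofFn (fun i => m.1 i) ∧ RealAlgCode.Denotes t.2 m.2) c l ∧
    p = (l.map fun m => MvPolynomial.monomial m.1 m.2).sum

/-- A code for an algebraic set: a finite list of defining polynomials. -/
abbrev SetCode := List PolyCode

/-- `c` is a code for the algebraic set `X`. -/
def SetCode.Denotes {d : ℕ} (c : SetCode) (X : Set (Fin d → ℝ)) : Prop :=
  ∃ P : List (MvPolynomial (Fin d) ℝ),
    List.Forall₂ PolyCode.Denotes c P ∧ X = {x | ∀ p ∈ P, MvPolynomial.eval x p = 0}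

/-- A code for an automaton with finitely many edges: the number of locations, the dimension, the
list of the flow matrices, the list of the edges, and the list of the sets of initial states. -/
abbrev AutomatonCode :=
  ℕ × ℕ × List MatCode × List (ℕ × MatCode × ℕ) × List SetCode

/-- `c` is a code for the automaton `𝒜`, whose locations are numbered by `e`. -/
def AutomatonCode.Denotes {Q : Type*} {n d : ℕ} (e : Q ≃ Fin n) (c : AutomatonCode)
    (𝒜 : HybridAutomaton Q d) : Prop :=
  c.1 = n ∧ c.2.1 = d ∧
    List.Forall₂ MatCode.Denotes c.2.2.1 (List.ofFn fun i => 𝒜.flow (e.symm i)) ∧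
    (∃ l : List (Q × Matrix (Fin d) (Fin d) ℝ × Q),
      List.Forall₂
        (fun (t : ℕ × MatCode × ℕ) (s : Q × Matrix (Fin d) (Fin d) ℝ × Q) =>
          t.1 = (e s.1 : ℕ) ∧ MatCode.Denotes t.2.1 s.2.1 ∧ t.2.2 = (e s.2.2 : ℕ))
        c.2.2.2.1 l ∧
      𝒜.edges = {s | s ∈ l}) ∧
    List.Forall₂ SetCode.Denotes c.2.2.2.2 (List.ofFn fun i => 𝒜.init (e.symm i))

end

/-! Let `A` be a real algebraic matrix with distinct complex eigenvalues `ν_l` and spectral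
projections `E_l`, and put `W_{l,k} = (A - ν_l)^k E_l / k!`. Then `e^{tA} = ∑_l e^{ν_l t} ∑_{k<d}
t^k W_{l,k}`. For nonzero `μ_l`, the matrix `B = ∑_l μ_l ∑_{k<d} W_{l,k}` commutes with `A` and
satisfies `B^n = ∑_l μ_l^n ∑_{k<d} n^k W_{l,k}`. A polynomial in the matrix entries therefore
becomes one and the same polynomial `R`, evaluated at `(t, e^{ν_l t})` on the flow and at `(n,
μ_l^n)` on the cyclic group. Distinct functions `t^k e^{κt}` are linearly independent, and so are
distinct sequences `n^k κ^n` with `κ ≠ 0`; hence `R` vanishes exactly if the coefficients of each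
class of coinciding monomials sum to zero. The classes agree, and with them the two closures, as
soon as the multiplicative relations of the `μ_l` are exactly the additive relations of the `ν_l`
(`SameRelations`, `SpectralData.complexMatrixClosure_eq`).

Algebraic `μ_l` of this kind are found as follows. Let the real algebraic integer `θ`, of degree
`D`, generate a field that contains the real and imaginary parts of all data. Then `ν_l = δ⁻¹
∑_{j<D} c_{l,j} θ^j` with unique Gaussian integers `c_{l,j}`, so it suffices to have an injective
homomorphism from `ℤ[i]^D` to the multiplicative group of `ℚ(i)`. With `z_j = 2^(2^j) + i`, take `c
↦ ∏_j z_j^(re c_j + im c_j) * conj(z_j)^(re c_j - im c_j)`. Since `z_j * conj(z_j)` is a Fermat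
number, the `z_j` and their conjugates are pairwise coprime non-units, which gives injectivity
(`sameRelations_gaussianValue`). The homomorphism commutes with complex conjugation, and this makes
`B` real (`gaussianValue_conj`, `SpectralDecomposition.exists_spectralData`).

Linear maps are Zariski continuous, so the closures of the collecting semantics of either automaton
form an inductive invariant of the other (`HybridAutomaton.strongestInvariant_eq_of_loops`). Only
times `t ≥ 0` and powers `n ≥ 0` are available there, and these already determine the vanishing
ideals.

The algorithm is an unbounded search for certificates. A certificate (`LoopCert`) presents `θ`, `A`,
`B`, the `ν_l` and the `W_{l,k}` by integer polynomials, and its validity is a primitive recursive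
condition: equations at `θ` are divisibilities by the defining polynomial, positivity at `θ` and
isolation of roots are dominance conditions on coefficients after a change of scale, and
irreducibility is a search for factors with bounded coefficients. Every valid certificate is sound
(`LoopCert.Valid.exists_spectralData`), and every algebraic matrix has one
(`LoopCert.exists_valid`), so the search terminates with a correct output. -/

noncomputable section


/-! ### Exponential polynomials -/

/-- The shift operator on sequences. -/
def seqShift : Module.End ℂ (ℕ → ℂ) where
  toFun f n := f (n + 1)
  map_add' _ _ := rfl
  map_smul' _ _ := rfl

/-- By the binomial theorem, `seqShift - μ` sends `n^k μ^n` to a combination of the same sequences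
with smaller exponents, so some power of it kills the sequence. -/
theorem pow_mul_geom_mem_maxGenEigenspace (μ : ℂ) (k : ℕ) :
    (fun n : ℕ => (n : ℂ) ^ k * μ ^ n) ∈ seqShift.maxGenEigenspace μ := by
  induction k using Nat.strong_induction_on with
  | _ k ih =>
    have h1 : (seqShift - μ • 1) (fun n : ℕ => (n : ℂ) ^ k * μ ^ n) ∈
        seqShift.maxGenEigenspace μ := by
      have : (seqShift - μ • 1) (fun n : ℕ => (n : ℂ) ^ k * μ ^ n) =
          ∑ j ∈ Finset.range k, (μ * (k.choose j : ℂ)) • (fun n : ℕ => (n : ℂ) ^ j * μ ^ n) := by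
        funext n
        simp only [seqShift, LinearMap.sub_apply, LinearMap.coe_mk, AddHom.coe_mk,
          LinearMap.smul_apply, Module.End.one_apply, Pi.sub_apply, Pi.smul_apply, smul_eq_mul,
          Finset.sum_apply, Nat.cast_add, Nat.cast_one, add_pow, one_pow, mul_one,
          Finset.sum_range_succ, Nat.choose_self]
        rw [add_mul, Finset.sum_mul]
        have : ∀ j ∈ Finset.range k, (n : ℂ) ^ j * (k.choose j : ℂ) * μ ^ (n + 1) =
            μ * (k.choose j : ℂ) * ((n : ℂ) ^ j * μ ^ n) := fun j _ => by ring
        rw [Finset.sum_congr rfl this]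
        ring
      rw [this]
      exact Submodule.sum_mem _ fun j hj =>
        Submodule.smul_mem _ _ (ih j (Finset.mem_range.1 hj))
    rw [Module.End.mem_maxGenEigenspace] at h1 ⊢
    obtain ⟨m, hm⟩ := h1
    exact ⟨m + 1, by rw [pow_succ, Module.End.mul_apply, hm]⟩

/-- Each summand lies in a generalized eigenspace of the shift, and these are independent, so every
summand vanishes and `p μ` has all natural numbers as roots. The base `0` is excluded because `0^n`
is zero for `n > 0`. -/
theorem expPoly_eq_zero (s : Finset ℂ) (p : ℂ → Polynomial ℂ) (h0 : (0 : ℂ) ∉ s)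
    (h : ∀ n : ℕ, ∑ μ ∈ s, (p μ).eval (n : ℂ) * μ ^ n = 0) : ∀ μ ∈ s, p μ = 0 := by
  have hind := (iSupIndep_iff_finsetSum_eq_zero_imp_eq_zero _).1
    (seqShift.independent_maxGenEigenspace)
  intro μ hμ
  have key := hind s (fun μ n => (p μ).eval (n : ℂ) * μ ^ n) (by
    intro κ _
    have : (fun n : ℕ => (p κ).eval (n : ℂ) * κ ^ n) =
        ∑ j ∈ (p κ).support, (p κ).coeff j • (fun n : ℕ => (n : ℂ) ^ j * κ ^ n) := by
      funext n
      simp only [Polynomial.eval_eq_sum, Polynomial.sum, Finset.sum_apply, Pi.smul_apply,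
        smul_eq_mul, Finset.sum_mul, mul_assoc]
    rw [this]
    exact Submodule.sum_mem _ fun j _ =>
      Submodule.smul_mem _ _ (pow_mul_geom_mem_maxGenEigenspace κ j))
    (by funext n; simpa using h n) μ hμ
  refine Polynomial.eq_zero_of_infinite_isRoot _ ?_
  refine (Set.infinite_range_of_injective (Nat.cast_injective (R := ℂ))).mono ?_
  rintro _ ⟨n, rfl⟩
  have := congrFun key n
  have hμ0 : μ ≠ 0 := fun h => h0 (h ▸ hμ)
  simpa [hμ0] using this

/-- A linear relation between the sequences `n ^ k i * μ i ^ n` is a relation between the pairs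
`(μ i, k i)`. -/
theorem sum_eq_zero_of_geom {ι : Type*} (I : Finset ι) (a μ g : ι → ℂ) (k : ι → ℕ)
    (hμ : ∀ i ∈ I, μ i ≠ 0)
    (h : ∀ n : ℕ, ∑ i ∈ I, a i * ((n : ℂ) ^ k i * μ i ^ n) = 0)
    (hg : ∀ i j, μ i = μ j → k i = k j → g i = g j) : ∑ i ∈ I, a i * g i = 0 := by
  classical
  -- Terms with equal base form one exponential polynomial; its coefficients then separate the
  -- exponents `k`.
  let p : ℂ → Polynomial ℂ := fun κ =>
    ∑ i ∈ I with μ i = κ, Polynomial.C (a i) * Polynomial.X ^ k i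
  have hp : ∀ κ ∈ I.image μ, p κ = 0 := by
    apply expPoly_eq_zero
    · simpa using fun i hi => hμ i hi
    · intro n
      rw [← h n, ← Finset.sum_fiberwise_of_maps_to
        (fun i hi => Finset.mem_image_of_mem μ hi : ∀ i ∈ I, μ i ∈ I.image μ)]
      refine Finset.sum_congr rfl fun κ _ => ?_
      simp only [p, Polynomial.eval_finsetSum, Finset.sum_mul]
      refine Finset.sum_congr rfl fun i hi => ?_
      rw [(Finset.mem_filter.1 hi).2]
      simp [mul_assoc]
  rw [← Finset.sum_fiberwise_of_maps_to
    (fun i hi => Finset.mem_image_of_mem (fun i => (μ i, k i)) hi :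
      ∀ i ∈ I, (μ i, k i) ∈ I.image fun i => (μ i, k i))]
  refine Finset.sum_eq_zero fun x hx => ?_
  obtain ⟨i₀, hi₀, rfl⟩ := Finset.mem_image.1 hx
  have h1 : ∀ i ∈ I.filter (fun i => (μ i, k i) = (μ i₀, k i₀)), a i * g i = a i * g i₀ := by
    intro i hi
    have := (Finset.mem_filter.1 hi).2
    rw [Prod.mk.injEq] at this
    rw [hg i i₀ this.1 this.2]
  rw [Finset.sum_congr rfl h1, ← Finset.sum_mul]
  have h2 := congrArg (fun q => Polynomial.coeff q (k i₀))
    (hp (μ i₀) (Finset.mem_image_of_mem μ hi₀))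
  simp only [p, Polynomial.finsetSum_coeff, Polynomial.coeff_C_mul, Polynomial.coeff_X_pow,
    Polynomial.coeff_zero, mul_ite, mul_one, mul_zero] at h2
  rw [← Finset.sum_filter, Finset.filter_filter] at h2
  have h3 : (I.filter fun i => (μ i, k i) = (μ i₀, k i₀)) =
      I.filter fun i => μ i = μ i₀ ∧ k i₀ = k i := by
    ext i; simp [eq_comm]
  rw [h3, h2, zero_mul]

/-- A small `τ` moves the finite set into the strip `|Im| < π`, where the exponential is injective.
-/
theorem exists_exp_mul_injOn (s : Finset ℂ) :
    ∃ τ : ℝ, 0 < τ ∧ ∀ x ∈ s, ∀ y ∈ s, Complex.exp (x * τ) = Complex.exp (y * τ) → x = y := by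
  obtain ⟨C, hC⟩ : ∃ C : ℝ, ∀ x ∈ s, |x.im| ≤ C :=
    ⟨∑ x ∈ s, |x.im|, fun x hx =>
      Finset.single_le_sum (f := fun x : ℂ => |x.im|) (fun _ _ => abs_nonneg _) hx⟩
  have hC1 : 0 < |C| + 1 := by positivity
  refine ⟨1 / (|C| + 1), by positivity, fun x hx y hy hxy => ?_⟩
  have hb : ∀ z ∈ s, |(z * ((1 / (|C| + 1) : ℝ) : ℂ)).im| < Real.pi := by
    intro z hz
    rw [Complex.im_mul_ofReal, abs_mul, abs_of_pos (by positivity : 0 < 1 / (|C| + 1)),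
      mul_one_div]
    have : |z.im| / (|C| + 1) ≤ 1 := by
      rw [div_le_one hC1]
      linarith [hC z hz, le_abs_self C]
    linarith [Real.pi_gt_three]
  have hx' := abs_lt.1 (hb x hx)
  have hy' := abs_lt.1 (hb y hy)
  have := Complex.exp_inj_of_neg_pi_lt_of_le_pi hx'.1 hx'.2.le hy'.1 hy'.2.le hxy
  refine mul_right_cancel₀ ?_ this
  exact_mod_cast (by positivity : (1 / (|C| + 1) : ℝ) ≠ 0)

/-- A linear relation between the functions `t ^ k i * exp (ν i * t)` on the half-line is a
relation between the pairs `(ν i, k i)`. -/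
theorem sum_eq_zero_of_exp {ι : Type*} (I : Finset ι) (a ν g : ι → ℂ) (k : ι → ℕ)
    (h : ∀ t : ℝ, 0 ≤ t → ∑ i ∈ I, a i * ((t : ℂ) ^ k i * Complex.exp (ν i * t)) = 0)
    (hg : ∀ i j, ν i = ν j → k i = k j → g i = g j) : ∑ i ∈ I, a i * g i = 0 := by
  classical
  obtain ⟨τ, hτ, hinj⟩ := exists_exp_mul_injOn (I.image ν)
  have hτ' : (τ : ℂ) ≠ 0 := by exact_mod_cast hτ.ne'
  -- Sampling at `t = n τ` turns `e^{νt}` into the geometric sequence of `e^{ντ}`, without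
  -- identifying distinct `ν`. The factor `τ^k` goes into the coefficient and is divided out of `g`.
  have := sum_eq_zero_of_geom I.attach (fun i => a i * (τ : ℂ) ^ k i)
    (fun i => Complex.exp (ν i * τ)) (fun i => g i / (τ : ℂ) ^ k i) (fun i => k i)
    (fun i _ => Complex.exp_ne_zero _) (by
      intro n
      rw [Finset.sum_attach I
        (fun i => a i * (τ : ℂ) ^ k i * ((n : ℂ) ^ k i * Complex.exp (ν i * τ) ^ n)),
        ← h (n * τ) (by positivity)]
      refine Finset.sum_congr rfl fun i _ => ?_
      rw [← Complex.exp_nat_mul]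
      push_cast
      rw [mul_pow]
      ring_nf) (by
      intro i j hij hk
      have := hinj _ (Finset.mem_image_of_mem ν i.2) _ (Finset.mem_image_of_mem ν j.2) hij
      rw [hg i j this hk, hk])
  rw [← this, Finset.sum_attach I (fun i => a i * (τ : ℂ) ^ k i * (g i / (τ : ℂ) ^ k i))]
  refine Finset.sum_congr rfl fun i _ => ?_
  have : (τ : ℂ) ^ k i ≠ 0 := pow_ne_zero _ hτ'
  field_simp

/-! ### The closures of a one-parameter group and of a cyclic group -/

/-- `μ` satisfies exactly the multiplicative relations that correspond to the additive relations
of `ν`. -/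
def SameRelations {s : ℕ} (ν μ : Fin s → ℂ) : Prop :=
  ∀ m m' : Fin s → ℕ, ∑ l, (m l : ℂ) * ν l = ∑ l, (m' l : ℂ) * ν l ↔
    ∏ l, μ l ^ m l = ∏ l, μ l ^ m' l

theorem eval_elim_eq {s : ℕ} (R : MvPolynomial (Option (Fin s)) ℂ) (z : ℂ) (y : Fin s → ℂ) :
    MvPolynomial.eval (fun o => o.elim z y) R =
      ∑ e ∈ R.support, R.coeff e * (z ^ e none * ∏ l, y l ^ e (some l)) := by
  rw [MvPolynomial.eval_eq']
  simp [Fintype.prod_option]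

theorem prod_exp_mul_pow {s : ℕ} (ν : Fin s → ℂ) (t : ℂ) (e : Fin s → ℕ) :
    ∏ l, Complex.exp (ν l * t) ^ e l = Complex.exp ((∑ l, (e l : ℂ) * ν l) * t) := by
  rw [Finset.sum_mul, Complex.exp_sum]
  refine Finset.prod_congr rfl fun l _ => ?_
  rw [← Complex.exp_nat_mul, mul_assoc]

/-- Monomials of `R` that coincide as functions of `t` also coincide at `(n, μ^n)`, by
`SameRelations`. Vanishing on the half-line makes the coefficients of each class sum to zero, and
this yields the conclusion for negative `n` as well. -/
theorem eval_zpow_of_eval_exp {s : ℕ} {ν μ : Fin s → ℂ} (h : SameRelations ν μ)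
    (R : MvPolynomial (Option (Fin s)) ℂ)
    (hR : ∀ t : ℝ, 0 ≤ t →
      MvPolynomial.eval (fun o => o.elim (t : ℂ) fun l => Complex.exp (ν l * t)) R = 0) (n : ℤ) :
    MvPolynomial.eval (fun o => o.elim (n : ℂ) fun l => μ l ^ n) R = 0 := by
  rw [eval_elim_eq]
  refine sum_eq_zero_of_exp R.support _ (fun e => ∑ l, (e (some l) : ℂ) * ν l) _
    (fun e => e none) (fun t ht => ?_) ?_
  · rw [← hR t ht, eval_elim_eq]
    simp only [prod_exp_mul_pow]
  · intro i j hij hk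
    have h1 : ∀ e : Option (Fin s) →₀ ℕ,
        ∏ l, (μ l ^ n) ^ e (some l) = (∏ l, μ l ^ e (some l)) ^ n := by
      intro e
      rw [← Finset.prod_zpow]
      refine Finset.prod_congr rfl fun l _ => ?_
      rw [← zpow_natCast, ← zpow_natCast, ← _root_.zpow_mul, ← _root_.zpow_mul, mul_comm]
    simp only [h1, (h _ _).1 hij, hk]

/-- The same argument in the other direction; nonzero `μ` are needed for the independence of the
geometric sequences. -/
theorem eval_exp_of_eval_pow {s : ℕ} {ν μ : Fin s → ℂ} (h : SameRelations ν μ)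
    (hμ : ∀ l, μ l ≠ 0) (R : MvPolynomial (Option (Fin s)) ℂ)
    (hR : ∀ n : ℕ, MvPolynomial.eval (fun o => o.elim (n : ℂ) fun l => μ l ^ n) R = 0) (t : ℝ) :
    MvPolynomial.eval (fun o => o.elim (t : ℂ) fun l => Complex.exp (ν l * t)) R = 0 := by
  rw [eval_elim_eq]
  refine sum_eq_zero_of_geom R.support _ (fun e => ∏ l, μ l ^ e (some l)) _
    (fun e => e none) (fun e _ => Finset.prod_ne_zero_iff.2 fun l _ => pow_ne_zero _ (hμ l))
    (fun n => ?_) ?_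
  · rw [← hR n, eval_elim_eq]
    refine Finset.sum_congr rfl fun e _ => ?_
    congr 2
    rw [← Finset.prod_pow]
    exact Finset.prod_congr rfl fun l _ => by rw [← pow_mul, ← pow_mul, mul_comm]
  · intro i j hij hk
    simp only [prod_exp_mul_pow, (h _ _).2 hij, hk]

/-! ### Spectral data for a pair of commuting matrices -/

/-- The complexification of a real matrix. -/
def complexify {d : ℕ} : Matrix (Fin d) (Fin d) ℝ →+* Matrix (Fin d) (Fin d) ℂ :=
  Complex.ofRealHom.mapMatrix

theorem complexify_apply {d : ℕ} (M : Matrix (Fin d) (Fin d) ℝ) (i j : Fin d) :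
    complexify M i j = (M i j : ℂ) := rfl

theorem complexify_injective {d : ℕ} :
    Function.Injective (complexify : Matrix (Fin d) (Fin d) ℝ →+* _) := by
  intro M N h
  ext i j
  have := congrFun (congrFun h i) j
  simpa [complexify_apply] using this

/-- `W l k = (A - ν l) ^ k * W l 0 / k!`, where the columns of `W l 0` are generalized eigenvectors
of `A` that sum up to the standard basis, and `B` acts on them as `μ l * exp (A - ν l)`. -/
structure SpectralData {d s : ℕ} (A B : Matrix (Fin d) (Fin d) ℝ) (ν μ : Fin s → ℂ)
    (W : Fin s → ℕ → Matrix (Fin d) (Fin d) ℂ) : Prop where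
  chain : ∀ l, ∀ k < d,
    ((k : ℂ) + 1) • W l (k + 1) = (complexify A - ν l • 1) * W l k
  chain_end : ∀ l, W l d = 0
  sum_eq : ∑ l, W l 0 = 1
  act : ∀ l, complexify B * W l 0 = μ l • ∑ k ∈ Finset.range d, W l k
  comm : A * B = B * A

/-! ### Exponentials of matrices acting on generalized eigenvectors. -/

section matrixExp

attribute [local instance] Matrix.linftyOpNormedRing Matrix.linftyOpNormedAlgebra

/-- On the columns of `E` the matrix `X` is nilpotent, so the exponential series breaks off. -/
theorem exp_mul_of_pow_mul_eq_zero {d : ℕ} (X E : Matrix (Fin d) (Fin d) ℂ) (K : ℕ)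
    (h : X ^ K * E = 0) :
    NormedSpace.exp X * E =
      ∑ k ∈ Finset.range K, ((k.factorial : ℂ)⁻¹) • (X ^ k * E) := by
  have h1 := (NormedSpace.exp_series_hasSum_exp' (𝕂 := ℂ) X).mul_right E
  refine h1.unique ?_
  have h2 : ∀ k ∉ Finset.range K, (((k.factorial : ℂ)⁻¹) • X ^ k) * E = 0 := by
    intro k hk
    obtain ⟨j, rfl⟩ := Nat.exists_eq_add_of_le (not_lt.1 (Finset.mem_range.not.1 hk))
    rw [add_comm, pow_add, smul_mul_assoc, mul_assoc, h, mul_zero, smul_zero]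
  simp only [smul_mul_assoc] at h2 ⊢
  exact hasSum_sum_of_ne_finset_zero h2

theorem complexify_exp {d : ℕ} (A : Matrix (Fin d) (Fin d) ℝ) :
    complexify (NormedSpace.exp A) = NormedSpace.exp (complexify A) :=
  NormedSpace.map_exp complexify
    (continuous_id.matrix_map Complex.continuous_ofReal) A

theorem exp_smul_eq {d : ℕ} (A : Matrix (Fin d) (Fin d) ℂ) (ν z : ℂ) :
    NormedSpace.exp (z • A) =
      Complex.exp (ν * z) • NormedSpace.exp (z • (A - ν • (1 : Matrix (Fin d) (Fin d) ℂ))) := by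
  have h1 : z • A = algebraMap ℂ _ (ν * z) + z • (A - ν • (1 : Matrix (Fin d) (Fin d) ℂ)) := by
    rw [Algebra.algebraMap_eq_smul_one, smul_sub, smul_smul, mul_comm ν z]
    abel
  have h2 : NormedSpace.exp (algebraMap ℂ (Matrix (Fin d) (Fin d) ℂ) (ν * z)) =
      algebraMap ℂ (Matrix (Fin d) (Fin d) ℂ) (NormedSpace.exp (ν * z)) :=
    (NormedSpace.algebraMap_exp_comm (ν * z)).symm
  rw [h1, Matrix.exp_add_of_commute _ _ (Algebra.commute_algebraMap_left _ _), h2,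
    ← Complex.exp_eq_exp_ℂ,
    Algebra.algebraMap_eq_smul_one, smul_mul_assoc, one_mul]

theorem commute_exp {d : ℕ} {X Y : Matrix (Fin d) (Fin d) ℂ} (h : Commute Y X) :
    Commute Y (NormedSpace.exp X) := h.exp_right

theorem exp_add_one_smul {d : ℕ} (X : Matrix (Fin d) (Fin d) ℂ) (z : ℂ) :
    NormedSpace.exp ((z + 1) • X) = NormedSpace.exp (z • X) * NormedSpace.exp X := by
  rw [add_smul, one_smul, Matrix.exp_add_of_commute _ _ ((Commute.refl X).smul_left z)]

end matrixExp

namespace SpectralData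

variable {d s : ℕ} {A B : Matrix (Fin d) (Fin d) ℝ} {ν μ : Fin s → ℂ}
  {W : Fin s → ℕ → Matrix (Fin d) (Fin d) ℂ}

theorem pow_mul (h : SpectralData A B ν μ W) (l : Fin s) (k : ℕ) (hk : k ≤ d) :
    (complexify A - ν l • 1) ^ k * W l 0 = (k.factorial : ℂ) • W l k := by
  induction k with
  | zero => simp
  | succ k ih =>
    rw [pow_succ', mul_assoc, ih (by omega), mul_smul_comm, ← h.chain l k (by omega), smul_smul,
      Nat.factorial_succ]
    push_cast
    rw [mul_comm]

theorem exp_mul (h : SpectralData A B ν μ W) (l : Fin s) (z : ℂ) :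
    NormedSpace.exp (z • (complexify A - ν l • (1 : Matrix (Fin d) (Fin d) ℂ))) * W l 0 =
      ∑ k ∈ Finset.range d, z ^ k • W l k := by
  rw [exp_mul_of_pow_mul_eq_zero _ _ d
    (by rw [smul_pow, smul_mul_assoc, h.pow_mul l d le_rfl, h.chain_end]; simp)]
  refine Finset.sum_congr rfl fun k hk => ?_
  rw [smul_pow, smul_mul_assoc, h.pow_mul l k (Finset.mem_range.1 hk).le, smul_comm (z ^ k),
    smul_smul, inv_mul_cancel₀ (by exact_mod_cast k.factorial_ne_zero), one_smul]

/-- The common form of the elements of the two groups. -/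
def form (W : Fin s → ℕ → Matrix (Fin d) (Fin d) ℂ) (z : ℂ) (y : Fin s → ℂ) :
    Matrix (Fin d) (Fin d) ℂ :=
  ∑ l, y l • ∑ k ∈ Finset.range d, z ^ k • W l k

theorem complexify_exp_smul (h : SpectralData A B ν μ W) (t : ℝ) :
    complexify (NormedSpace.exp (t • A)) = form W t fun l => Complex.exp (ν l * t) := by
  have h1 : complexify (t • A) = (t : ℂ) • complexify A := by
    ext i j; simp [complexify_apply]
  rw [complexify_exp, h1, ← mul_one (NormedSpace.exp _), ← h.sum_eq, Finset.mul_sum, form]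
  refine Finset.sum_congr rfl fun l _ => ?_
  rw [exp_smul_eq _ (ν l), smul_mul_assoc, h.exp_mul]

/-- As `B` commutes with `A`, it passes through `exp (n (A - ν_l))`. On `W l 0` it acts as `μ_l exp
(A - ν_l)`, which raises the exponent by one. Negative `n` are included and provide the inverse of
`B`. -/
theorem mul_form (h : SpectralData A B ν μ W) (hμ : ∀ l, μ l ≠ 0) (n : ℤ) :
    complexify B * form W n (fun l => μ l ^ n) =
      form W (n + 1 : ℤ) (fun l => μ l ^ (n + 1)) := by
  rw [form, Finset.mul_sum, form]
  refine Finset.sum_congr rfl fun l _ => ?_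
  have hc : Commute (complexify B) (complexify A - ν l • 1) := by
    refine Commute.sub_right ?_ ((Commute.one_right _).smul_right _)
    rw [commute_iff_eq, ← map_mul, ← map_mul, h.comm]
  have h1 := h.exp_mul l 1
  simp only [one_smul, one_pow] at h1
  rw [mul_smul_comm, ← h.exp_mul, ← mul_assoc, (commute_exp (hc.smul_right (n : ℂ))).eq,
    mul_assoc, h.act, ← h1, mul_smul_comm, smul_smul, zpow_add_one₀ (hμ l), ← mul_assoc,
    ← exp_add_one_smul, ← h.exp_mul]
  push_cast
  rfl

theorem form_zero (h : SpectralData A B ν μ W) :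
    form W (0 : ℤ) (fun l => μ l ^ (0 : ℤ)) = 1 := by
  rw [← h.sum_eq, form]
  refine Finset.sum_congr rfl fun l _ => ?_
  rw [zpow_zero, one_smul]
  rcases d with _ | d
  · exact Subsingleton.elim _ _
  · rw [Finset.sum_range_succ', Finset.sum_eq_zero (by simp)]
    simp

/-- `form` at `-1` is a right inverse of the complexification of `B`. -/
theorem isUnit (h : SpectralData A B ν μ W) (hμ : ∀ l, μ l ≠ 0) : IsUnit B := by
  have h1 := h.mul_form hμ (-1)
  rw [neg_add_cancel, h.form_zero] at h1
  have h2 := congrArg Matrix.det h1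
  rw [Matrix.det_mul, Matrix.det_one] at h2
  have h3 : (complexify B).det = (B.det : ℂ) := (RingHom.map_det Complex.ofRealHom B).symm
  rw [Matrix.isUnit_iff_isUnit_det, isUnit_iff_ne_zero]
  rintro h4
  rw [h3, h4] at h2
  simp at h2

theorem complexify_zpow (h : SpectralData A B ν μ W) (hμ : ∀ l, μ l ≠ 0) (U : GL (Fin d) ℝ)
    (hU : (U : Matrix (Fin d) (Fin d) ℝ) = B) (n : ℤ) :
    complexify ((U ^ n : GL (Fin d) ℝ) : Matrix (Fin d) (Fin d) ℝ) =
      form W n fun l => μ l ^ n := by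
  have hs : ∀ n : ℤ, complexify ((U ^ (n + 1) : GL (Fin d) ℝ) : Matrix (Fin d) (Fin d) ℝ) =
      complexify B * complexify ((U ^ n : GL (Fin d) ℝ) : Matrix (Fin d) (Fin d) ℝ) := by
    intro n
    rw [add_comm, _root_.zpow_add, _root_.zpow_one, Units.val_mul, map_mul, hU]
  induction n using Int.induction_on with
  | zero => rw [h.form_zero]; simp
  | succ n ih => rw [hs, ih, h.mul_form hμ]
  | pred n ih =>
    have h1 := hs (-n - 1)
    have h2 := h.mul_form hμ (-n - 1)
    rw [sub_add_cancel] at h1 h2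
    rw [ih, ← h2] at h1
    exact ((h.isUnit hμ).map complexify).mul_left_cancel h1.symm

/-- Polynomial functions of the elements of the two groups. -/
theorem exists_polynomial (W : Fin s → ℕ → Matrix (Fin d) (Fin d) ℂ)
    (P : MvPolynomial (Fin d × Fin d) ℂ) :
    ∃ R : MvPolynomial (Option (Fin s)) ℂ, ∀ z y,
      MvPolynomial.eval (fun ij => form W z y ij.1 ij.2) P =
        MvPolynomial.eval (fun o => o.elim z y) R := by
  refine ⟨MvPolynomial.bind₁ (fun ij => ∑ l, MvPolynomial.X (some l) *
    ∑ k ∈ Finset.range d, MvPolynomial.X none ^ k * MvPolynomial.C (W l k ij.1 ij.2)) P,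
    fun z y => ?_⟩
  rw [← MvPolynomial.coe_aeval_eq_eval, ← MvPolynomial.coe_aeval_eq_eval]
  simp only [RingHom.coe_coe]
  rw [MvPolynomial.aeval_bind₁]
  congr 2
  funext ij
  simp [form, Matrix.sum_apply]

theorem eval_zpow_eq_zero (h : SpectralData A B ν μ W) (hμ : ∀ l, μ l ≠ 0)
    (hr : SameRelations ν μ) (U : GL (Fin d) ℝ) (hU : (U : Matrix (Fin d) (Fin d) ℝ) = B)
    (P : MvPolynomial (Fin d × Fin d) ℂ)
    (hP : ∀ t : ℝ, 0 ≤ t →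
      MvPolynomial.eval (fun ij => complexify (NormedSpace.exp (t • A)) ij.1 ij.2) P = 0)
    (n : ℤ) :
    MvPolynomial.eval
      (fun ij => complexify ((U ^ n : GL (Fin d) ℝ) : Matrix (Fin d) (Fin d) ℝ) ij.1 ij.2) P =
        0 := by
  obtain ⟨R, hR⟩ := exists_polynomial W P
  simp only [h.complexify_exp_smul, h.complexify_zpow hμ U hU, hR] at hP ⊢
  exact eval_zpow_of_eval_exp hr R hP n

/-- Natural powers suffice as a hypothesis; these are the only ones that a self-loop produces. -/
theorem eval_exp_eq_zero (h : SpectralData A B ν μ W) (hμ : ∀ l, μ l ≠ 0)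
    (hr : SameRelations ν μ) (U : GL (Fin d) ℝ) (hU : (U : Matrix (Fin d) (Fin d) ℝ) = B)
    (P : MvPolynomial (Fin d × Fin d) ℂ)
    (hP : ∀ n : ℕ, MvPolynomial.eval
      (fun ij => complexify ((U ^ n : GL (Fin d) ℝ) : Matrix (Fin d) (Fin d) ℝ) ij.1 ij.2) P =
        0) (t : ℝ) :
    MvPolynomial.eval (fun ij => complexify (NormedSpace.exp (t • A)) ij.1 ij.2) P = 0 := by
  obtain ⟨R, hR⟩ := exists_polynomial W P
  have h1 : ∀ n : ℕ, complexify ((U ^ n : GL (Fin d) ℝ) : Matrix (Fin d) (Fin d) ℝ) =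
      form W n fun l => μ l ^ n := fun n => by
    have := h.complexify_zpow hμ U hU n
    simpa only [zpow_natCast, Int.cast_natCast] using this
  simp only [h.complexify_exp_smul, h1, hR] at hP ⊢
  exact eval_exp_of_eval_pow hr hμ R hP t

end SpectralData

theorem SpectralData.complexMatrixClosure_eq {d s : ℕ} {A B : Matrix (Fin d) (Fin d) ℝ}
    {ν μ : Fin s → ℂ} {W : Fin s → ℕ → Matrix (Fin d) (Fin d) ℂ}
    (h : SpectralData A B ν μ W) (hμ : ∀ l, μ l ≠ 0)
    (hr : SameRelations ν μ) (U : GL (Fin d) ℝ) (hU : (U : Matrix (Fin d) (Fin d) ℝ) = B) :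
    complexMatrixClosure (cyclicGroup U) = complexMatrixClosure (flowGroup A) := by
  unfold complexMatrixClosure zariskiClosure
  congr 1
  ext P
  simp only [MvPolynomial.mem_vanishingIdeal_iff]
  constructor
  · rintro hP _ ⟨_, ⟨t, rfl⟩, rfl⟩
    refine h.eval_exp_eq_zero hμ hr U hU P (fun n => ?_) t
    exact hP _ ⟨_, ⟨n, rfl⟩, rfl⟩
  · rintro hP _ ⟨_, ⟨n, rfl⟩, rfl⟩
    refine h.eval_zpow_eq_zero hμ hr U hU P (fun t _ => ?_) n
    exact hP _ ⟨_, ⟨t, rfl⟩, rfl⟩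

/-! ### From vanishing on matrix groups to vanishing on orbits of vectors. -/

/-- The polynomial function `M ↦ p (M x)`. -/
def orbitPolynomial {K : Type*} [Field K] {d : ℕ} (p : MvPolynomial (Fin d) K) (x : Fin d → K) :
    MvPolynomial (Fin d × Fin d) K :=
  MvPolynomial.bind₁ (fun i => ∑ j, MvPolynomial.X (i, j) * MvPolynomial.C (x j)) p

theorem eval_orbitPolynomial {K : Type*} [Field K] {d : ℕ} (p : MvPolynomial (Fin d) K)
    (x : Fin d → K) (M : Matrix (Fin d) (Fin d) K) :
    MvPolynomial.eval (fun ij => M ij.1 ij.2) (orbitPolynomial p x) =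
      MvPolynomial.eval (M *ᵥ x) p := by
  rw [orbitPolynomial, ← MvPolynomial.coe_aeval_eq_eval, ← MvPolynomial.coe_aeval_eq_eval]
  simp only [RingHom.coe_coe]
  rw [MvPolynomial.aeval_bind₁]
  congr 2
  funext i
  simp [Matrix.mulVec, dotProduct]

theorem eval_complexify_orbitPolynomial {d : ℕ} (p : MvPolynomial (Fin d) ℝ)
    (x : Fin d → ℝ) (M : Matrix (Fin d) (Fin d) ℝ) :
    MvPolynomial.eval (fun ij => complexify M ij.1 ij.2)
        (MvPolynomial.map Complex.ofRealHom (orbitPolynomial p x)) =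
      (MvPolynomial.eval (M *ᵥ x) p : ℂ) := by
  rw [← eval_orbitPolynomial, MvPolynomial.eval_map]
  have := MvPolynomial.eval₂_comp_left Complex.ofRealHom (RingHom.id ℝ) (fun ij => M ij.1 ij.2)
    (orbitPolynomial p x)
  rw [RingHom.comp_id] at this
  exact this.symm

/-- For fixed `x`, the condition `p (M x) = 0` is polynomial in `M`, so it passes from the forward
flow to the group generated by `B`. One application of the loop is the case `n = 1`. -/
theorem SpectralData.eval_pow_mulVec {d s : ℕ} {A B : Matrix (Fin d) (Fin d) ℝ}
    {ν μ : Fin s → ℂ} {W : Fin s → ℕ → Matrix (Fin d) (Fin d) ℂ}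
    (h : SpectralData A B ν μ W) (hμ : ∀ l, μ l ≠ 0)
    (hr : SameRelations ν μ) (U : GL (Fin d) ℝ) (hU : (U : Matrix (Fin d) (Fin d) ℝ) = B)
    (p : MvPolynomial (Fin d) ℝ) (x : Fin d → ℝ)
    (hp : ∀ t : ℝ, 0 ≤ t → MvPolynomial.eval (NormedSpace.exp (t • A) *ᵥ x) p = 0) :
    MvPolynomial.eval (B *ᵥ x) p = 0 := by
  have := h.eval_zpow_eq_zero hμ hr U hU
    (MvPolynomial.map Complex.ofRealHom (orbitPolynomial p x)) (fun t ht => by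
      rw [eval_complexify_orbitPolynomial, hp t ht, Complex.ofReal_zero]) 1
  rw [eval_complexify_orbitPolynomial, _root_.zpow_one, hU] at this
  exact_mod_cast this

theorem SpectralData.eval_exp_mulVec {d s : ℕ} {A B : Matrix (Fin d) (Fin d) ℝ}
    {ν μ : Fin s → ℂ} {W : Fin s → ℕ → Matrix (Fin d) (Fin d) ℂ}
    (h : SpectralData A B ν μ W) (hμ : ∀ l, μ l ≠ 0)
    (hr : SameRelations ν μ) (U : GL (Fin d) ℝ) (hU : (U : Matrix (Fin d) (Fin d) ℝ) = B)
    (p : MvPolynomial (Fin d) ℝ) (x : Fin d → ℝ)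
    (hp : ∀ n : ℕ, MvPolynomial.eval ((B ^ n) *ᵥ x) p = 0) (t : ℝ) :
    MvPolynomial.eval (NormedSpace.exp (t • A) *ᵥ x) p = 0 := by
  have := h.eval_exp_eq_zero hμ hr U hU
    (MvPolynomial.map Complex.ofRealHom (orbitPolynomial p x)) (fun n => by
      rw [eval_complexify_orbitPolynomial, Units.val_pow_eq_pow_val, hU, hp,
        Complex.ofReal_zero]) t
  rw [eval_complexify_orbitPolynomial] at this
  exact_mod_cast this

/-! ### Invariants -/

theorem subset_zariskiClosure {K σ : Type*} [Field K] (S : Set (σ → K)) :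
    S ⊆ zariskiClosure S := fun _ hx _ hp => hp _ hx

theorem zariskiClosure_subset {K σ : Type*} [Field K] {S T : Set (σ → K)}
    (h : S ⊆ zariskiClosure T) : zariskiClosure S ⊆ zariskiClosure T := by
  intro x hx p hp
  refine hx p ?_
  rw [MvPolynomial.mem_vanishingIdeal_iff]
  exact fun y hy => h hy p hp

theorem mem_zariskiClosure {K σ : Type*} [Field K] {S : Set (σ → K)} {x : σ → K} :
    x ∈ zariskiClosure S ↔
      ∀ p : MvPolynomial σ K, (∀ y ∈ S, MvPolynomial.eval y p = 0) → MvPolynomial.eval x p = 0 := by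
  simp [zariskiClosure, MvPolynomial.mem_vanishingIdeal_iff]

/-- Linear maps are Zariski continuous: `p (M y)` is a polynomial in `y`. -/
theorem mulVec_mem_zariskiClosure {d : ℕ} {S T : Set (Fin d → ℝ)} {M : Matrix (Fin d) (Fin d) ℝ}
    (h : ∀ x ∈ S, M *ᵥ x ∈ zariskiClosure T) {x : Fin d → ℝ} (hx : x ∈ zariskiClosure S) :
    M *ᵥ x ∈ zariskiClosure T := by
  rw [mem_zariskiClosure] at hx ⊢
  intro p hp
  have key : ∀ y, MvPolynomial.eval y (MvPolynomial.bind₁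
      (fun i => ∑ j, MvPolynomial.C (M i j) * MvPolynomial.X j) p) =
      MvPolynomial.eval (M *ᵥ y) p := by
    intro y
    rw [← MvPolynomial.coe_aeval_eq_eval, ← MvPolynomial.coe_aeval_eq_eval]
    simp only [RingHom.coe_coe]
    rw [MvPolynomial.aeval_bind₁]
    congr 2
    funext i
    simp [Matrix.mulVec, dotProduct]
  rw [← key]
  refine hx _ fun y hy => ?_
  rw [key]
  exact mem_zariskiClosure.1 (h y hy) p hp

namespace HybridAutomaton

variable {Q : Type*} {d : ℕ}

theorem init_subset_collecting (𝒜 : HybridAutomaton Q d) (q : Q) :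
    𝒜.init q ⊆ 𝒜.collecting q := by
  have := 𝒜.step.map_lfp
  intro x hx
  rw [collecting, ← this]
  exact Or.inl (Or.inl hx)

theorem exp_mulVec_mem_collecting (𝒜 : HybridAutomaton Q d) (q : Q) {t : ℝ} (ht : 0 ≤ t)
    {x : Fin d → ℝ} (hx : x ∈ 𝒜.collecting q) :
    NormedSpace.exp (t • 𝒜.flow q) *ᵥ x ∈ 𝒜.collecting q := by
  have := 𝒜.step.map_lfp
  rw [collecting, ← this]
  exact Or.inl (Or.inr ⟨t, ht, x, hx, rfl⟩)

theorem mulVec_mem_collecting (𝒜 : HybridAutomaton Q d) {p q : Q}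
    {M : Matrix (Fin d) (Fin d) ℝ} (he : (p, M, q) ∈ 𝒜.edges)
    {x : Fin d → ℝ} (hx : x ∈ 𝒜.collecting p) : M *ᵥ x ∈ 𝒜.collecting q := by
  have := 𝒜.step.map_lfp
  rw [collecting, ← this]
  exact Or.inr ⟨p, M, he, x, hx, rfl⟩

theorem collecting_subset (𝒜 : HybridAutomaton Q d) (V : Q → Set (Fin d → ℝ))
    (h1 : ∀ q, 𝒜.init q ⊆ V q)
    (h2 : ∀ q, ∀ t : ℝ, 0 ≤ t → ∀ x ∈ V q, NormedSpace.exp (t • 𝒜.flow q) *ᵥ x ∈ V q)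
    (h3 : ∀ p M q, (p, M, q) ∈ 𝒜.edges → ∀ x ∈ V p, M *ᵥ x ∈ V q) (q : Q) :
    𝒜.collecting q ⊆ V q := by
  refine OrderHom.lfp_le 𝒜.step (a := V) ?_ q
  rintro q y ((hy | ⟨t, ht, x, hx, rfl⟩) | ⟨p, B, he, x, hx, rfl⟩)
  exacts [h1 q hy, h2 q t ht x hx, h3 p B q he x hx]

/-- Replacing the flow in each location by a self-loop with the same polynomial relations does not
change the strongest algebraic invariant. -/
theorem strongestInvariant_eq_of_loops (𝒜 𝒜' : HybridAutomaton Q d)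
    (B : Q → Matrix (Fin d) (Fin d) ℝ) (hflow : ∀ q, 𝒜'.flow q = 0) (hinit : 𝒜'.init = 𝒜.init)
    (hedges : 𝒜'.edges = 𝒜.edges ∪ Set.range fun q => (q, B q, q))
    (hB : ∀ q (p : MvPolynomial (Fin d) ℝ) x, (∀ t : ℝ, 0 ≤ t →
      MvPolynomial.eval (NormedSpace.exp (t • 𝒜.flow q) *ᵥ x) p = 0) →
        MvPolynomial.eval (B q *ᵥ x) p = 0)
    (hA : ∀ q (p : MvPolynomial (Fin d) ℝ) x, (∀ n : ℕ, MvPolynomial.eval ((B q ^ n) *ᵥ x) p = 0) →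
      ∀ t : ℝ, MvPolynomial.eval (NormedSpace.exp (t • 𝒜.flow q) *ᵥ x) p = 0) :
    𝒜'.strongestInvariant = 𝒜.strongestInvariant := by
  funext q
  refine Set.Subset.antisymm (zariskiClosure_subset ?_) (zariskiClosure_subset ?_)
  -- By leastness of the semantics it is enough that the closures for one automaton contain the
  -- initial states and are stable under all moves of the other.
  · refine 𝒜'.collecting_subset 𝒜.strongestInvariant ?_ ?_ ?_ q
    · intro q
      rw [hinit]
      exact (𝒜.init_subset_collecting q).trans (subset_zariskiClosure _)
    · intro q t _ x hx
      rw [hflow, smul_zero, NormedSpace.exp_zero, one_mulVec]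
      exact hx
    · intro p M q he x hx
      refine mulVec_mem_zariskiClosure (fun y hy => ?_) hx
      rw [hedges] at he
      rcases he with he | ⟨q', he⟩
      · exact subset_zariskiClosure _ (𝒜.mulVec_mem_collecting he hy)
      · simp only [Prod.mk.injEq] at he
        obtain ⟨rfl, rfl, rfl⟩ := he
        rw [mem_zariskiClosure]
        exact fun P hP => hB _ P y fun t ht => hP _ (𝒜.exp_mulVec_mem_collecting _ ht hy)
  · refine 𝒜.collecting_subset 𝒜'.strongestInvariant ?_ ?_ ?_ q
    · intro q
      rw [← hinit]
      exact (𝒜'.init_subset_collecting q).trans (subset_zariskiClosure _)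
    · intro q t _ x hx
      refine mulVec_mem_zariskiClosure (fun y hy => ?_) hx
      -- Iterating the loop reaches all natural powers of `B q`, and a polynomial that vanishes
      -- there vanishes along the flow.
      have hn : ∀ n : ℕ, (B q ^ n) *ᵥ y ∈ 𝒜'.collecting q := by
        intro n
        induction n with
        | zero => simpa using hy
        | succ n ih =>
          rw [pow_succ', ← Matrix.mulVec_mulVec]
          exact 𝒜'.mulVec_mem_collecting (by rw [hedges]; exact Or.inr ⟨q, rfl⟩) ih
      rw [mem_zariskiClosure]
      exact fun P hP => hA q P y (fun n => hP _ (hn n)) t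
    · intro p M q he x hx
      refine mulVec_mem_zariskiClosure (fun y hy => ?_) hx
      exact subset_zariskiClosure _ (𝒜'.mulVec_mem_collecting (by rw [hedges]; exact Or.inl he) hy)

end HybridAutomaton

/-! ### Primitive recursive integer arithmetic -/

namespace Primrec

theorem encode_natCast_int (n : ℕ) : Encodable.encode (n : ℤ) = 2 * n := rfl

theorem encode_negSucc_int (n : ℕ) : Encodable.encode (Int.negSucc n) = 2 * n + 1 := rfl

theorem int_natCast : Primrec (fun n : ℕ => (n : ℤ)) := by
  refine Primrec.encode_iff.1 ?_
  exact (Primrec.nat_mul.comp (.const 2) .id).of_eq fun n => (encode_natCast_int n).symm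

theorem int_negSucc : Primrec (fun n : ℕ => Int.negSucc n) := by
  refine Primrec.encode_iff.1 ?_
  exact (Primrec.succ.comp (Primrec.nat_mul.comp (.const 2) .id)).of_eq
    fun n => (encode_negSucc_int n).symm

/-- The parity of the code of an integer tells its sign, and half of the code its size. -/
theorem int_toNat : Primrec Int.toNat := by
  have h : Primrec fun z : ℤ => if Encodable.encode z % 2 = 0 then Encodable.encode z / 2 else 0 :=
    Primrec.ite (Primrec.eq.comp (Primrec.nat_mod.comp .encode (.const 2)) (.const 0))
      (Primrec.nat_div.comp .encode (.const 2)) (.const 0)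
  refine h.of_eq fun z => ?_
  rcases z with n | n
  · simp [encode_natCast_int]
  · rw [encode_negSucc_int, if_neg (by omega)]; rfl

theorem int_neg_toNat : Primrec (fun z : ℤ => (-z).toNat) := by
  have h : Primrec fun z : ℤ =>
      if Encodable.encode z % 2 = 0 then 0 else Encodable.encode z / 2 + 1 :=
    Primrec.ite (Primrec.eq.comp (Primrec.nat_mod.comp .encode (.const 2)) (.const 0))
      (.const 0) (Primrec.succ.comp (Primrec.nat_div.comp .encode (.const 2)))
  refine h.of_eq fun z => ?_
  rcases z with n | n
  · simp [encode_natCast_int]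
  · rw [encode_negSucc_int, if_neg (by omega)]
    have : (-Int.negSucc n).toNat = n + 1 := rfl
    omega

theorem int_subNatNat : Primrec₂ (fun m n : ℕ => (m : ℤ) - n) := by
  have h : Primrec₂ fun m n : ℕ => if n ≤ m then ((m - n : ℕ) : ℤ) else Int.negSucc (n - m - 1) :=
    Primrec.ite (Primrec.nat_le.comp .snd .fst) (int_natCast.comp Primrec.nat_sub)
      (int_negSucc.comp (Primrec.nat_sub.comp (Primrec.nat_sub.comp .snd .fst) (.const 1)))
  refine h.of_eq fun m n => ?_
  split_ifs with h <;> omega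

/-- Every integer `a` is the difference of the natural numbers `a.toNat` and `(-a).toNat`; this
reduces integer arithmetic to natural arithmetic. -/
theorem int_add : Primrec₂ (fun a b : ℤ => a + b) := by
  have h : Primrec₂ fun a b : ℤ =>
      ((a.toNat + b.toNat : ℕ) : ℤ) - (((-a).toNat + (-b).toNat : ℕ) : ℤ) :=
    int_subNatNat.comp
      (Primrec.nat_add.comp (int_toNat.comp .fst) (int_toNat.comp .snd))
      (Primrec.nat_add.comp (int_neg_toNat.comp .fst) (int_neg_toNat.comp .snd))
  exact h.of_eq fun a b => by omega

theorem int_mul : Primrec₂ (fun a b : ℤ => a * b) := by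
  have h : Primrec₂ fun a b : ℤ =>
      ((a.toNat * b.toNat + (-a).toNat * (-b).toNat : ℕ) : ℤ) -
        ((a.toNat * (-b).toNat + (-a).toNat * b.toNat : ℕ) : ℤ) :=
    int_subNatNat.comp
      (Primrec.nat_add.comp
        (Primrec.nat_mul.comp (int_toNat.comp .fst) (int_toNat.comp .snd))
        (Primrec.nat_mul.comp (int_neg_toNat.comp .fst) (int_neg_toNat.comp .snd)))
      (Primrec.nat_add.comp
        (Primrec.nat_mul.comp (int_toNat.comp .fst) (int_neg_toNat.comp .snd))
        (Primrec.nat_mul.comp (int_neg_toNat.comp .fst) (int_toNat.comp .snd)))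
  refine h.of_eq fun a b => ?_
  have ha : a = (a.toNat : ℤ) - ((-a).toNat : ℤ) := by omega
  have hb : b = (b.toNat : ℤ) - ((-b).toNat : ℤ) := by omega
  conv_rhs => rw [ha, hb]
  push_cast
  ring

theorem int_neg : Primrec (fun a : ℤ => -a) :=
  (int_mul.comp (.const (-1)) .id).of_eq fun a => by simp

theorem int_sub : Primrec₂ (fun a b : ℤ => a - b) :=
  (int_add.comp .fst (int_neg.comp .snd)).of_eq fun x => (sub_eq_add_neg x.1 x.2).symm

theorem int_natAbs : Primrec Int.natAbs :=
  (Primrec.nat_add.comp int_toNat int_neg_toNat).of_eq fun a => by omega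

theorem int_lt : PrimrecRel (fun a b : ℤ => a < b) :=
  (Primrec.nat_lt.comp (.const 0) (int_toNat.comp (int_sub.comp .snd .fst))).of_eq
    fun x => by omega

theorem pow_of_mul {R : Type*} [Monoid R] [Primcodable R] (hmul : Primrec₂ fun a b : R => a * b) :
    Primrec₂ (fun (a : R) (n : ℕ) => a ^ n) := by
  have h : Primrec₂ fun (a : R) (n : ℕ) => n.rec (motive := fun _ => R) 1 fun _ r => r * a :=
    Primrec.nat_rec' (f := fun p : R × ℕ => p.2) (g := fun _ => (1 : R))
      (h := fun p q => q.2 * p.1) .snd (.const 1)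
      (hmul.comp (Primrec.snd.comp .snd) (Primrec.fst.comp .fst))
  refine h.of_eq fun a n => ?_
  induction n with
  | zero => simp
  | succ n ih => simp [pow_succ, ← ih]

end Primrec

/-- Gaussian integers as pairs of integers. -/
def gaussianEquiv : GaussianInt ≃ ℤ × ℤ where
  toFun z := (z.re, z.im)
  invFun p := ⟨p.1, p.2⟩
  left_inv _ := rfl
  right_inv _ := rfl

instance : Primcodable GaussianInt := Primcodable.ofEquiv _ gaussianEquiv

namespace Primrec

theorem gaussian_re : Primrec (fun z : GaussianInt => z.re) :=
  Primrec.fst.comp (Primrec.of_equiv (e := gaussianEquiv))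

theorem gaussian_im : Primrec (fun z : GaussianInt => z.im) :=
  Primrec.snd.comp (Primrec.of_equiv (e := gaussianEquiv))

theorem gaussian_mk : Primrec₂ (fun a b : ℤ => (⟨a, b⟩ : GaussianInt)) :=
  Primrec.of_equiv_symm (e := gaussianEquiv)

theorem gaussian_add : Primrec₂ (fun a b : GaussianInt => a + b) :=
  gaussian_mk.comp
    (int_add.comp (gaussian_re.comp .fst) (gaussian_re.comp .snd))
    (int_add.comp (gaussian_im.comp .fst) (gaussian_im.comp .snd))

theorem gaussian_mul : Primrec₂ (fun a b : GaussianInt => a * b) := by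
  have h : Primrec₂ fun a b : GaussianInt =>
      (⟨a.re * b.re - a.im * b.im, a.re * b.im + a.im * b.re⟩ : GaussianInt) :=
    gaussian_mk.comp
      (int_sub.comp
        (int_mul.comp (gaussian_re.comp .fst) (gaussian_re.comp .snd))
        (int_mul.comp (gaussian_im.comp .fst) (gaussian_im.comp .snd)))
      (int_add.comp
        (int_mul.comp (gaussian_re.comp .fst) (gaussian_im.comp .snd))
        (int_mul.comp (gaussian_im.comp .fst) (gaussian_re.comp .snd)))
  exact h.of_eq fun a b => by ext <;> (simp; try ring)

end Primrec

/-! ### Polynomials as lists of coefficients -/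

section listPoly

variable {R : Type*} [CommRing R]

/-- The polynomial with a given list of coefficients. -/
def listPoly (l : List R) : Polynomial R :=
  l.foldr (fun a p => Polynomial.C a + Polynomial.X * p) 0

/-- Addition of coefficient lists. -/
def listAdd (f g : List R) : List R :=
  (List.range (max f.length g.length)).map fun i => f.getD i 0 + g.getD i 0

/-- Multiplication of a coefficient list by a scalar. -/
def listScale (a : R) (f : List R) : List R := f.map fun x => a * x

/-- Subtraction of coefficient lists. -/
def listSub (f g : List R) : List R := listAdd f (listScale (-1) g)

/-- Multiplication of coefficient lists. -/
def listMul (f g : List R) : List R :=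
  f.foldr (fun a r => listAdd (listScale a g) (0 :: r)) []

/-- Sum of `n` coefficient lists. -/
def listSum (n : ℕ) (F : ℕ → List R) : List R :=
  (List.range n).foldr (fun k r => listAdd (F k) r) []

/-- The coefficient list of `b ^ (n - 1) * f (g / b)`, where `n` is the length of `f`. -/
def listHom (f g : List R) (b : R) : List R :=
  (f.foldr (fun a s => (listAdd (listScale a s.2) (listMul g s.1), listScale b s.2))
    (([], [1]) : List R × List R)).1

@[simp] theorem listPoly_nil : listPoly ([] : List R) = 0 := rfl

@[simp] theorem listPoly_cons (a : R) (l : List R) :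
    listPoly (a :: l) = Polynomial.C a + Polynomial.X * listPoly l := rfl

theorem coeff_listPoly (l : List R) (n : ℕ) : (listPoly l).coeff n = l.getD n 0 := by
  induction l generalizing n with
  | nil => simp
  | cons a l ih =>
    rcases n with _ | n
    · simp
    · simp [ih]

theorem listPoly_add (f g : List R) : listPoly (listAdd f g) = listPoly f + listPoly g := by
  ext n
  rw [Polynomial.coeff_add, coeff_listPoly, coeff_listPoly, coeff_listPoly, listAdd]
  by_cases h : n < max f.length g.length
  · simp [List.getD_eq_getElem?_getD, List.getElem?_map, List.getElem?_range h]
  · have h1 := le_max_left f.length g.length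
    have h2 := le_max_right f.length g.length
    rw [List.getD_eq_default _ _ (by simpa using not_lt.1 h), List.getD_eq_default _ _ (by omega),
      List.getD_eq_default _ _ (by omega), add_zero]

theorem listPoly_scale (a : R) (f : List R) :
    listPoly (listScale a f) = Polynomial.C a * listPoly f := by
  induction f with
  | nil => simp [listScale]
  | cons b f ih =>
    simp only [listScale, List.map_cons, listPoly_cons, Polynomial.C_mul] at ih ⊢
    rw [ih]; ring

theorem listPoly_sub (f g : List R) : listPoly (listSub f g) = listPoly f - listPoly g := by
  rw [listSub, listPoly_add, listPoly_scale]
  simp [sub_eq_add_neg]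

theorem listPoly_mul (f g : List R) : listPoly (listMul f g) = listPoly f * listPoly g := by
  induction f with
  | nil => simp [listMul]
  | cons a f ih =>
    have : listMul (a :: f) g = listAdd (listScale a g) (0 :: listMul f g) := rfl
    rw [this, listPoly_add, listPoly_scale, listPoly_cons, ih, listPoly_cons]
    simp; ring

theorem listPoly_sum (n : ℕ) (F : ℕ → List R) :
    listPoly (listSum n F) = ∑ k ∈ Finset.range n, listPoly (F k) := by
  have h : ∀ l : List ℕ, listPoly (l.foldr (fun k r => listAdd (F k) r) []) =
      (l.map fun k => listPoly (F k)).sum := by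
    intro l
    induction l with
    | nil => simp
    | cons a l ih => simp [listPoly_add, ih]
  rw [listSum, h]
  rfl

/-- The fold carries the homogenized value of the part already read, and the matching power of `b`.
The additional factor `φ b` on the left avoids the exponent `f.length - 1`, which would be wrong for
the empty list. -/
theorem eval₂_listHom {S : Type*} [CommRing S] (φ : R →+* S) (x y : S) (f g : List R) (b : R)
    (hy : φ b * y = (listPoly g).eval₂ φ x) :
    (listPoly (listHom f g b)).eval₂ φ x * φ b = φ b ^ f.length * (listPoly f).eval₂ φ y := by
  have h : ∀ f : List R, ∀ s, s = f.foldr (fun a s =>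
        (listAdd (listScale a s.2) (listMul g s.1), listScale b s.2))
        (([], [1]) : List R × List R) →
      (listPoly s.1).eval₂ φ x * φ b = φ b ^ f.length * (listPoly f).eval₂ φ y ∧
        (listPoly s.2).eval₂ φ x = φ b ^ f.length := by
    intro f
    induction f with
    | nil => rintro s rfl; simp
    | cons a f ih =>
      rintro s rfl
      obtain ⟨h1, h2⟩ := ih _ rfl
      simp only [List.foldr_cons, listPoly_add, listPoly_scale, listPoly_mul, List.length_cons,
        listPoly_cons, Polynomial.eval₂_add, Polynomial.eval₂_mul, Polynomial.eval₂_C,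
        Polynomial.eval₂_X, h2]
      refine ⟨?_, by rw [pow_succ']⟩
      rw [add_mul, mul_assoc ((listPoly g).eval₂ φ x), h1, ← hy]
      ring
  exact (h f _ rfl).1

/-- Coefficient lists may end in zeros, so equality of polynomials is tested on the entries of a
difference, not on the lists themselves. -/
theorem listPoly_eq_zero_iff (l : List R) : listPoly l = 0 ↔ ∀ a ∈ l, a = 0 := by
  induction l with
  | nil => simp
  | cons a l ih =>
    rw [List.forall_mem_cons, ← ih, listPoly_cons]
    constructor
    · intro h
      have h0 := congrArg (fun p => Polynomial.coeff p 0) h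
      simp only [Polynomial.coeff_add, Polynomial.coeff_C_zero, Polynomial.mul_coeff_zero,
        Polynomial.coeff_X_zero, zero_mul, add_zero, Polynomial.coeff_zero] at h0
      refine ⟨h0, ?_⟩
      ext n
      have := congrArg (fun p => Polynomial.coeff p (n + 1)) h
      simpa [Polynomial.coeff_C] using this
    · rintro ⟨rfl, h⟩
      simp [h]

theorem exists_listPoly (p : Polynomial R) (n : ℕ) (h : p.natDegree < n) :
    ∃ l : List R, l.length = n ∧ listPoly l = p := by
  refine ⟨(List.range n).map p.coeff, by simp, ?_⟩
  ext k
  rw [coeff_listPoly]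
  by_cases hk : k < n
  · simp [List.getD_eq_getElem?_getD, List.getElem?_map, List.getElem?_range hk]
  · rw [List.getD_eq_default _ _ (by simpa using hk),
      Polynomial.coeff_eq_zero_of_natDegree_lt (by omega)]

theorem map_listPoly {S : Type*} [CommRing S] (φ : R →+* S) (l : List R) :
    (listPoly l).map φ = listPoly (l.map φ) := by
  induction l with
  | nil => simp
  | cons a l ih => simp [ih]

theorem degree_listPoly_lt (l : List R) : (listPoly l).degree < l.length := by
  rw [Polynomial.degree_lt_iff_coeff_zero]
  intro m hm
  rw [coeff_listPoly, List.getD_eq_default _ _ hm]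

end listPoly

/-! ### Primitive recursiveness of the arithmetic of coefficient lists. -/

section primrec

variable {R : Type*} [CommRing R] [Primcodable R] {α : Type*} [Primcodable α]

theorem primrec_listAdd (ha : Primrec₂ fun a b : R => a + b) :
    Primrec₂ (listAdd : List R → List R → List R) := by
  have h : Primrec₂ fun (p : List R × List R) (i : ℕ) => p.1.getD i 0 + p.2.getD i 0 :=
    ha.comp
      ((Primrec.list_getD 0).comp (Primrec.fst.comp .fst) .snd)
      ((Primrec.list_getD 0).comp (Primrec.snd.comp .fst) .snd)
  exact Primrec.list_map
    (Primrec.list_range.comp (Primrec.nat_max.comp (Primrec.list_length.comp .fst)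
      (Primrec.list_length.comp .snd))) h

theorem primrec_listScale (hm : Primrec₂ fun a b : R => a * b) :
    Primrec₂ (listScale : R → List R → List R) :=
  Primrec.list_map .snd (hm.comp (Primrec.fst.comp .fst) .snd)

theorem primrec_listSub (ha : Primrec₂ fun a b : R => a + b) (hm : Primrec₂ fun a b : R => a * b) :
    Primrec₂ (listSub : List R → List R → List R) :=
  (primrec_listAdd ha).comp .fst ((primrec_listScale hm).comp (.const (-1)) .snd)

theorem primrec_listMul (ha : Primrec₂ fun a b : R => a + b) (hm : Primrec₂ fun a b : R => a * b) :
    Primrec₂ (listMul : List R → List R → List R) := by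
  have h : Primrec₂ fun (p : List R × List R) (q : R × List R) =>
      listAdd (listScale q.1 p.2) (0 :: q.2) :=
    (primrec_listAdd ha).comp
      ((primrec_listScale hm).comp (Primrec.fst.comp .snd) (Primrec.snd.comp .fst))
      (Primrec.list_cons.comp (.const 0) (Primrec.snd.comp .snd))
  exact Primrec.list_foldr .fst (.const []) h

theorem primrec_listSum (ha : Primrec₂ fun a b : R => a + b) {n : α → ℕ} (hn : Primrec n)
    {F : α → ℕ → List R} (hF : Primrec₂ F) : Primrec fun a => listSum (n a) (F a) := by
  have h : Primrec₂ fun (a : α) (q : ℕ × List R) => listAdd (F a q.1) q.2 :=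
    (primrec_listAdd ha).comp (hF.comp .fst (Primrec.fst.comp .snd)) (Primrec.snd.comp .snd)
  exact Primrec.list_foldr (Primrec.list_range.comp hn) (.const []) h

theorem primrec_listHom (ha : Primrec₂ fun a b : R => a + b) (hm : Primrec₂ fun a b : R => a * b)
    {f g : α → List R} {b : α → R} (hf : Primrec f) (hg : Primrec g) (hb : Primrec b) :
    Primrec fun x => listHom (f x) (g x) (b x) := by
  have h : Primrec₂ fun (x : α) (q : R × List R × List R) =>
      (listAdd (listScale q.1 q.2.2) (listMul (g x) q.2.1), listScale (b x) q.2.2) :=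
    Primrec.pair
      ((primrec_listAdd ha).comp
        ((primrec_listScale hm).comp (Primrec.fst.comp .snd)
          (Primrec.snd.comp (Primrec.snd.comp .snd)))
        ((primrec_listMul ha hm).comp (hg.comp .fst) (Primrec.fst.comp (Primrec.snd.comp .snd))))
      ((primrec_listScale hm).comp (hb.comp .fst) (Primrec.snd.comp (Primrec.snd.comp .snd)))
  exact Primrec.fst.comp (Primrec.list_foldr hf (.const (([], [1]) : List R × List R)) h)

end primrec

/-! ### Isolating roots by dominant coefficients -/

namespace Polynomial

theorem eval_pos_of_dominant (P : Polynomial ℝ) (n : ℕ) (hn : P.natDegree < n)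
    (h : ∑ k ∈ Finset.range n, |P.coeff k| < 2 * P.coeff 0) {x : ℝ} (hx : |x| ≤ 1) :
    0 < P.eval x := by
  have h0 : 0 ∈ Finset.range n := Finset.mem_range.2 (by omega)
  rw [eval_eq_sum_range' hn, ← Finset.add_sum_erase _ _ h0]
  rw [← Finset.add_sum_erase _ _ h0] at h
  have h1 : |∑ k ∈ (Finset.range n).erase 0, P.coeff k * x ^ k| ≤
      ∑ k ∈ (Finset.range n).erase 0, |P.coeff k| := by
    refine (Finset.abs_sum_le_sum_abs _ _).trans (Finset.sum_le_sum fun k _ => ?_)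
    rw [abs_mul, abs_pow]
    exact mul_le_of_le_one_right (abs_nonneg _) (pow_le_one₀ (abs_nonneg _) hx)
  have h2 := neg_abs_le (∑ k ∈ (Finset.range n).erase 0, P.coeff k * x ^ k)
  have h3 := le_abs_self (P.coeff 0)
  simp only [pow_zero, mul_one]
  linarith

/-- Up to sign the derivative is positive on `[-1, 1]`, since the linear coefficient outweighs the
higher terms. It also outweighs all other terms at `±1`, so the values there have opposite signs. -/
theorem existsUnique_root_of_dominant (P : Polynomial ℝ) (n : ℕ) (hn : P.natDegree < n)
    (h : |P.coeff 0| + ∑ k ∈ Finset.range n, (k : ℝ) * |P.coeff k| < 2 * |P.coeff 1|) :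
    ∃! x : ℝ, |x| < 1 ∧ P.eval x = 0 := by
  wlog hpos : 0 ≤ P.coeff 1 generalizing P
  · have := this (-P) (by simpa using hn) (by simpa using h)
      (by simpa using (not_le.1 hpos).le)
    simpa using this
  have hS : 0 ≤ ∑ k ∈ Finset.range n, (k : ℝ) * |P.coeff k| :=
    Finset.sum_nonneg fun k _ => by positivity
  have h10 : P.coeff 1 ≠ 0 := by
    intro h0
    rw [h0, abs_zero] at h
    linarith [abs_nonneg (P.coeff 0)]
  have h1 : 1 ∈ Finset.range n := by
    have := le_natDegree_of_ne_zero h10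
    exact Finset.mem_range.2 (by omega)
  rw [abs_of_nonneg hpos] at h
  rw [← Finset.add_sum_erase _ _ h1, Nat.cast_one, one_mul, abs_of_nonneg hpos] at h
  have hder : ∀ x : ℝ, |x| ≤ 1 → 0 < P.derivative.eval x := by
    intro x hx
    have h2 : P.derivative.eval x = ∑ k ∈ Finset.range n, P.coeff k * (k : ℝ) * x ^ (k - 1) := by
      conv_lhs => rw [P.as_sum_range' n hn]
      simp [derivative_monomial, eval_finsetSum]
    rw [h2, ← Finset.add_sum_erase _ _ h1]
    have h3 : |∑ k ∈ (Finset.range n).erase 1, P.coeff k * (k : ℝ) * x ^ (k - 1)| ≤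
        ∑ k ∈ (Finset.range n).erase 1, (k : ℝ) * |P.coeff k| := by
      refine (Finset.abs_sum_le_sum_abs _ _).trans (Finset.sum_le_sum fun k _ => ?_)
      rw [abs_mul, abs_mul, abs_pow, Nat.abs_cast, mul_comm |P.coeff k|]
      exact mul_le_of_le_one_right (by positivity) (pow_le_one₀ (abs_nonneg _) hx)
    have h4 := neg_abs_le (∑ k ∈ (Finset.range n).erase 1, P.coeff k * (k : ℝ) * x ^ (k - 1))
    have h5 := abs_nonneg (P.coeff 0)
    simp only [Nat.cast_one, tsub_self, pow_zero, mul_one]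
    linarith
  have hmono : StrictMonoOn (fun x => P.eval x) (Set.Icc (-1) 1) := by
    refine strictMonoOn_of_deriv_pos (convex_Icc _ _) P.continuous.continuousOn fun x hx => ?_
    rw [interior_Icc] at hx
    rw [Polynomial.deriv]
    exact hder x (abs_le.2 ⟨hx.1.le, hx.2.le⟩)
  have hb : ∀ x : ℝ, |x| = 1 →
      |∑ k ∈ (Finset.range n).erase 1, P.coeff k * x ^ k| < P.coeff 1 := by
    intro x hx
    have h0 : 0 ∈ (Finset.range n).erase 1 := by
      simp only [Finset.mem_erase, Finset.mem_range] at h1 ⊢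
      omega
    have h3 : |∑ k ∈ (Finset.range n).erase 1, P.coeff k * x ^ k| ≤
        ∑ k ∈ (Finset.range n).erase 1, ((if k = 0 then |P.coeff 0| else 0) +
          (k : ℝ) * |P.coeff k|) := by
      refine (Finset.abs_sum_le_sum_abs _ _).trans (Finset.sum_le_sum fun k _ => ?_)
      rw [abs_mul, abs_pow, hx, one_pow, mul_one]
      rcases Nat.eq_zero_or_pos k with rfl | hk
      · simp
      · have : (1 : ℝ) ≤ k := by exact_mod_cast hk
        rw [if_neg hk.ne', zero_add]
        exact le_mul_of_one_le_left (abs_nonneg _) this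
    rw [Finset.sum_add_distrib, Finset.sum_ite_eq' , if_pos h0] at h3
    linarith
  have hev : ∀ x : ℝ, P.eval x =
      P.coeff 1 * x + ∑ k ∈ (Finset.range n).erase 1, P.coeff k * x ^ k := by
    intro x
    rw [eval_eq_sum_range' hn, ← Finset.add_sum_erase _ _ h1, pow_one]
  have hr : 0 < P.eval 1 := by
    have := abs_lt.1 (hb 1 abs_one)
    rw [hev]; linarith
  have hl : P.eval (-1) < 0 := by
    have := abs_lt.1 (hb (-1) (by simp))
    rw [hev]; linarith
  obtain ⟨x, hx, hx0⟩ := intermediate_value_Ioo (by norm_num : (-1 : ℝ) ≤ 1)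
    P.continuous.continuousOn ⟨hl, hr⟩
  refine ⟨x, ⟨abs_lt.2 hx, hx0⟩, ?_⟩
  rintro y ⟨hy, hy0⟩
  have hy := abs_lt.1 hy
  exact hmono.injOn ⟨hy.1.le, hy.2.le⟩ ⟨hx.1.le, hx.2.le⟩ (hy0.trans hx0.symm)

end Polynomial

/-- The weighted sum of the absolute values of a list of coefficients. -/
def weightedSum (w : ℕ → ℕ) (l : List ℤ) : ℕ :=
  (List.range l.length).foldr (fun k r => w k * (l.getD k 0).natAbs + r) 0

theorem weightedSum_eq (w : ℕ → ℕ) (l : List ℤ) :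
    weightedSum w l = ∑ k ∈ Finset.range l.length, w k * (l.getD k 0).natAbs := by
  have h : ∀ L : List ℕ, L.foldr (fun k r => w k * (l.getD k 0).natAbs + r) 0 =
      (L.map fun k => w k * (l.getD k 0).natAbs).sum := by
    intro L
    induction L with
    | nil => simp
    | cons a L ih => rw [List.foldr_cons, ih, List.map_cons, List.sum_cons]
  rw [weightedSum, h]
  rfl

/-- The constant coefficient is positive and dominates the others. -/
def DominantConst (l : List ℤ) : Prop :=
  (weightedSum (fun _ => 1) l : ℤ) < 2 * l.getD 0 0

/-- The linear coefficient dominates the others. -/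
def DominantLinear (l : List ℤ) : Prop :=
  (l.getD 0 0).natAbs + weightedSum (fun k => k) l < 2 * (l.getD 1 0).natAbs

/-- The value at a real number of an integer polynomial. -/
def realEval (l : List ℤ) (x : ℝ) : ℝ := (listPoly l).eval₂ (Int.castRingHom ℝ) x

theorem realEval_eq_eval (l : List ℤ) (x : ℝ) :
    realEval l x = ((listPoly l).map (Int.castRingHom ℝ)).eval x :=
  (Polynomial.eval_map _ _).symm

theorem eval₂_listPoly_pair {R S : Type*} [CommRing R] [CommRing S] (φ : R →+* S) (x : S)
    (a b : R) : (listPoly [a, b]).eval₂ φ x = φ a + x * φ b := by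
  rw [listPoly_cons, listPoly_cons, listPoly_nil, mul_zero, add_zero, Polynomial.eval₂_add,
    Polynomial.eval₂_mul, Polynomial.eval₂_C, Polynomial.eval₂_C, Polynomial.eval₂_X]

/-- The substitution `y = (ρ + x) / M` identifies `|x| < 1` with the interval of radius `1 / M`
about `ρ / M`; thus a test on `[-1, 1]` becomes a test near a rational approximation. -/
theorem realEval_listHom (f : List ℤ) (ρ M : ℤ) (hM : 0 < M) (x : ℝ) :
    realEval (listHom f [ρ, 1] M) x * M = (M : ℝ) ^ f.length * realEval f ((ρ + x) / M) := by
  have hM' : (M : ℝ) ≠ 0 := by exact_mod_cast hM.ne'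
  exact eval₂_listHom (Int.castRingHom ℝ) x ((ρ + x) / M) f [ρ, 1] M
    (by rw [eval₂_listPoly_pair]; simp; field_simp)

theorem natDegree_map_listPoly_lt (l : List ℤ) (h : l ≠ []) :
    ((listPoly l).map (Int.castRingHom ℝ)).natDegree < l.length := by
  have h1 : 0 < l.length := List.length_pos_iff.2 h
  by_cases h0 : (listPoly l).map (Int.castRingHom ℝ) = 0
  · rwa [h0, Polynomial.natDegree_zero]
  · exact (Polynomial.natDegree_lt_iff_degree_lt h0).2
      (Polynomial.degree_map_le.trans_lt (degree_listPoly_lt l))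

theorem coeff_map_listPoly (l : List ℤ) (k : ℕ) :
    ((listPoly l).map (Int.castRingHom ℝ)).coeff k = (l.getD k 0 : ℤ) := by
  rw [Polynomial.coeff_map, coeff_listPoly]; simp

theorem dominantConst_iff (l : List ℤ) : DominantConst l ↔
    ∑ k ∈ Finset.range l.length, |((listPoly l).map (Int.castRingHom ℝ)).coeff k| <
      2 * ((listPoly l).map (Int.castRingHom ℝ)).coeff 0 := by
  simp only [DominantConst, weightedSum_eq, coeff_map_listPoly]
  rw [← Int.cast_lt (R := ℝ)]
  push_cast
  simp

theorem dominantLinear_iff (l : List ℤ) : DominantLinear l ↔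
    |((listPoly l).map (Int.castRingHom ℝ)).coeff 0| +
      ∑ k ∈ Finset.range l.length,
        (k : ℝ) * |((listPoly l).map (Int.castRingHom ℝ)).coeff k| <
      2 * |((listPoly l).map (Int.castRingHom ℝ)).coeff 1| := by
  simp only [DominantLinear, weightedSum_eq, coeff_map_listPoly]
  rw [← Nat.cast_lt (α := ℝ)]
  push_cast
  simp [Nat.cast_natAbs]

theorem realEval_pos_of_dominantConst {f : List ℤ} {ρ M : ℤ} (hM : 0 < M)
    (h : DominantConst (listHom f [ρ, 1] M)) {y : ℝ} (hy : |M * y - ρ| < 1) :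
    0 < realEval f y := by
  have hM' : (0 : ℝ) < M := by exact_mod_cast hM
  have hne : listHom f [ρ, 1] M ≠ [] := by
    intro h0
    rw [h0] at h
    simp [DominantConst, weightedSum] at h
  have h1 := Polynomial.eval_pos_of_dominant _ _ (natDegree_map_listPoly_lt _ hne)
    ((dominantConst_iff _).1 h) hy.le
  rw [← realEval_eq_eval] at h1
  have h2 := realEval_listHom f ρ M hM (M * y - ρ)
  rw [add_sub_cancel, mul_div_cancel_left₀ _ hM'.ne'] at h2
  have h3 : 0 < (M : ℝ) ^ f.length * realEval f y := h2 ▸ mul_pos h1 hM'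
  exact (pos_iff_pos_of_mul_pos h3).1 (by positivity)

theorem existsUnique_of_dominantLinear {f : List ℤ} {ρ M : ℤ} (hM : 0 < M)
    (h : DominantLinear (listHom f [ρ, 1] M)) :
    ∃! y : ℝ, |M * y - ρ| < 1 ∧ realEval f y = 0 := by
  have hM' : (M : ℝ) ≠ 0 := by exact_mod_cast hM.ne'
  have hne : listHom f [ρ, 1] M ≠ [] := by
    intro h0
    rw [h0] at h
    simp [DominantLinear, weightedSum] at h
  obtain ⟨x, ⟨hx, hx0⟩, hu⟩ := Polynomial.existsUnique_root_of_dominant _ _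
    (natDegree_map_listPoly_lt _ hne) ((dominantLinear_iff _).1 h)
  simp only [← realEval_eq_eval] at hx0 hu
  have key : ∀ x, realEval f ((ρ + x) / M) = 0 ↔ realEval (listHom f [ρ, 1] M) x = 0 := by
    intro x
    have h2 := realEval_listHom f ρ M hM x
    constructor
    · intro h3
      rw [h3, mul_zero] at h2
      exact (mul_eq_zero.1 h2).resolve_right hM'
    · intro h3
      rw [h3, zero_mul] at h2
      exact (mul_eq_zero.1 h2.symm).resolve_left (pow_ne_zero _ hM')
  refine ⟨(ρ + x) / M, ⟨?_, (key x).2 hx0⟩, ?_⟩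
  · rw [mul_div_cancel₀ _ hM', add_sub_cancel_left]; exact hx
  · rintro y ⟨hy, hy0⟩
    have h3 : (ρ + (M * y - ρ)) / M = y := by field_simp; ring
    have h4 := hu (M * y - ρ) ⟨hy, (key _).1 (by rw [h3]; exact hy0)⟩
    rw [← h4, h3]

/-- Up to powers of `M`, the rescaled polynomial is the Taylor expansion at `ρ / M` in the variable
`x / M`. This is `eval₂_listHom` with values in real polynomials. -/
theorem coeff_listHom (f : List ℤ) (ρ : ℤ) (M : ℕ) (hM : 0 < M) (k : ℕ) :
    ((listPoly (listHom f [ρ, 1] (M : ℤ))).map (Int.castRingHom ℝ)).coeff k * M =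
      (M : ℝ) ^ f.length * (((Polynomial.hasseDeriv k
        ((listPoly f).map (Int.castRingHom ℝ))).eval ((ρ : ℝ) / M)) * ((M : ℝ)⁻¹) ^ k) := by
  have hM' : (M : ℝ) ≠ 0 := by exact_mod_cast hM.ne'
  set g := (listPoly f).map (Int.castRingHom ℝ)
  have h := eval₂_listHom (Polynomial.C.comp (Int.castRingHom ℝ)) Polynomial.X
    ((Polynomial.X + Polynomial.C ((ρ : ℝ) / M)).comp (Polynomial.C ((M : ℝ)⁻¹) * Polynomial.X))
    f [ρ, 1] (M : ℤ) (by
      have h1 : (M : ℝ) * ((ρ : ℝ) / M) = ρ := by field_simp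
      have hφ : ∀ z : ℤ, Polynomial.C.comp (Int.castRingHom ℝ) z = Polynomial.C (z : ℝ) :=
        fun _ => rfl
      rw [eval₂_listPoly_pair, Polynomial.add_comp, Polynomial.X_comp, Polynomial.C_comp, mul_add,
        hφ, hφ, hφ, Int.cast_natCast, ← mul_assoc, ← Polynomial.C_mul, ← Polynomial.C_mul,
        mul_inv_cancel₀ hM', h1, Int.cast_one, Polynomial.C_1, one_mul, mul_one, add_comm])
  have h1 : ∀ (p : Polynomial ℤ) (q : Polynomial ℝ),
      p.eval₂ (Polynomial.C.comp (Int.castRingHom ℝ)) q = (p.map (Int.castRingHom ℝ)).comp q := by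
    intro p q
    rw [Polynomial.comp, Polynomial.eval₂_map]
  rw [h1, h1, Polynomial.comp_X, ← Polynomial.comp_assoc] at h
  have h2 := congrArg (fun p => Polynomial.coeff p k) h
  simp only [RingHom.coe_comp, Function.comp_apply, ← Polynomial.C_pow, Polynomial.coeff_mul_C,
    Polynomial.coeff_C_mul, Polynomial.comp_C_mul_X_coeff] at h2
  rw [← Polynomial.taylor_coeff, Polynomial.taylor_apply]
  simpa using h2

theorem tendsto_round_div (b : ℝ) :
    Filter.Tendsto (fun M : ℕ => (round (M * b) : ℝ) / M) Filter.atTop (nhds b) := by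
  have h := tendsto_inv_atTop_nhds_zero_nat (𝕜 := ℝ)
  rw [tendsto_iff_dist_tendsto_zero]
  refine squeeze_zero' (Filter.Eventually.of_forall fun _ => dist_nonneg) ?_ h
  filter_upwards [Filter.eventually_gt_atTop 0] with M hM
  have hM' : (0 : ℝ) < M := by exact_mod_cast hM
  have h1 := abs_sub_round (M * b)
  have h2 : (round (M * b) : ℝ) / M - b = -((M * b - round (M * b)) * (M : ℝ)⁻¹) := by
    field_simp; ring
  rw [Real.dist_eq, h2, abs_neg, abs_mul, abs_of_pos (inv_pos.2 hM')]
  exact mul_le_of_le_one_left (inv_pos.2 hM').le (by linarith)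

/-- The two lists may differ in length, but Hasse derivatives of order at least `f.length` vanish,
so both sums can be compared over the longer range. -/
theorem sum_abs_coeff_listHom_le (w : ℕ → ℝ) (hw : ∀ k, 0 ≤ w k) (f : List ℤ) (ρ : ℤ) (M : ℕ)
    (hM : 0 < M) :
    (∑ k ∈ Finset.range (listHom f [ρ, 1] (M : ℤ)).length, w k *
      |((listPoly (listHom f [ρ, 1] (M : ℤ))).map (Int.castRingHom ℝ)).coeff k|) * M ≤
    (M : ℝ) ^ f.length * ∑ k ∈ Finset.range f.length, w k * (|(Polynomial.hasseDeriv k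
        ((listPoly f).map (Int.castRingHom ℝ))).eval ((ρ : ℝ) / M)| * ((M : ℝ)⁻¹) ^ k) := by
  have hM' : (0 : ℝ) < M := by exact_mod_cast hM
  set n := f.length
  set n' := (listHom f [ρ, 1] (M : ℤ)).length
  have h1 : ∀ k, w k *
      |((listPoly (listHom f [ρ, 1] (M : ℤ))).map (Int.castRingHom ℝ)).coeff k| * M =
      (M : ℝ) ^ n * (w k * (|(Polynomial.hasseDeriv k
        ((listPoly f).map (Int.castRingHom ℝ))).eval ((ρ : ℝ) / M)| * ((M : ℝ)⁻¹) ^ k)) := by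
    intro k
    have := congrArg abs (coeff_listHom f ρ M hM k)
    rw [abs_mul, abs_mul, abs_mul, abs_of_pos hM', abs_of_pos (by positivity : 0 < (M : ℝ) ^ n),
      abs_of_pos (by positivity : 0 < (M : ℝ)⁻¹ ^ k)] at this
    rw [mul_assoc, this]
    ring
  rw [Finset.sum_mul, Finset.mul_sum]
  simp only [h1]
  have h2 : Finset.range n ⊆ Finset.range (max n n') :=
    Finset.range_subset_range.2 (le_max_left _ _)
  rw [Finset.sum_subset h2]
  · exact Finset.sum_le_sum_of_subset_of_nonneg
      (Finset.range_subset_range.2 (le_max_right _ _)) fun k _ _ => by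
        have := hw k
        positivity
  · intro k _ hk
    by_cases hf : f = []
    · simp [hf]
    · rw [Polynomial.hasseDeriv_eq_zero_of_lt_natDegree _ _
        ((natDegree_map_listPoly_lt f hf).trans_le (by simpa [n] using hk))]
      simp

theorem tendsto_sum_hasseDeriv (w : ℕ → ℝ) (e : ℕ → ℕ) (f : List ℤ) (b : ℝ) :
    Filter.Tendsto (fun M : ℕ => ∑ k ∈ Finset.range f.length, w k * (|(Polynomial.hasseDeriv k
        ((listPoly f).map (Int.castRingHom ℝ))).eval ((round (M * b) : ℝ) / M)| *
          ((M : ℝ)⁻¹) ^ e k)) Filter.atTop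
      (nhds (∑ k ∈ Finset.range f.length, w k * (|(Polynomial.hasseDeriv k
        ((listPoly f).map (Int.castRingHom ℝ))).eval b| * 0 ^ e k))) := by
  refine tendsto_finsetSum _ fun k _ => (Filter.Tendsto.mul ?_ ?_).const_mul _
  · exact ((Polynomial.continuous _).abs.tendsto b).comp (tendsto_round_div b)
  · exact (tendsto_inv_atTop_nhds_zero_nat (𝕜 := ℝ)).pow _

/-- The rescaled coefficients of positive index carry powers of `1 / M`; in the limit the condition
reads `f(b) < 2 f(b)`. -/
theorem eventually_dominantConst (f : List ℤ) (b : ℝ) (hb : 0 < realEval f b) :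
    ∀ᶠ M : ℕ in Filter.atTop, DominantConst (listHom f [round (M * b), 1] (M : ℤ)) := by
  have hne : 0 < f.length := by
    rw [List.length_pos_iff]
    rintro rfl
    simp [realEval] at hb
  have h1 := tendsto_sum_hasseDeriv (fun _ => 1) (fun k => k) f b
  have h2 : Filter.Tendsto (fun M : ℕ => 2 * ((Polynomial.hasseDeriv 0
        ((listPoly f).map (Int.castRingHom ℝ))).eval ((round (M * b) : ℝ) / M)))
      Filter.atTop (nhds (2 * ((Polynomial.hasseDeriv 0
        ((listPoly f).map (Int.castRingHom ℝ))).eval b))) :=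
    (((Polynomial.continuous _).tendsto b).comp (tendsto_round_div b)).const_mul _
  rw [Polynomial.hasseDeriv_zero', ← realEval_eq_eval] at h2
  rw [Finset.sum_eq_single_of_mem 0 (Finset.mem_range.2 hne)
    (fun k _ hk => by rw [zero_pow hk]; simp), Polynomial.hasseDeriv_zero', ← realEval_eq_eval,
    abs_of_pos hb, pow_zero, mul_one, one_mul] at h1
  filter_upwards [h1.eventually_lt h2 (by linarith), Filter.eventually_gt_atTop 0] with M hM hM0
  have hM' : (0 : ℝ) < M := by exact_mod_cast hM0
  rw [dominantConst_iff]
  have h3 := sum_abs_coeff_listHom_le (fun _ => 1) (fun _ => zero_le_one) f (round (M * b)) M hM0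
  have h4 := coeff_listHom f (round (M * b)) M hM0 0
  simp only [one_mul, Polynomial.hasseDeriv_zero', pow_zero, mul_one] at h3 h4 hM
  refine lt_of_mul_lt_mul_right ?_ hM'.le
  refine h3.trans_lt ?_
  rw [mul_assoc, h4, mul_left_comm]
  exact mul_lt_mul_of_pos_left hM (by positivity)

/-- At a simple root `b`, with `r` the rounding of `b` to denominator `M`, the rescaled coefficients
are proportional to `f(r)`, `f'(r) / M` and terms of order `M⁻²`. Rounding to the nearest integer
gives `|r - b| ≤ 1 / (2M)`, so the constant term is asymptotically at most half of the linear one.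
-/
theorem eventually_dominantLinear (f : List ℤ) (b : ℝ) (hb : realEval f b = 0)
    (hb' : (((listPoly f).map (Int.castRingHom ℝ)).derivative).eval b ≠ 0) :
    ∀ᶠ M : ℕ in Filter.atTop, DominantLinear (listHom f [round (M * b), 1] (M : ℤ)) := by
  set g := (listPoly f).map (Int.castRingHom ℝ) with hg
  set G := g.derivative.eval b with hG
  have hG0 : 0 < |G| := abs_pos.2 hb'
  have h1 := tendsto_sum_hasseDeriv (fun k => k) (fun k => k - 1) f b
  have h2 : Filter.Tendsto (fun M : ℕ => 2 * |(Polynomial.hasseDeriv 1 g).eval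
      ((round (M * b) : ℝ) / M)|) Filter.atTop (nhds (2 * |G|)) := by
    rw [Polynomial.hasseDeriv_one']
    exact (((Polynomial.continuous _).abs.tendsto b).comp (tendsto_round_div b)).const_mul _
  have h3 : ∑ k ∈ Finset.range f.length, (k : ℝ) * (|(Polynomial.hasseDeriv k g).eval b| *
      0 ^ (k - 1)) ≤ |G| := by
    have : ∀ k ∈ Finset.range f.length, (k : ℝ) * (|(Polynomial.hasseDeriv k g).eval b| *
      0 ^ (k - 1)) ≤ if k = 1 then |G| else 0 := by
      intro k _
      rcases k with _ | _ | k
      · simp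
      · simp [hG]
      · simp
    refine (Finset.sum_le_sum this).trans ?_
    rw [Finset.sum_ite_eq']
    split_ifs
    · exact le_rfl
    · exact hG0.le
  -- The limit is at most `-|G|`; the margin `9/10` still exceeds the contribution `5/8` of the
  -- constant term.
  have h4 := (h1.sub h2).eventually_lt_const
    (show _ < -(9 / 10) * |G| by linarith)
  -- A relative error of `1/4` in the linear approximation gives `|g(r)| ≤ 5/4 |G| |r - b|`, hence
  -- the bound `5/4 * 1/2 = 5/8` after multiplication by `M`.
  have h5 := (tendsto_round_div b).eventually
    ((g.hasDerivAt b).isLittleO.def (show 0 < |G| / 4 by linarith))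
  filter_upwards [h4, h5, Filter.eventually_gt_atTop 0] with M hM hM5 hM0
  have hM' : (0 : ℝ) < M := by exact_mod_cast hM0
  set r := (round (M * b) : ℝ) / M with hr
  have hrb : M * |r - b| ≤ 1 / 2 := by
    have := abs_sub_round (M * b)
    have h7 : M * |r - b| = |M * (r - b)| := by rw [abs_mul, abs_of_pos hM']
    rw [h7, mul_sub, hr, mul_div_cancel₀ _ hM'.ne', abs_sub_comm]
    exact this
  have hgr : M * |g.eval r| ≤ 5 / 8 * |G| := by
    rw [realEval_eq_eval] at hb
    rw [← hg] at hb
    rw [hb, sub_zero, Real.norm_eq_abs, Real.norm_eq_abs, smul_eq_mul, ← hG] at hM5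
    have h6 : |g.eval r| ≤ 5 / 4 * |G| * |r - b| := by
      have h7 := abs_sub_abs_le_abs_sub (g.eval r) ((r - b) * G)
      rw [abs_mul (r - b)] at h7
      nlinarith
    calc M * |g.eval r| ≤ M * (5 / 4 * |G| * |r - b|) := by gcongr
      _ = 5 / 4 * |G| * (M * |r - b|) := by ring
      _ ≤ 5 / 4 * |G| * (1 / 2) := by gcongr
      _ = _ := by ring
  rw [dominantLinear_iff]
  have e3 := sum_abs_coeff_listHom_le (fun k => k) (fun k => k.cast_nonneg) f (round (M * b)) M hM0
  have e0 := congrArg abs (coeff_listHom f (round (M * b)) M hM0 0)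
  have e1 := congrArg abs (coeff_listHom f (round (M * b)) M hM0 1)
  rw [← hg, ← hr, abs_mul, abs_mul, abs_mul, abs_of_pos hM',
    abs_of_pos (by positivity : 0 < (M : ℝ) ^ f.length)] at e0 e1
  rw [Polynomial.hasseDeriv_zero', pow_zero, abs_one, mul_one] at e0
  rw [pow_one, abs_of_pos (inv_pos.2 hM')] at e1
  refine lt_of_mul_lt_mul_right ?_ hM'.le
  rw [add_mul, mul_assoc 2, e1, e0]
  refine (add_le_add_right e3 _).trans_lt ?_
  rw [← mul_add, mul_left_comm]
  refine mul_lt_mul_of_pos_left ?_ (by positivity)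
  have h8 : ∑ k ∈ Finset.range f.length, (k : ℝ) * (|(Polynomial.hasseDeriv k g).eval r| *
      ((M : ℝ)⁻¹) ^ k) = (∑ k ∈ Finset.range f.length,
        (k : ℝ) * (|(Polynomial.hasseDeriv k g).eval r| * ((M : ℝ)⁻¹) ^ (k - 1))) * (M : ℝ)⁻¹ := by
    rw [Finset.sum_mul]
    refine Finset.sum_congr rfl fun k _ => ?_
    rcases k with _ | k
    · simp
    · rw [Nat.add_sub_cancel, pow_succ]; ring
  have h9 : |g.eval r| = (M * |g.eval r|) * (M : ℝ)⁻¹ := by field_simp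
  rw [h8, h9, ← add_mul, ← mul_assoc]
  exact mul_lt_mul_of_pos_right (by linarith) (inv_pos.2 hM')

/-! ### Certified irreducibility -/

/-- All lists of `n` integers of absolute value at most `H`. -/
def listBox (H n : ℕ) : List (List ℤ) :=
  n.rec (motive := fun _ => List (List ℤ)) [[]] fun _ L =>
    (List.range (2 * H + 1)).flatMap fun a : ℕ => L.map fun l => ((a : ℤ) - H) :: l

theorem mem_listBox {H n : ℕ} {l : List ℤ} :
    l ∈ listBox H n ↔ l.length = n ∧ ∀ a ∈ l, a.natAbs ≤ H := by
  induction n generalizing l with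
  | zero => simp +contextual [listBox]
  | succ n ih =>
    have : listBox H (n + 1) = (List.range (2 * H + 1)).flatMap fun a : ℕ =>
      (listBox H n).map fun l => ((a : ℤ) - H) :: l := rfl
    rw [this]
    simp only [List.mem_flatMap, List.mem_map, List.mem_range]
    constructor
    · rintro ⟨a, ha, l, hl, rfl⟩
      obtain ⟨h1, h2⟩ := ih.1 hl
      refine ⟨by simp [h1], ?_⟩
      rw [List.forall_mem_cons]
      exact ⟨by omega, h2⟩
    · rintro ⟨h1, h2⟩
      rcases l with _ | ⟨b, l⟩
      · simp at h1
      · rw [List.forall_mem_cons] at h2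
        refine ⟨(b + H).toNat, by omega, l, ih.2 ⟨by simpa using h1, h2.2⟩, ?_⟩
        congr 1
        omega

/-- The polynomial with coefficients `m`, of degree `m.length - 1`, is not a product of two
polynomials of smaller degree. -/
def NoFactors (m : List ℤ) : Prop :=
  ∀ f ∈ listBox (2 ^ (m.length - 1) * weightedSum (fun _ => 1) m) (m.length - 1),
    ∀ g ∈ listBox (2 ^ (m.length - 1) * weightedSum (fun _ => 1) m) (m.length - 1),
      ¬ ∀ a ∈ listSub (listMul f g) m, a = 0

theorem natDegree_listPoly_eq {R : Type*} [CommRing R] {m : List R}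
    (h : m.getD (m.length - 1) 0 ≠ 0) : (listPoly m).natDegree = m.length - 1 := by
  refine le_antisymm ?_ (Polynomial.le_natDegree_of_ne_zero (by rwa [coeff_listPoly]))
  rw [Polynomial.natDegree_le_iff_coeff_eq_zero]
  intro k hk
  rw [coeff_listPoly, List.getD_eq_default _ _ (by omega)]

/-- The Mahler measure is multiplicative and at least `1` for nonzero integer polynomials, so that
of a factor is bounded by that of the product, hence by the sum of its absolute coefficients. It
bounds coefficients up to a binomial factor. -/
theorem natAbs_coeff_le_of_mul_eq {f g : Polynomial ℤ} {m : List ℤ} (hm : listPoly m ≠ 0)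
    (h : f * g = listPoly m) (hf : f.natDegree ≤ m.length - 1) (k : ℕ) :
    (f.coeff k).natAbs ≤ 2 ^ (m.length - 1) * weightedSum (fun _ => 1) m := by
  have hg : g ≠ 0 := by rintro rfl; rw [mul_zero] at h; exact hm h.symm
  have h1 : (f.map (Int.castRingHom ℂ)).mahlerMeasure ≤
      ((listPoly m).map (Int.castRingHom ℂ)).mahlerMeasure := by
    rw [← h, Polynomial.map_mul, Polynomial.mahlerMeasure_mul]
    exact le_mul_of_one_le_right (Polynomial.mahlerMeasure_nonneg _)
      (Polynomial.one_le_mahlerMeasure_of_ne_zero hg)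
  have h2 := Polynomial.norm_coeff_le_choose_mul_mahlerMeasure k (f.map (Int.castRingHom ℂ))
  have h3 : ((listPoly m).map (Int.castRingHom ℂ)).mahlerMeasure ≤
      (weightedSum (fun _ => 1) m : ℝ) := by
    refine (Polynomial.mahlerMeasure_le_sum_norm_coeff _).trans ?_
    rw [Polynomial.sum_over_range' _ (by simp) m.length, weightedSum_eq]
    · push_cast
      refine Finset.sum_le_sum fun i _ => ?_
      rw [Polynomial.coeff_map, coeff_listPoly]
      simp [Nat.cast_natAbs]
    · have h0 : (listPoly m).map (Int.castRingHom ℂ) ≠ 0 :=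
        (Polynomial.map_ne_zero_iff (Int.cast_injective)).2 hm
      rw [Polynomial.natDegree_lt_iff_degree_lt h0]
      exact Polynomial.degree_map_le.trans_lt (degree_listPoly_lt m)
  have h4 : ((f.map (Int.castRingHom ℂ)).natDegree.choose k : ℝ) ≤ 2 ^ (m.length - 1) := by
    have h5 : (f.map (Int.castRingHom ℂ)).natDegree ≤ m.length - 1 :=
      Polynomial.natDegree_map_le.trans hf
    exact_mod_cast (Nat.choose_le_two_pow _ _).trans (Nat.pow_le_pow_right (by norm_num) h5)
  have h6 : ‖(f.map (Int.castRingHom ℂ)).coeff k‖ = ((f.coeff k).natAbs : ℝ) := by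
    rw [Polynomial.coeff_map]; simp [Nat.cast_natAbs]
  rw [h6] at h2
  have h7 : ((f.coeff k).natAbs : ℝ) ≤ 2 ^ (m.length - 1) * (weightedSum (fun _ => 1) m : ℝ) :=
    h2.trans (mul_le_mul h4 (h1.trans h3) (Polynomial.mahlerMeasure_nonneg _) (by positivity))
  exact_mod_cast h7

/-- A root of a polynomial without factors is not a root of a polynomial of smaller degree. -/
theorem eq_zero_of_noFactors {m : List ℤ} (hlead : m.getD (m.length - 1) 0 ≠ 0)
    (hm : NoFactors m) {θ : ℝ} (hθ : realEval m θ = 0) (g : Polynomial ℤ)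
    (hg : g.degree < (m.length - 1 : ℕ)) (hg0 : g.eval₂ (Int.castRingHom ℝ) θ = 0) : g = 0 := by
  by_contra hne
  have hdeg := natDegree_listPoly_eq hlead
  have hm0 : listPoly m ≠ 0 := by
    intro h0
    apply hlead
    rw [← coeff_listPoly, h0, Polynomial.coeff_zero]
  -- Some irreducible integer factor `π` of `m` vanishes at `θ` and by Gauss's lemma stays
  -- irreducible over `ℚ`. It therefore divides `g` over `ℚ` and has smaller degree than `m`, so
  -- that `π` and its cofactor form a factorization that `NoFactors` excludes.
  obtain ⟨F, hF, hFm⟩ := WfDvdMonoid.exists_factors (listPoly m) hm0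
  obtain ⟨π, hπ, hπ0⟩ : ∃ π ∈ F, π.eval₂ (Int.castRingHom ℝ) θ = 0 := by
    obtain ⟨u, hu⟩ := hFm.symm
    have h1 : (F.prod).eval₂ (Int.castRingHom ℝ) θ = 0 := by
      rw [← hu, Polynomial.eval₂_mul]
      rw [realEval] at hθ
      rw [hθ, zero_mul]
    rw [← Polynomial.coe_eval₂RingHom, map_multiset_prod, Multiset.prod_eq_zero_iff,
      Multiset.mem_map] at h1
    exact h1
  have hirr := hF π hπ
  obtain ⟨b, hb⟩ : π ∣ listPoly m := (Multiset.dvd_prod hπ).trans hFm.dvd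
  have hπdeg : π.natDegree ≠ 0 := by
    intro h0
    rw [Polynomial.eq_C_of_natDegree_eq_zero h0, Polynomial.eval₂_C] at hπ0
    have : π.coeff 0 = 0 := by simpa using hπ0
    exact hirr.ne_zero (by rw [Polynomial.eq_C_of_natDegree_eq_zero h0, this, Polynomial.C_0])
  have hprim := hirr.isPrimitive hπdeg
  have hirrQ := (Polynomial.IsPrimitive.Int.irreducible_iff_irreducible_map_cast hprim).1 hirr
  have hcast : ∀ p : Polynomial ℤ, Polynomial.aeval θ (p.map (Int.castRingHom ℚ)) =
      p.eval₂ (Int.castRingHom ℝ) θ := by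
    intro p
    rw [Polynomial.aeval_def, Polynomial.eval₂_map]
    congr 1
  have hint : IsIntegral ℚ θ :=
    IsAlgebraic.isIntegral ⟨_, hirrQ.ne_zero, (hcast π).trans hπ0⟩
  have hdvd : π.map (Int.castRingHom ℚ) ∣ g.map (Int.castRingHom ℚ) :=
    ((minpoly.irreducible hint).dvd_symm hirrQ (minpoly.dvd ℚ θ ((hcast π).trans hπ0))).trans
      (minpoly.dvd ℚ θ ((hcast g).trans hg0))
  have hinj : Function.Injective (Int.castRingHom ℚ) := Int.cast_injective
  have hle := Polynomial.natDegree_le_of_dvd hdvd ((Polynomial.map_ne_zero_iff hinj).2 hne)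
  rw [Polynomial.natDegree_map_eq_of_injective hinj,
    Polynomial.natDegree_map_eq_of_injective hinj] at hle
  have hlt := (Polynomial.natDegree_lt_iff_degree_lt hne).2 hg
  have hb0 : b ≠ 0 := by rintro rfl; rw [mul_zero] at hb; exact hm0 hb
  have hsum := congrArg Polynomial.natDegree hb
  rw [Polynomial.natDegree_mul hirr.ne_zero hb0, hdeg] at hsum
  obtain ⟨l₁, hl₁, hl₁'⟩ := exists_listPoly π (m.length - 1) (by omega)
  obtain ⟨l₂, hl₂, hl₂'⟩ := exists_listPoly b (m.length - 1) (by omega)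
  have hmem : ∀ (l : List ℤ) (p q : Polynomial ℤ), l.length = m.length - 1 → listPoly l = p →
      p * q = listPoly m → p.natDegree ≤ m.length - 1 →
      l ∈ listBox (2 ^ (m.length - 1) * weightedSum (fun _ => 1) m) (m.length - 1) := by
    intro l p q h1 h2 h3 h4
    refine mem_listBox.2 ⟨h1, fun a ha => ?_⟩
    obtain ⟨k, hk, rfl⟩ := List.getElem_of_mem ha
    have := natAbs_coeff_le_of_mul_eq hm0 h3 h4 k
    rwa [← h2, coeff_listPoly, List.getD_eq_getElem _ _ hk] at this
  refine hm l₁ (hmem l₁ π b hl₁ hl₁' hb.symm (by omega)) l₂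
    (hmem l₂ b π hl₂ hl₂' (by rw [mul_comm]; exact hb.symm) (by omega)) ?_
  rw [← listPoly_eq_zero_iff, listPoly_sub, listPoly_mul, hl₁', hl₂', hb, sub_self]

/-- Only factors of smaller degree are excluded, so irreducibility over `ℚ` is enough and a
nontrivial content of `m` does no harm. -/
theorem noFactors_of_irreducible {m : List ℤ} (hlead : m.getD (m.length - 1) 0 ≠ 0)
    (hm : Irreducible ((listPoly m).map (Int.castRingHom ℚ))) : NoFactors m := by
  intro f hf g hg h
  rw [← listPoly_eq_zero_iff, listPoly_sub, listPoly_mul, sub_eq_zero] at h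
  have hdeg := natDegree_listPoly_eq hlead
  have hinj : Function.Injective (Int.castRingHom ℚ) := Int.cast_injective
  have hlt : ∀ l : List ℤ, l ∈ listBox (2 ^ (m.length - 1) * weightedSum (fun _ => 1) m)
      (m.length - 1) → (listPoly l).degree < (m.length - 1 : ℕ) := fun l hl => by
    rw [← (mem_listBox.1 hl).1]; exact degree_listPoly_lt l
  have hm0 : listPoly m ≠ 0 := by
    rintro h0
    rw [h0, Polynomial.map_zero] at hm
    exact hm.ne_zero rfl
  have hmd : (listPoly m).degree = (m.length - 1 : ℕ) := by
    rw [Polynomial.degree_eq_natDegree hm0, hdeg]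
  have key : ∀ f g : Polynomial ℤ, f * g = listPoly m → g.degree < (m.length - 1 : ℕ) →
      ¬ IsUnit (f.map (Int.castRingHom ℚ)) := by
    intro f g h1 h2 h3
    have h4 := Polynomial.degree_eq_zero_of_isUnit h3
    rw [Polynomial.degree_map_eq_of_injective hinj] at h4
    rw [← hmd, ← h1, Polynomial.degree_mul, h4, zero_add] at h2
    exact lt_irrefl _ h2
  rcases hm.isUnit_or_isUnit (by rw [← Polynomial.map_mul, h] :
      (listPoly m).map (Int.castRingHom ℚ) = (listPoly f).map (Int.castRingHom ℚ) *
        (listPoly g).map (Int.castRingHom ℚ)) with h1 | h1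
  · exact key _ _ h (hlt g hg) h1
  · exact key _ _ (by rw [mul_comm]; exact h) (hlt f hf) h1

/-! ### Multiplicatively independent Gaussian integers -/

/-- The Gaussian integers `2 ^ 2 ^ j + i`. -/
def gaussianBase (j : ℕ) : GaussianInt := ⟨(2 : ℤ) ^ 2 ^ j, 1⟩

theorem gaussianBase_mul_star (j : ℕ) :
    gaussianBase j * star (gaussianBase j) = (Nat.fermatNumber (j + 1) : GaussianInt) := by
  refine Zsqrtd.ext ?_ ?_
  · rw [Zsqrtd.re_natCast, Nat.fermatNumber]
    simp [gaussianBase]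
    ring
  · rw [Zsqrtd.im_natCast]
    simp [gaussianBase]

/-- The family of all `gaussianBase j` and their conjugates. -/
def gaussianFamily (x : ℕ × Bool) : GaussianInt :=
  if x.2 then gaussianBase x.1 else star (gaussianBase x.1)

theorem gaussianFamily_dvd (x : ℕ × Bool) :
    gaussianFamily x ∣ (Nat.fermatNumber (x.1 + 1) : GaussianInt) := by
  rw [← gaussianBase_mul_star, gaussianFamily]
  split_ifs
  · exact dvd_mul_right _ _
  · exact dvd_mul_left _ _

/-- Members with different indices divide coprime Fermat numbers. A member and its conjugate differ
by `2i`, up to sign, while their product is odd. -/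
theorem isCoprime_gaussianFamily {x y : ℕ × Bool} (h : x ≠ y) :
    IsCoprime (gaussianFamily x) (gaussianFamily y) := by
  by_cases h1 : x.1 = y.1
  · have h2 : IsCoprime (gaussianBase x.1) (star (gaussianBase x.1)) := by
      have h3 : gaussianBase x.1 - star (gaussianBase x.1) = ⟨0, 2⟩ := by
        ext <;> simp [gaussianBase]
      have h4 : gaussianBase x.1 * star (gaussianBase x.1) = 2 ^ 2 ^ (x.1 + 1) + 1 := by
        rw [gaussianBase_mul_star, Nat.fermatNumber]; push_cast; rfl
      -- With `z = gaussianBase x.1` and `e = 2 ^ (x.1 + 1)`, insert `2 = -i (z - star z)` into `1 =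
      -- z * star z - 2 ^ (e - 1) * 2`.
      refine ⟨star (gaussianBase x.1) + 2 ^ (2 ^ (x.1 + 1) - 1) * ⟨0, 1⟩,
        - (2 ^ (2 ^ (x.1 + 1) - 1) * ⟨0, 1⟩), ?_⟩
      have h5 : (⟨0, 1⟩ : GaussianInt) * (gaussianBase x.1 - star (gaussianBase x.1)) = -2 := by
        rw [h3]; ext <;> simp
      have h6 : (2 : GaussianInt) ^ 2 ^ (x.1 + 1) = 2 ^ (2 ^ (x.1 + 1) - 1) * 2 := by
        rw [← pow_succ, Nat.sub_add_cancel Nat.one_le_two_pow]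
      linear_combination h4 + (2 : GaussianInt) ^ (2 ^ (x.1 + 1) - 1) * h5 + h6
    obtain ⟨i, b⟩ := x
    obtain ⟨i', b'⟩ := y
    obtain rfl : i = i' := h1
    rcases b with _ | _ <;> rcases b' with _ | _
    · exact absurd rfl h
    · exact h2.symm
    · exact h2
    · exact absurd rfl h
  · have h2 := Nat.coprime_fermatNumber_fermatNumber (fun h3 => h1 (Nat.succ_injective h3) :
      x.1 + 1 ≠ y.1 + 1)
    have h3 := (Nat.isCoprime_iff_coprime.2 h2).map (Int.castRingHom GaussianInt)
    simp only [eq_intCast, Int.cast_natCast] at h3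
    exact (h3.of_isCoprime_of_dvd_left (gaussianFamily_dvd x)).of_isCoprime_of_dvd_right
      (gaussianFamily_dvd y)

/-- The norm is one more than the square of an integer greater than `1`. -/
theorem not_isUnit_gaussianFamily (x : ℕ × Bool) : ¬ IsUnit (gaussianFamily x) := by
  have h : ¬ IsUnit (gaussianBase x.1) := by
    intro hu
    have h1 := gaussianBase_mul_star x.1
    have h2 : IsUnit (star (gaussianBase x.1)) := hu.star
    have h3 := (Zsqrtd.norm_eq_one_iff.2 hu)
    rw [Zsqrtd.norm_def] at h3
    have h4 : (1 : ℤ) < (2 : ℤ) ^ 2 ^ x.1 := one_lt_pow₀ (by norm_num) (by positivity)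
    simp only [gaussianBase] at h3
    have h5 : (1 : ℤ) < 2 ^ 2 ^ x.1 * 2 ^ 2 ^ x.1 := by nlinarith
    omega
  rw [gaussianFamily]
  split_ifs
  · exact h
  · intro hu
    exact h (by simpa using hu.star)

/-- Pairwise coprime non-units have no multiplicative relation. -/
theorem pow_eq_pow_of_pairwise_coprime {R ι : Type*} [CommRing R] [IsDomain R] (z : ι → R)
    (s : Finset ι)
    (hc : ∀ x y, x ≠ y → IsCoprime (z x) (z y)) (hu : ∀ x, ¬ IsUnit (z x)) (h0 : ∀ x, z x ≠ 0)
    (a b : ι → ℕ) (h : ∏ x ∈ s, z x ^ a x = ∏ x ∈ s, z x ^ b x) : ∀ x ∈ s, a x = b x := by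
  classical
  have key : ∀ a b : ι → ℕ, ∏ x ∈ s, z x ^ a x = ∏ x ∈ s, z x ^ b x →
      ∀ x ∈ s, a x ≤ b x := by
    intro a b h x hx
    by_contra hlt
    rw [not_le] at hlt
    rw [← Finset.mul_prod_erase s _ hx, ← Finset.mul_prod_erase s (fun x => z x ^ b x) hx] at h
    -- Cancelling `z x ^ b x` leaves a positive power of `z x` on one side, so `z x` divides a
    -- product of elements coprime to it.
    obtain ⟨c, hc'⟩ := Nat.exists_eq_add_of_lt hlt
    rw [hc', add_assoc, pow_add, mul_assoc] at h
    have h1 := mul_left_cancel₀ (pow_ne_zero _ (h0 x)) h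
    have h2 : z x ∣ ∏ y ∈ s.erase x, z y ^ b y := by
      rw [← h1, pow_succ]
      exact Dvd.intro_left (z x ^ c * ∏ y ∈ s.erase x, z y ^ a y) (by ring)
    have h3 : IsCoprime (z x) (∏ y ∈ s.erase x, z y ^ b y) :=
      IsCoprime.prod_right fun y hy => (hc x y (Finset.ne_of_mem_erase hy).symm).pow_right
    exact hu x (h3.isUnit_of_dvd' dvd_rfl h2)
  exact fun x hx => le_antisymm (key a b h x hx) (key b a h.symm x hx)

/-! ### A homomorphism from additive to multiplicative relations -/

/-- The product of the powers of the `gaussianBase j` and their conjugates with the positive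
exponents determined by a list of Gaussian integers. -/
def gaussianNum (ν : List GaussianInt) : GaussianInt :=
  (List.range ν.length).foldr (fun j r =>
    gaussianBase j ^ ((ν.getD j 0).re + (ν.getD j 0).im).toNat *
      star (gaussianBase j) ^ ((ν.getD j 0).re - (ν.getD j 0).im).toNat * r) 1

/-- The exponent of `gaussianFamily x` determined by a sequence of Gaussian integers. -/
def gaussianExponent (c : ℕ → GaussianInt) (x : ℕ × Bool) : ℤ :=
  if x.2 then (c x.1).re + (c x.1).im else (c x.1).re - (c x.1).im

/-- The members of `gaussianFamily` that a list of length at most `D` may involve. -/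
def gaussianIndex (D : ℕ) : Finset (ℕ × Bool) := Finset.range D ×ˢ Finset.univ

theorem gaussianFamily_ne_zero (x : ℕ × Bool) : gaussianFamily x ≠ 0 := by
  have h : gaussianBase x.1 ≠ 0 := fun h => by
    have := congrArg Zsqrtd.im h
    simp [gaussianBase] at this
  rw [gaussianFamily]
  split_ifs
  · exact h
  · simpa using h

/-- Missing coefficients count as zero, so lists of different lengths can share the index set given
by `D`. -/
theorem gaussianNum_eq (ν : List GaussianInt) (D : ℕ) (hD : ν.length ≤ D) :
    gaussianNum ν = ∏ x ∈ gaussianIndex D,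
      gaussianFamily x ^ (gaussianExponent (fun j => ν.getD j 0) x).toNat := by
  have h : ∀ L : List ℕ, L.foldr (fun j r =>
      gaussianBase j ^ ((ν.getD j 0).re + (ν.getD j 0).im).toNat *
      star (gaussianBase j) ^ ((ν.getD j 0).re - (ν.getD j 0).im).toNat * r) 1 =
      (L.map fun j => gaussianBase j ^ ((ν.getD j 0).re + (ν.getD j 0).im).toNat *
      star (gaussianBase j) ^ ((ν.getD j 0).re - (ν.getD j 0).im).toNat).prod := by
    intro L
    induction L with
    | nil => simp
    | cons a L ih => rw [List.foldr_cons, ih, List.map_cons, List.prod_cons]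
  rw [gaussianNum, h, gaussianIndex, Finset.prod_product,
    ← Finset.prod_subset (Finset.range_subset_range.2 hD)]
  · simp only [Fintype.prod_bool, gaussianFamily, gaussianExponent, if_true, Bool.false_eq_true,
      if_false]
    rfl
  · intro j _ hj
    rw [Finset.mem_range, not_lt] at hj
    simp [gaussianExponent, List.getElem?_eq_none hj]

/-- The image of a list of Gaussian integers under the homomorphism with values in `ℚ(i)`. -/
def gaussianValue (ν : List GaussianInt) : ℂ :=
  (gaussianNum ν : ℂ) / (gaussianNum (listScale (-1) ν) : ℂ)

theorem toComplex_gaussianFamily_ne_zero (x : ℕ × Bool) : (gaussianFamily x : ℂ) ≠ 0 :=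
  GaussianInt.toComplex_eq_zero.not.2 (gaussianFamily_ne_zero x)

theorem getD_listScale {R : Type*} [CommRing R] (a : R) (l : List R) (j : ℕ) :
    (listScale a l).getD j 0 = a * l.getD j 0 := by
  rw [← coeff_listPoly, listPoly_scale, Polynomial.coeff_C_mul, coeff_listPoly]

theorem gaussianValue_eq (ν : List GaussianInt) (D : ℕ) (hD : ν.length ≤ D) :
    gaussianValue ν = ∏ x ∈ gaussianIndex D,
      (gaussianFamily x : ℂ) ^ gaussianExponent (fun j => ν.getD j 0) x := by
  have h1 : (listScale (-1) ν).length ≤ D := by simpa [listScale] using hD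
  rw [gaussianValue, gaussianNum_eq ν D hD, gaussianNum_eq _ D h1, map_prod, map_prod,
    ← Finset.prod_div_distrib]
  refine Finset.prod_congr rfl fun x _ => ?_
  have h2 : gaussianExponent (fun j => (listScale (-1) ν).getD j 0) x =
      -gaussianExponent (fun j => ν.getD j 0) x := by
    simp only [getD_listScale, gaussianExponent]
    split_ifs <;> simp <;> ring
  rw [h2, map_pow, map_pow, div_eq_iff (pow_ne_zero _ (toComplex_gaussianFamily_ne_zero x)),
    ← zpow_natCast, ← zpow_natCast, ← zpow_add₀ (toComplex_gaussianFamily_ne_zero x)]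
  congr 1
  omega

theorem gaussianNum_ne_zero (ν : List GaussianInt) : gaussianNum ν ≠ 0 := by
  rw [gaussianNum_eq ν _ le_rfl]
  exact Finset.prod_ne_zero_iff.2 fun x _ => pow_ne_zero _ (gaussianFamily_ne_zero x)

theorem gaussianValue_ne_zero (ν : List GaussianInt) : gaussianValue ν ≠ 0 :=
  div_ne_zero (GaussianInt.toComplex_eq_zero.not.2 (gaussianNum_ne_zero _))
    (GaussianInt.toComplex_eq_zero.not.2 (gaussianNum_ne_zero _))

/-- Multiplication by the powers with exponent `-min (a x) (b x)` removes negative exponents and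
moves the comparison to the Gaussian integers. -/
theorem gaussianFamily_zpow_injective (s : Finset (ℕ × Bool)) (a b : ℕ × Bool → ℤ)
    (h : ∏ x ∈ s, (gaussianFamily x : ℂ) ^ a x = ∏ x ∈ s, (gaussianFamily x : ℂ) ^ b x) :
    ∀ x ∈ s, a x = b x := by
  have key : ∀ a b : ℕ × Bool → ℤ, (∏ x ∈ s, (gaussianFamily x : ℂ) ^ a x) *
      (∏ x ∈ s, (gaussianFamily x : ℂ) ^ (-min (a x) (b x))) =
      ((∏ x ∈ s, gaussianFamily x ^ (a x - min (a x) (b x)).toNat : GaussianInt) : ℂ) := by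
    intro a b
    rw [← Finset.prod_mul_distrib, map_prod]
    refine Finset.prod_congr rfl fun x _ => ?_
    rw [← zpow_add₀ (toComplex_gaussianFamily_ne_zero x), map_pow, ← zpow_natCast]
    congr 1
    omega
  have h1 := key a b
  have h2 := key b a
  simp only [min_comm (b _)] at h2
  rw [h, h2] at h1
  have h3 := pow_eq_pow_of_pairwise_coprime gaussianFamily s
    (fun _ _ => isCoprime_gaussianFamily) not_isUnit_gaussianFamily gaussianFamily_ne_zero _ _
    (GaussianInt.toComplex_inj.1 h1)
  intro x hx
  have := h3 x hx
  omega

/-- The value at a real number of a polynomial with Gaussian integer coefficients. -/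
def gaussianEval (l : List GaussianInt) (x : ℝ) : ℂ :=
  (listPoly l).eval₂ GaussianInt.toComplex (x : ℂ)

theorem gaussianEval_eq_sum (l : List GaussianInt) (x : ℝ) (D : ℕ) (hD : l.length ≤ D) :
    gaussianEval l x = ∑ j ∈ Finset.range D, (l.getD j 0 : ℂ) * (x : ℂ) ^ j := by
  rw [gaussianEval, Polynomial.eval₂_eq_sum, Polynomial.sum_over_range' _ (by simp) (D + 1),
    Finset.sum_range_succ]
  · simp only [coeff_listPoly]
    rw [List.getD_eq_default _ _ hD]
    simp
  · rcases eq_or_ne (listPoly l) 0 with h | h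
    · simp [h]
    · rw [Polynomial.natDegree_lt_iff_degree_lt h]
      exact (degree_listPoly_lt l).trans_le (by exact_mod_cast hD.trans (Nat.le_succ D))

/-- Since `θ` is real, real and imaginary parts give two integer relations between its powers below
`D`, and both are trivial. -/
theorem gaussian_eq_of_sum_eq {θ : ℝ} {D : ℕ}
    (hθ : ∀ g : Polynomial ℤ, g.degree < D → g.eval₂ (Int.castRingHom ℝ) θ = 0 → g = 0)
    (c c' : ℕ → GaussianInt)
    (h : ∑ j ∈ Finset.range D, (c j : ℂ) * (θ : ℂ) ^ j =
      ∑ j ∈ Finset.range D, (c' j : ℂ) * (θ : ℂ) ^ j) : ∀ j < D, c j = c' j := by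
  have key : ∀ a : ℕ → ℤ, ∑ j ∈ Finset.range D, (a j : ℝ) * θ ^ j = 0 → ∀ j < D, a j = 0 := by
    intro a ha j hj
    have h1 := hθ (∑ j ∈ Finset.range D, Polynomial.C (a j) * Polynomial.X ^ j) (by
        rw [Polynomial.degree_lt_iff_coeff_zero]
        intro m hm
        simp only [Polynomial.finsetSum_coeff, Polynomial.coeff_C_mul_X_pow]
        exact Finset.sum_eq_zero fun x hx =>
          if_neg (by have := Finset.mem_range.1 hx; omega)) (by
        rw [Polynomial.eval₂_finsetSum, ← ha]
        refine Finset.sum_congr rfl fun x _ => ?_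
        rw [Polynomial.eval₂_mul, Polynomial.eval₂_C, Polynomial.eval₂_X_pow, eq_intCast])
    have h2 := congrArg (fun p => Polynomial.coeff p j) h1
    simp only [Polynomial.finsetSum_coeff, Polynomial.coeff_C_mul_X_pow,
      Polynomial.coeff_zero] at h2
    rwa [Finset.sum_ite_eq, if_pos (Finset.mem_range.2 hj)] at h2
  have hre := key (fun j => (c j - c' j).re) (by
    have := congrArg Complex.re (sub_eq_zero.2 h)
    rw [← Finset.sum_sub_distrib, Complex.re_sum] at this
    rw [Complex.zero_re] at this
    rw [← this]
    refine Finset.sum_congr rfl fun x _ => ?_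
    rw [← sub_mul, ← Complex.ofReal_pow, Complex.re_mul_ofReal, ← map_sub,
      ← GaussianInt.intCast_re])
  have him := key (fun j => (c j - c' j).im) (by
    have := congrArg Complex.im (sub_eq_zero.2 h)
    rw [← Finset.sum_sub_distrib, Complex.im_sum] at this
    rw [Complex.zero_im] at this
    rw [← this]
    refine Finset.sum_congr rfl fun x _ => ?_
    rw [← sub_mul, ← Complex.ofReal_pow, Complex.im_mul_ofReal, ← map_sub,
      ← GaussianInt.intCast_im])
  intro j hj
  exact sub_eq_zero.1 (Zsqrtd.ext (hre j hj) (him j hj))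

theorem gaussianExponent_sum {s : ℕ} (m : Fin s → ℕ) (ν : Fin s → List GaussianInt)
    (x : ℕ × Bool) : gaussianExponent (fun j => ∑ l, (m l : GaussianInt) * (ν l).getD j 0) x =
      ∑ l, (m l : ℤ) * gaussianExponent (fun j => (ν l).getD j 0) x := by
  have hre : ∀ z : Fin s → GaussianInt, (∑ l, (m l : GaussianInt) * z l).re =
      ∑ l, (m l : ℤ) * (z l).re := by
    intro z
    refine (map_sum (AddMonoidHom.mk' Zsqrtd.re fun _ _ => rfl) _ _).trans ?_
    exact Finset.sum_congr rfl fun l _ => by simp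
  have him : ∀ z : Fin s → GaussianInt, (∑ l, (m l : GaussianInt) * z l).im =
      ∑ l, (m l : ℤ) * (z l).im := by
    intro z
    refine (map_sum (AddMonoidHom.mk' Zsqrtd.im fun _ _ => rfl) _ _).trans ?_
    exact Finset.sum_congr rfl fun l _ => by simp
  simp only [gaussianExponent, hre, him]
  split_ifs
  · rw [← Finset.sum_add_distrib]
    exact Finset.sum_congr rfl fun l _ => by ring
  · rw [← Finset.sum_sub_distrib]
    exact Finset.sum_congr rfl fun l _ => by ring

theorem zpow_finset_sum {G ι : Type*} [CommGroupWithZero G] {z : G} (hz : z ≠ 0) (s : Finset ι)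
    (f : ι → ℤ) : z ^ (∑ i ∈ s, f i) = ∏ i ∈ s, z ^ f i := by
  classical
  induction s using Finset.induction_on with
  | empty => simp
  | insert a s ha ih => rw [Finset.sum_insert ha, Finset.prod_insert ha, zpow_add₀ hz, ih]

/-- Both kinds of relation mean equality of the same vectors of Gaussian integers: additively
because the powers of `θ` are independent, multiplicatively because the members of `gaussianFamily`
are. -/
theorem sameRelations_gaussianValue {s D : ℕ} {θ δ : ℝ} (hδ : δ ≠ 0)
    (hθ : ∀ g : Polynomial ℤ, g.degree < D → g.eval₂ (Int.castRingHom ℝ) θ = 0 → g = 0)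
    (ν : Fin s → List GaussianInt) (hν : ∀ l, (ν l).length ≤ D) :
    SameRelations (fun l => gaussianEval (ν l) θ / δ) (fun l => gaussianValue (ν l)) := by
  intro m m'
  have h1 : ∀ m : Fin s → ℕ, ∑ l, (m l : ℂ) * (gaussianEval (ν l) θ / δ) =
      (∑ j ∈ Finset.range D,
        ((∑ l, (m l : GaussianInt) * (ν l).getD j 0 : GaussianInt) : ℂ) * (θ : ℂ) ^ j) / δ := by
    intro m
    rw [Finset.sum_div]
    simp only [fun l => gaussianEval_eq_sum (ν l) θ D (hν l), map_sum, map_mul, map_natCast,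
      Finset.sum_mul, Finset.sum_div, Finset.mul_sum]
    rw [Finset.sum_comm]
    exact Finset.sum_congr rfl fun j _ => Finset.sum_congr rfl fun l _ => by ring
  have h2 : ∀ m : Fin s → ℕ, ∏ l, gaussianValue (ν l) ^ m l =
      ∏ x ∈ gaussianIndex D, (gaussianFamily x : ℂ) ^
        gaussianExponent (fun j => ∑ l, (m l : GaussianInt) * (ν l).getD j 0) x := by
    intro m
    simp only [fun l => gaussianValue_eq (ν l) D (hν l), ← Finset.prod_pow]
    rw [Finset.prod_comm]
    refine Finset.prod_congr rfl fun x _ => ?_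
    rw [gaussianExponent_sum, zpow_finset_sum (toComplex_gaussianFamily_ne_zero x)]
    refine Finset.prod_congr rfl fun l _ => ?_
    rw [mul_comm, _root_.zpow_mul, zpow_natCast]
  rw [h1, h1, h2, h2]
  have hδ' : (δ : ℂ) ≠ 0 := by exact_mod_cast hδ
  constructor
  · intro h
    rw [div_left_inj' hδ'] at h
    have h3 := gaussian_eq_of_sum_eq hθ _ _ h
    refine Finset.prod_congr rfl fun x hx => ?_
    have hx' := h3 x.1 (Finset.mem_range.1 (Finset.mem_product.1 hx).1)
    simp only [gaussianExponent, hx']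
  · intro h
    have h3 := gaussianFamily_zpow_injective _ _ _ h
    congr 1
    refine Finset.sum_congr rfl fun j hj => ?_
    -- The two exponents are `re + im` and `re - im`, which determine `re` and `im`.
    have ht := h3 (j, true) (Finset.mem_product.2 ⟨hj, Finset.mem_univ _⟩)
    have hf := h3 (j, false) (Finset.mem_product.2 ⟨hj, Finset.mem_univ _⟩)
    simp only [gaussianExponent, if_true, Bool.false_eq_true, if_false] at ht hf
    congr 2
    exact Zsqrtd.ext (by omega) (by omega)

/-! ### Certificates for loops -/

/-- The entry of a matrix given by the list of its rows. -/
def listEntry {α : Type*} (x : α) (M : List (List α)) (i j : ℕ) : α := (M.getD i []).getD j x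

/-- The list of all entries of a square matrix. -/
def allEntries {α : Type*} (d : ℕ) (F : ℕ → ℕ → α) : List α :=
  (List.range d).flatMap fun i => (List.range d).map fun j => F i j

theorem mem_allEntries {α : Type*} {d : ℕ} {F : ℕ → ℕ → α} {x : α} :
    x ∈ allEntries d F ↔ ∃ i < d, ∃ j < d, F i j = x := by
  simp [allEntries]

theorem forall_mem_allEntries {α : Type*} {d : ℕ} {F : ℕ → ℕ → α} {p : α → Prop} :
    (∀ x ∈ allEntries d F, p x) ↔ ∀ i < d, ∀ j < d, p (F i j) := by
  simp only [mem_allEntries]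
  refine ⟨fun h i hi j hj => h _ ⟨i, hi, j, hj, rfl⟩, ?_⟩
  rintro h _ ⟨i, hi, j, hj, rfl⟩
  exact h i hi j hj

/-- A certificate that a matrix `B` generates a cyclic group with the same closure as the
one-parameter group of a matrix `A`: a polynomial and a pair of integers that isolate a generator
of a real number field, two denominators, the entries of `A` and of `B` in that field, codes for
the entries of `B`, the eigenvalues of `A` with chains of generalized eigenvectors, and a list of
quotients by the polynomial. -/
abbrev LoopCert :=
  List ℤ × (ℤ × ℤ) × (ℤ × ℤ) × List (List (List ℤ)) × List (List (List ℤ)) ×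
    List (List (List ℤ × ℤ × ℕ)) ×
    List (List GaussianInt × List (List (List (List GaussianInt)))) × List (List GaussianInt)

namespace LoopCert

/-- The polynomial that defines the number field. -/
def modulus (w : LoopCert) : List ℤ := w.1
/-- The numerator of an approximation of the generator. -/
def center (w : LoopCert) : ℤ := w.2.1.1
/-- The denominator of an approximation of the generator. -/
def scale (w : LoopCert) : ℤ := w.2.1.2
/-- The common denominator of the entries of `A` and the generalized eigenvectors. -/
def denA (w : LoopCert) : ℤ := w.2.2.1.1
/-- The common denominator of the entries of `B`. -/
def denB (w : LoopCert) : ℤ := w.2.2.1.2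
/-- The entries of `A`. -/
def entryA (w : LoopCert) (i j : ℕ) : List ℤ := listEntry [] w.2.2.2.1 i j
/-- The entries of `B`. -/
def entryB (w : LoopCert) (i j : ℕ) : List ℤ := listEntry [] w.2.2.2.2.1 i j
/-- The polynomials and approximations that determine the entries of `B`. -/
def codeB (w : LoopCert) (i j : ℕ) : List ℤ × ℤ × ℕ := listEntry ([], 0, 0) w.2.2.2.2.2.1 i j
/-- The number of the eigenvalues. -/
def size (w : LoopCert) : ℕ := w.2.2.2.2.2.2.1.length
/-- The eigenvalues. -/
def eigenvalue (w : LoopCert) (l : ℕ) : List GaussianInt := (w.2.2.2.2.2.2.1.getD l ([], [])).1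
/-- The generalized eigenvectors. -/
def vector (w : LoopCert) (l k i j : ℕ) : List GaussianInt :=
  listEntry [] ((w.2.2.2.2.2.2.1.getD l ([], [])).2.getD k []) i j
/-- The quotients. -/
def quotients (w : LoopCert) : List (List GaussianInt) := w.2.2.2.2.2.2.2

end LoopCert

/-- Integers as Gaussian integers. -/
def toGaussian (l : List ℤ) : List GaussianInt := l.map fun a => ⟨a, 0⟩

/-- The polynomial whose vanishing means that `f / δ` is a root of the polynomial of a code. -/
def rootPoly (c : RealAlgCode) (f : List ℤ) (δ : ℤ) : List GaussianInt :=
  toGaussian (listHom c.1 f δ)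

/-- The polynomial whose positivity means that `f / δ` is greater than the lower bound of a
code. -/
def lowerPoly (c : RealAlgCode) (f : List ℤ) (δ : ℤ) : List ℤ :=
  listSub (listScale ((c.2.1.2 : ℤ) + 1) f) [δ * c.2.1.1]

/-- The polynomial whose positivity means that `f / δ` is smaller than the upper bound of a
code. -/
def upperPoly (c : RealAlgCode) (f : List ℤ) (δ : ℤ) : List ℤ :=
  listSub [δ * c.2.2.1] (listScale ((c.2.2.2 : ℤ) + 1) f)

/-- The code for the root of a polynomial that is isolated by an approximation. -/
def isolatedCode (x : List ℤ × ℤ × ℕ) : RealAlgCode :=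
  (x.1, (x.2.1 - 1, x.2.2), (x.2.1 + 1, x.2.2))

/-- The entry of a code of a matrix. -/
def MatCode.entry (c : MatCode) (i j : ℕ) : RealAlgCode := listEntry ([], (0, 0), (0, 0)) c i j

namespace LoopCert

/-- The identity `(k + 1) * W (k + 1) = (A - ν) * W k`. -/
def chainPoly (d : ℕ) (w : LoopCert) (l k i j : ℕ) : List GaussianInt :=
  -- All entries carry a factor `denA`; the additional one here balances the products of two such
  -- entries.
  listSub (listScale ⟨w.denA * ((k : ℤ) + 1), 0⟩ (w.vector l (k + 1) i j))
    (listSub (listSum d fun t => listMul (toGaussian (w.entryA i t)) (w.vector l k t j))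
      (listMul (w.eigenvalue l) (w.vector l k i j)))

/-- The identity `∑ l, W l 0 = 1`. -/
def sumPoly (w : LoopCert) (i j : ℕ) : List GaussianInt :=
  listSub (listSum w.size fun l => w.vector l 0 i j) [if i = j then ⟨w.denA, 0⟩ else 0]

/-- The identity `B * W l 0 = μ l * ∑ k, W l k`. -/
def actPoly (d : ℕ) (w : LoopCert) (l i j : ℕ) : List GaussianInt :=
  listSub
    -- Both sides are multiplied by `denA * denB` and by the denominator of `gaussianValue`.
    (listScale (gaussianNum (listScale (-1) (w.eigenvalue l)))
      (listSum d fun t => listMul (toGaussian (w.entryB i t)) (w.vector l 0 t j)))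
    (listScale (⟨w.denB, 0⟩ * gaussianNum (w.eigenvalue l))
      (listSum d fun k => w.vector l k i j))

/-- The identity `A * B = B * A`. -/
def commPoly (d : ℕ) (w : LoopCert) (i j : ℕ) : List GaussianInt :=
  toGaussian (listSub (listSum d fun t => listMul (w.entryA i t) (w.entryB t j))
    (listSum d fun t => listMul (w.entryB i t) (w.entryA t j)))

/-- The polynomials that have to be divisible by the modulus. -/
def identities (d : ℕ) (c : MatCode) (w : LoopCert) : List (List GaussianInt) :=
  (allEntries d fun i j => rootPoly (c.entry i j) (w.entryA i j) w.denA) ++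
  ((allEntries d fun i j => rootPoly (isolatedCode (w.codeB i j)) (w.entryB i j) w.denB) ++
  (((List.range w.size).flatMap fun l => (List.range d).flatMap fun k =>
    allEntries d (w.chainPoly d l k)) ++
  (((List.range w.size).flatMap fun l => allEntries d (w.vector l d)) ++
  (allEntries d w.sumPoly ++
  (((List.range w.size).flatMap fun l => allEntries d (w.actPoly d l)) ++
  allEntries d (w.commPoly d))))))

/-- The polynomials that have to be positive at the generator. -/
def inequalities (d : ℕ) (c : MatCode) (w : LoopCert) : List (List ℤ) :=
  (allEntries d fun i j => lowerPoly (c.entry i j) (w.entryA i j) w.denA) ++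
  ((allEntries d fun i j => upperPoly (c.entry i j) (w.entryA i j) w.denA) ++
  ((allEntries d fun i j => lowerPoly (isolatedCode (w.codeB i j)) (w.entryB i j) w.denB) ++
  (allEntries d fun i j => upperPoly (isolatedCode (w.codeB i j)) (w.entryB i j) w.denB)))

/-- The polynomials that need to have exactly one root near the given approximations. -/
def isolations (d : ℕ) (w : LoopCert) : List (List ℤ) :=
  listHom w.modulus [w.center, 1] w.scale ::
    allEntries d fun i j =>
      listHom (w.codeB i j).1 [(w.codeB i j).2.1, 1] (((w.codeB i j).2.2 : ℤ) + 1)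

/-- `w` is a valid certificate for the `d × d` matrix with code `c`. -/
def Valid (d : ℕ) (c : MatCode) (w : LoopCert) : Prop :=
  (0 < w.scale ∧ 0 < w.denA ∧ 0 < w.denB) ∧
  (w.modulus.getD (w.modulus.length - 1) 0 ≠ 0 ∧ NoFactors w.modulus) ∧
  (∀ f ∈ isolations d w, DominantLinear f) ∧
  (∀ f ∈ inequalities d c w, DominantConst (listHom f [w.center, 1] w.scale)) ∧
  -- The eigenvalues must be given by polynomials of degree below that of the generator; for these,
  -- additive relations are relations between the coefficients.
  (∀ l < w.size, (w.eigenvalue l).length ≤ w.modulus.length - 1) ∧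
  ∀ f ∈ identities d c w, ∃ r ∈ w.quotients,
    ∀ a ∈ listSub f (listMul (toGaussian w.modulus) r), a = 0

/-- The code of the matrix `B`. -/
def output (d : ℕ) (w : LoopCert) : MatCode :=
  (List.range d).map fun i => (List.range d).map fun j => isolatedCode (w.codeB i j)

end LoopCert

/-! ### The certificates are checked by a primitive recursive function -/

section primrec

variable {α β : Type*} [Primcodable α] [Primcodable β]

open Primrec

theorem primrec_listEntry (x : β) {M : α → List (List β)} {i j : α → ℕ} (hM : Primrec M)
    (hi : Primrec i) (hj : Primrec j) : Primrec fun a => listEntry x (M a) (i a) (j a) :=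
  (Primrec.list_getD x).comp ((Primrec.list_getD []).comp hM hi) hj

theorem primrec_allEntries {d : α → ℕ} (hd : Primrec d) {F : α → ℕ → ℕ → β}
    (hF : Primrec fun x : (α × ℕ) × ℕ => F x.1.1 x.1.2 x.2) :
    Primrec fun a => allEntries (d a) (F a) := by
  have h1 : Primrec₂ fun (a : α) (i : ℕ) => (List.range (d a)).map fun j => F a i j :=
    Primrec.list_map (Primrec.list_range.comp (hd.comp .fst)) hF
  exact Primrec.list_flatMap (Primrec.list_range.comp hd) h1

theorem primrec_rangeFlatMap {n : α → ℕ} (hn : Primrec n) {F : α → ℕ → List β}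
    (hF : Primrec fun x : α × ℕ => F x.1 x.2) :
    Primrec fun a => (List.range (n a)).flatMap (F a) :=
  Primrec.list_flatMap (Primrec.list_range.comp hn) hF

variable {w : α → LoopCert}

theorem primrec_modulus : Primrec LoopCert.modulus := .fst
theorem primrec_center : Primrec LoopCert.center :=
  Primrec.fst.comp (Primrec.fst.comp .snd)
theorem primrec_scale : Primrec LoopCert.scale :=
  Primrec.snd.comp (Primrec.fst.comp .snd)
theorem primrec_denA : Primrec LoopCert.denA :=
  Primrec.fst.comp (Primrec.fst.comp (Primrec.snd.comp .snd))
theorem primrec_denB : Primrec LoopCert.denB :=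
  Primrec.snd.comp (Primrec.fst.comp (Primrec.snd.comp .snd))
theorem primrec_entryA (hw : Primrec w) {i j : α → ℕ} (hi : Primrec i) (hj : Primrec j) :
    Primrec fun a => (w a).entryA (i a) (j a) :=
  primrec_listEntry [] (Primrec.fst.comp (Primrec.snd.comp (Primrec.snd.comp
    (Primrec.snd.comp hw)))) hi hj
theorem primrec_entryB (hw : Primrec w) {i j : α → ℕ} (hi : Primrec i) (hj : Primrec j) :
    Primrec fun a => (w a).entryB (i a) (j a) :=
  primrec_listEntry [] (Primrec.fst.comp (Primrec.snd.comp (Primrec.snd.comp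
    (Primrec.snd.comp (Primrec.snd.comp hw))))) hi hj
theorem primrec_codeB (hw : Primrec w) {i j : α → ℕ} (hi : Primrec i) (hj : Primrec j) :
    Primrec fun a => (w a).codeB (i a) (j a) :=
  primrec_listEntry _ (Primrec.fst.comp (Primrec.snd.comp (Primrec.snd.comp
    (Primrec.snd.comp (Primrec.snd.comp (Primrec.snd.comp hw)))))) hi hj

theorem primrec_eigenData : Primrec (fun w : LoopCert => w.2.2.2.2.2.2.1) :=
  Primrec.fst.comp (Primrec.snd.comp (Primrec.snd.comp
    (Primrec.snd.comp (Primrec.snd.comp (Primrec.snd.comp .snd)))))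
theorem primrec_quotients : Primrec LoopCert.quotients :=
  Primrec.snd.comp (Primrec.snd.comp (Primrec.snd.comp
    (Primrec.snd.comp (Primrec.snd.comp (Primrec.snd.comp .snd)))))
theorem primrec_size : Primrec LoopCert.size := Primrec.list_length.comp primrec_eigenData
theorem primrec_eigenvalue (hw : Primrec w) {l : α → ℕ} (hl : Primrec l) :
    Primrec fun a => (w a).eigenvalue (l a) :=
  Primrec.fst.comp ((Primrec.list_getD _).comp (primrec_eigenData.comp hw) hl)
theorem primrec_vector (hw : Primrec w) {l k i j : α → ℕ} (hl : Primrec l) (hk : Primrec k)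
    (hi : Primrec i) (hj : Primrec j) :
    Primrec fun a => (w a).vector (l a) (k a) (i a) (j a) :=
  primrec_listEntry [] ((Primrec.list_getD []).comp
    (Primrec.snd.comp ((Primrec.list_getD _).comp (primrec_eigenData.comp hw) hl)) hk) hi hj

theorem primrec_toGaussian : Primrec toGaussian :=
  Primrec.list_map .id (gaussian_mk.comp .snd (.const 0))

theorem primrec_rootPoly {c : α → RealAlgCode} {f : α → List ℤ} {δ : α → ℤ} (hc : Primrec c)
    (hf : Primrec f) (hδ : Primrec δ) : Primrec fun a => rootPoly (c a) (f a) (δ a) :=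
  primrec_toGaussian.comp (primrec_listHom int_add int_mul (Primrec.fst.comp hc) hf hδ)

theorem primrec_lowerPoly {c : α → RealAlgCode} {f : α → List ℤ} {δ : α → ℤ} (hc : Primrec c)
    (hf : Primrec f) (hδ : Primrec δ) : Primrec fun a => lowerPoly (c a) (f a) (δ a) := by
  have h1 : Primrec fun a => (c a).2.1 := Primrec.fst.comp (Primrec.snd.comp hc)
  exact (primrec_listSub int_add int_mul).comp
    ((primrec_listScale int_mul).comp
      (int_add.comp (int_natCast.comp (Primrec.snd.comp h1)) (.const 1)) hf)
    (Primrec.list_cons.comp (int_mul.comp hδ (Primrec.fst.comp h1)) (.const []))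

theorem primrec_upperPoly {c : α → RealAlgCode} {f : α → List ℤ} {δ : α → ℤ} (hc : Primrec c)
    (hf : Primrec f) (hδ : Primrec δ) : Primrec fun a => upperPoly (c a) (f a) (δ a) := by
  have h1 : Primrec fun a => (c a).2.2 := Primrec.snd.comp (Primrec.snd.comp hc)
  exact (primrec_listSub int_add int_mul).comp
    (Primrec.list_cons.comp (int_mul.comp hδ (Primrec.fst.comp h1)) (.const []))
    ((primrec_listScale int_mul).comp
      (int_add.comp (int_natCast.comp (Primrec.snd.comp h1)) (.const 1)) hf)

theorem primrec_isolatedCode : Primrec isolatedCode :=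
  Primrec.pair .fst (Primrec.pair
    (Primrec.pair (int_sub.comp (Primrec.fst.comp .snd) (.const 1)) (Primrec.snd.comp .snd))
    (Primrec.pair (int_add.comp (Primrec.fst.comp .snd) (.const 1)) (Primrec.snd.comp .snd)))

theorem primrec_entry {c : α → MatCode} {i j : α → ℕ} (hc : Primrec c) (hi : Primrec i)
    (hj : Primrec j) : Primrec fun a => (c a).entry (i a) (j a) :=
  primrec_listEntry _ hc hi hj

theorem primrec_gaussianBase : Primrec gaussianBase :=
  gaussian_mk.comp ((pow_of_mul int_mul).comp (.const 2)
    ((pow_of_mul Primrec.nat_mul).comp (.const 2) .id)) (.const 1)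

theorem primrec_gaussianNum : Primrec gaussianNum := by
  have hs : Primrec fun j : ℕ => star (gaussianBase j) :=
    (gaussian_mk.comp (gaussian_re.comp primrec_gaussianBase)
      (int_neg.comp (gaussian_im.comp primrec_gaussianBase))).of_eq fun j => rfl
  have hg : Primrec₂ fun (ν : List GaussianInt) (q : ℕ × GaussianInt) => ν.getD q.1 0 :=
    (Primrec.list_getD 0).comp .fst (Primrec.fst.comp .snd)
  have hp := pow_of_mul gaussian_mul
  have h : Primrec₂ fun (ν : List GaussianInt) (q : ℕ × GaussianInt) =>
      gaussianBase q.1 ^ ((ν.getD q.1 0).re + (ν.getD q.1 0).im).toNat *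
        star (gaussianBase q.1) ^ ((ν.getD q.1 0).re - (ν.getD q.1 0).im).toNat * q.2 :=
    gaussian_mul.comp (gaussian_mul.comp
      (hp.comp (primrec_gaussianBase.comp (Primrec.fst.comp .snd))
        (int_toNat.comp (int_add.comp (gaussian_re.comp hg) (gaussian_im.comp hg))))
      (hp.comp (hs.comp (Primrec.fst.comp .snd))
        (int_toNat.comp (int_sub.comp (gaussian_re.comp hg) (gaussian_im.comp hg)))))
      (Primrec.snd.comp .snd)
  exact Primrec.list_foldr (Primrec.list_range.comp .list_length) (.const 1) h

theorem primrec_gaussian_ofInt {f : α → ℤ} (hf : Primrec f) :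
    Primrec fun a => (⟨f a, 0⟩ : GaussianInt) := gaussian_mk.comp hf (.const 0)

theorem primrec_chainPoly {d l k i j : α → ℕ} (hd : Primrec d) (hw : Primrec w) (hl : Primrec l)
    (hk : Primrec k) (hi : Primrec i) (hj : Primrec j) :
    Primrec fun a => (w a).chainPoly (d a) (l a) (k a) (i a) (j a) := by
  have hsub := primrec_listSub gaussian_add gaussian_mul
  have hmul := primrec_listMul gaussian_add gaussian_mul
  have h1 : Primrec₂ fun (a : α) (t : ℕ) =>
      listMul (toGaussian ((w a).entryA (i a) t)) ((w a).vector (l a) (k a) t (j a)) :=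
    hmul.comp (primrec_toGaussian.comp (primrec_entryA (hw.comp .fst) (hi.comp .fst) .snd))
      (primrec_vector (hw.comp .fst) (hl.comp .fst) (hk.comp .fst) .snd (hj.comp .fst))
  exact hsub.comp
    ((primrec_listScale gaussian_mul).comp
      (primrec_gaussian_ofInt (int_mul.comp (primrec_denA.comp hw)
        (int_add.comp (int_natCast.comp hk) (.const 1))))
      (primrec_vector hw hl (Primrec.succ.comp hk) hi hj))
    (hsub.comp (primrec_listSum gaussian_add hd h1)
      (hmul.comp (primrec_eigenvalue hw hl) (primrec_vector hw hl hk hi hj)))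

theorem primrec_sumPoly {i j : α → ℕ} (hw : Primrec w) (hi : Primrec i) (hj : Primrec j) :
    Primrec fun a => (w a).sumPoly (i a) (j a) := by
  have h1 : Primrec₂ fun (a : α) (l : ℕ) => (w a).vector l 0 (i a) (j a) :=
    primrec_vector (hw.comp .fst) .snd (.const 0) (hi.comp .fst) (hj.comp .fst)
  exact (primrec_listSub gaussian_add gaussian_mul).comp
    (primrec_listSum gaussian_add (primrec_size.comp hw) h1)
    (Primrec.list_cons.comp (Primrec.ite (Primrec.eq.comp hi hj)
      (primrec_gaussian_ofInt (primrec_denA.comp hw)) (.const 0)) (.const []))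

theorem primrec_actPoly {d l i j : α → ℕ} (hd : Primrec d) (hw : Primrec w) (hl : Primrec l)
    (hi : Primrec i) (hj : Primrec j) :
    Primrec fun a => (w a).actPoly (d a) (l a) (i a) (j a) := by
  have hscale := primrec_listScale gaussian_mul
  have h1 : Primrec₂ fun (a : α) (t : ℕ) =>
      listMul (toGaussian ((w a).entryB (i a) t)) ((w a).vector (l a) 0 t (j a)) :=
    (primrec_listMul gaussian_add gaussian_mul).comp
      (primrec_toGaussian.comp (primrec_entryB (hw.comp .fst) (hi.comp .fst) .snd))
      (primrec_vector (hw.comp .fst) (hl.comp .fst) (.const 0) .snd (hj.comp .fst))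
  have h2 : Primrec₂ fun (a : α) (k : ℕ) => (w a).vector (l a) k (i a) (j a) :=
    primrec_vector (hw.comp .fst) (hl.comp .fst) .snd (hi.comp .fst) (hj.comp .fst)
  exact (primrec_listSub gaussian_add gaussian_mul).comp
    (hscale.comp (primrec_gaussianNum.comp (hscale.comp (.const (-1)) (primrec_eigenvalue hw hl)))
      (primrec_listSum gaussian_add hd h1))
    (hscale.comp (gaussian_mul.comp (primrec_gaussian_ofInt (primrec_denB.comp hw))
      (primrec_gaussianNum.comp (primrec_eigenvalue hw hl)))
      (primrec_listSum gaussian_add hd h2))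

theorem primrec_commPoly {d i j : α → ℕ} (hd : Primrec d) (hw : Primrec w)
    (hi : Primrec i) (hj : Primrec j) :
    Primrec fun a => (w a).commPoly (d a) (i a) (j a) := by
  have h1 : Primrec₂ fun (a : α) (t : ℕ) =>
      listMul ((w a).entryA (i a) t) ((w a).entryB t (j a)) :=
    (primrec_listMul int_add int_mul).comp
      (primrec_entryA (hw.comp .fst) (hi.comp .fst) .snd)
      (primrec_entryB (hw.comp .fst) .snd (hj.comp .fst))
  have h2 : Primrec₂ fun (a : α) (t : ℕ) =>
      listMul ((w a).entryB (i a) t) ((w a).entryA t (j a)) :=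
    (primrec_listMul int_add int_mul).comp
      (primrec_entryB (hw.comp .fst) (hi.comp .fst) .snd)
      (primrec_entryA (hw.comp .fst) .snd (hj.comp .fst))
  exact primrec_toGaussian.comp ((primrec_listSub int_add int_mul).comp
    (primrec_listSum int_add hd h1) (primrec_listSum int_add hd h2))

theorem primrec_fst_fst {γ : Type*} [Primcodable γ] :
    Primrec fun x : (γ × ℕ) × ℕ => x.1.1 := Primrec.fst.comp .fst

theorem primrec_snd_fst {γ : Type*} [Primcodable γ] :
    Primrec fun x : (γ × ℕ) × ℕ => x.1.2 := Primrec.snd.comp .fst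

theorem primrec_identities {d : α → ℕ} {c : α → MatCode} (hd : Primrec d) (hc : Primrec c)
    (hw : Primrec w) : Primrec fun a => (w a).identities (d a) (c a) := by
  have f3 : Primrec fun x : (α × ℕ) × ℕ => x.1.1 := primrec_fst_fst
  have i3 : Primrec fun x : (α × ℕ) × ℕ => x.1.2 := primrec_snd_fst
  have hA := primrec_allEntries (F := fun a i j =>
      rootPoly ((c a).entry i j) ((w a).entryA i j) (w a).denA) hd
    (primrec_rootPoly (primrec_entry (hc.comp f3) i3 .snd)
      (primrec_entryA (hw.comp f3) i3 .snd) (primrec_denA.comp (hw.comp f3)))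
  have hB := primrec_allEntries (F := fun a i j =>
      rootPoly (isolatedCode ((w a).codeB i j)) ((w a).entryB i j) (w a).denB) hd
    (primrec_rootPoly (primrec_isolatedCode.comp (primrec_codeB (hw.comp f3) i3 .snd))
      (primrec_entryB (hw.comp f3) i3 .snd) (primrec_denB.comp (hw.comp f3)))
  have hsum := primrec_allEntries (F := fun a i j => (w a).sumPoly i j) hd
    (primrec_sumPoly (hw.comp f3) i3 .snd)
  have hcomm := primrec_allEntries (F := fun a i j => (w a).commPoly (d a) i j) hd
    (primrec_commPoly (hd.comp f3) (hw.comp f3) i3 .snd)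
  have f4 : Primrec fun x : ((α × ℕ) × ℕ) × ℕ => x.1.1.1 := Primrec.fst.comp primrec_fst_fst
  have l4 : Primrec fun x : ((α × ℕ) × ℕ) × ℕ => x.1.1.2 := Primrec.snd.comp primrec_fst_fst
  have i4 : Primrec fun x : ((α × ℕ) × ℕ) × ℕ => x.1.2 := primrec_snd_fst
  have hend := primrec_rangeFlatMap (n := fun a => (w a).size)
    (F := fun a l => allEntries (d a) ((w a).vector l (d a))) (primrec_size.comp hw)
    (primrec_allEntries (F := fun (x : α × ℕ) i j => (w x.1).vector x.2 (d x.1) i j)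
      (hd.comp .fst) (primrec_vector (hw.comp f4) l4 (hd.comp f4) i4 .snd))
  have hact := primrec_rangeFlatMap (n := fun a => (w a).size)
    (F := fun a l => allEntries (d a) ((w a).actPoly (d a) l)) (primrec_size.comp hw)
    (primrec_allEntries (F := fun (x : α × ℕ) i j => (w x.1).actPoly (d x.1) x.2 i j)
      (hd.comp .fst) (primrec_actPoly (hd.comp f4) (hw.comp f4) l4 i4 .snd))
  have f5 : Primrec fun x : (((α × ℕ) × ℕ) × ℕ) × ℕ => x.1.1.1.1 := f4.comp .fst
  have l5 : Primrec fun x : (((α × ℕ) × ℕ) × ℕ) × ℕ => x.1.1.1.2 := l4.comp .fst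
  have k5 : Primrec fun x : (((α × ℕ) × ℕ) × ℕ) × ℕ => x.1.1.2 := i4.comp .fst
  have hchain := primrec_rangeFlatMap (n := fun a => (w a).size)
    (F := fun a l => (List.range (d a)).flatMap fun k =>
      allEntries (d a) ((w a).chainPoly (d a) l k)) (primrec_size.comp hw)
    (primrec_rangeFlatMap (n := fun x : α × ℕ => d x.1) (F := fun (x : α × ℕ) k =>
      allEntries (d x.1) ((w x.1).chainPoly (d x.1) x.2 k)) (hd.comp .fst)
      (primrec_allEntries
        (F := fun (x : (α × ℕ) × ℕ) i j => (w x.1.1).chainPoly (d x.1.1) x.1.2 x.2 i j)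
        (hd.comp f3)
        (primrec_chainPoly (hd.comp f5) (hw.comp f5) l5 k5 primrec_snd_fst .snd)))
  have happ := Primrec.list_append (α := List GaussianInt)
  exact happ.comp hA (happ.comp hB (happ.comp hchain (happ.comp hend (happ.comp hsum
    (happ.comp hact hcomm)))))

theorem primrec_inequalities {d : α → ℕ} {c : α → MatCode} (hd : Primrec d) (hc : Primrec c)
    (hw : Primrec w) : Primrec fun a => (w a).inequalities (d a) (c a) := by
  have f3 : Primrec fun x : (α × ℕ) × ℕ => x.1.1 := primrec_fst_fst
  have i3 : Primrec fun x : (α × ℕ) × ℕ => x.1.2 := primrec_snd_fst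
  have cA := primrec_entry (hc.comp f3) i3 .snd
  have cB := primrec_isolatedCode.comp (primrec_codeB (hw.comp f3) i3 .snd)
  have eA := primrec_entryA (hw.comp f3) i3 .snd
  have eB := primrec_entryB (hw.comp f3) i3 .snd
  have dA := primrec_denA.comp (hw.comp f3)
  have dB := primrec_denB.comp (hw.comp f3)
  have happ := Primrec.list_append (α := List ℤ)
  exact happ.comp (primrec_allEntries (F := fun a i j =>
      lowerPoly ((c a).entry i j) ((w a).entryA i j) (w a).denA) hd (primrec_lowerPoly cA eA dA))
    (happ.comp (primrec_allEntries (F := fun a i j =>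
      upperPoly ((c a).entry i j) ((w a).entryA i j) (w a).denA) hd (primrec_upperPoly cA eA dA))
    (happ.comp (primrec_allEntries (F := fun a i j =>
      lowerPoly (isolatedCode ((w a).codeB i j)) ((w a).entryB i j) (w a).denB) hd
        (primrec_lowerPoly cB eB dB))
    (primrec_allEntries (F := fun a i j =>
      upperPoly (isolatedCode ((w a).codeB i j)) ((w a).entryB i j) (w a).denB) hd
        (primrec_upperPoly cB eB dB))))

theorem primrec_shift {f : α → List ℤ} {ρ M : α → ℤ} (hf : Primrec f) (hρ : Primrec ρ)
    (hM : Primrec M) : Primrec fun a => listHom (f a) [ρ a, 1] (M a) :=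
  primrec_listHom int_add int_mul hf (Primrec.list_cons.comp hρ (.const [1])) hM

theorem primrec_isolations {d : α → ℕ} (hd : Primrec d) (hw : Primrec w) :
    Primrec fun a => (w a).isolations (d a) := by
  have cB : Primrec fun x : (α × ℕ) × ℕ => (w x.1.1).codeB x.1.2 x.2 :=
    primrec_codeB (hw.comp primrec_fst_fst) primrec_snd_fst .snd
  exact Primrec.list_cons.comp
    (primrec_shift (primrec_modulus.comp hw) (primrec_center.comp hw) (primrec_scale.comp hw))
    (primrec_allEntries (F := fun a i j =>
      listHom ((w a).codeB i j).1 [((w a).codeB i j).2.1, 1] ((((w a).codeB i j).2.2 : ℤ) + 1)) hd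
      (primrec_shift (Primrec.fst.comp cB) (Primrec.fst.comp (Primrec.snd.comp cB))
        (int_add.comp (int_natCast.comp (Primrec.snd.comp (Primrec.snd.comp cB))) (.const 1))))

theorem primrec_output {d : α → ℕ} (hd : Primrec d) (hw : Primrec w) :
    Primrec fun a => (w a).output (d a) := by
  have h1 : Primrec₂ fun (a : α) (i : ℕ) =>
      (List.range (d a)).map fun j => isolatedCode ((w a).codeB i j) :=
    Primrec.list_map (Primrec.list_range.comp (hd.comp .fst))
      (primrec_isolatedCode.comp (primrec_codeB (hw.comp primrec_fst_fst) primrec_snd_fst .snd))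
  exact Primrec.list_map (Primrec.list_range.comp hd) h1

theorem primrec_weightedSum {v : ℕ → ℕ} (hv : Primrec v) : Primrec (weightedSum v) := by
  have h : Primrec₂ fun (l : List ℤ) (q : ℕ × ℕ) => v q.1 * (l.getD q.1 0).natAbs + q.2 :=
    Primrec.nat_add.comp (Primrec.nat_mul.comp (hv.comp (Primrec.fst.comp .snd))
      (int_natAbs.comp ((Primrec.list_getD 0).comp .fst (Primrec.fst.comp .snd))))
      (Primrec.snd.comp .snd)
  exact Primrec.list_foldr (Primrec.list_range.comp .list_length) (.const 0) h

theorem primrecPred_dominantConst : PrimrecPred DominantConst :=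
  int_lt.comp (int_natCast.comp (primrec_weightedSum (.const 1)))
    (int_mul.comp (.const 2) ((Primrec.list_getD 0).comp .id (.const 0)))

theorem primrecPred_dominantLinear : PrimrecPred DominantLinear :=
  Primrec.nat_lt.comp
    (Primrec.nat_add.comp (int_natAbs.comp ((Primrec.list_getD 0).comp .id (.const 0)))
      (primrec_weightedSum .id))
    (Primrec.nat_mul.comp (.const 2) (int_natAbs.comp ((Primrec.list_getD 0).comp .id (.const 1))))

theorem primrecPred_forall_zero {R : Type*} [CommRing R] [Primcodable R] :
    PrimrecPred fun l : List R => ∀ a ∈ l, a = 0 :=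
  PrimrecPred.forall_mem_list (Primrec.eq.comp .id (.const 0))

theorem primrec_listBox : Primrec₂ listBox := by
  have h2 : Primrec₂ fun (x : ℕ × ℕ × List (List ℤ)) (a : ℕ) =>
      x.2.2.map fun l => ((a : ℤ) - x.1) :: l :=
    Primrec.list_map (Primrec.snd.comp (Primrec.snd.comp .fst))
      (Primrec.list_cons.comp
        (int_sub.comp (int_natCast.comp (Primrec.snd.comp .fst))
          (int_natCast.comp (Primrec.fst.comp (Primrec.fst.comp .fst)))) .snd)
  have h : Primrec₂ fun (H : ℕ) (q : ℕ × List (List ℤ)) =>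
      (List.range (2 * H + 1)).flatMap fun a : ℕ => q.2.map fun l => ((a : ℤ) - H) :: l :=
    Primrec.list_flatMap (Primrec.list_range.comp
      (Primrec.succ.comp (Primrec.nat_mul.comp (.const 2) .fst))) h2
  exact Primrec.nat_rec (.const [[]]) h

theorem primrecPred_noFactors : PrimrecPred NoFactors := by
  have hD : Primrec fun m : List ℤ => m.length - 1 := Primrec.nat_sub.comp .list_length (.const 1)
  have hbox : Primrec fun m : List ℤ =>
      listBox (2 ^ (m.length - 1) * weightedSum (fun _ => 1) m) (m.length - 1) :=
    primrec_listBox.comp (Primrec.nat_mul.comp ((pow_of_mul Primrec.nat_mul).comp (.const 2) hD)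
      (primrec_weightedSum (.const 1))) hD
  have h1 : PrimrecRel fun (g : List ℤ) (q : List ℤ × List ℤ) =>
      ¬ ∀ a ∈ listSub (listMul q.1 g) q.2, a = 0 :=
    (primrecPred_forall_zero.comp ((primrec_listSub int_add int_mul).comp
      ((primrec_listMul int_add int_mul).comp (Primrec.fst.comp .snd) .fst)
        (Primrec.snd.comp .snd))).not
  have h2 : PrimrecRel fun (f : List ℤ) (m : List ℤ) =>
      ∀ g ∈ listBox (2 ^ (m.length - 1) * weightedSum (fun _ => 1) m) (m.length - 1),
        ¬ ∀ a ∈ listSub (listMul f g) m, a = 0 :=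
    h1.forall_mem_list.comp (hbox.comp .snd) (Primrec.pair .fst .snd)
  exact h2.forall_mem_list.comp hbox .id

/-- All quantifiers range over finite lists computed from the data, and every test is exact integer
arithmetic. -/
theorem primrecPred_valid {d : α → ℕ} {c : α → MatCode} (hd : Primrec d) (hc : Primrec c)
    (hw : Primrec w) : PrimrecPred fun a => (w a).Valid (d a) (c a) := by
  have hpos : ∀ {f : α → ℤ}, Primrec f → PrimrecPred fun a => 0 < f a :=
    fun hf => int_lt.comp (.const 0) hf
  have hm := primrec_modulus.comp hw
  have hlen : Primrec fun a => (w a).modulus.length - 1 :=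
    Primrec.nat_sub.comp (Primrec.list_length.comp hm) (.const 1)
  have h1 : PrimrecPred fun a => (w a).modulus.getD ((w a).modulus.length - 1) 0 ≠ 0 :=
    (Primrec.eq.comp ((Primrec.list_getD 0).comp hm hlen) (.const 0)).not
  have h2 : PrimrecRel fun (f : List ℤ) (q : ℤ × ℤ) => DominantConst (listHom f [q.1, 1] q.2) :=
    primrecPred_dominantConst.comp
      (primrec_shift .fst (Primrec.fst.comp .snd) (Primrec.snd.comp .snd))
  have h3 : PrimrecRel fun (l : ℕ) (a : α) =>
      ((w a).eigenvalue l).length ≤ (w a).modulus.length - 1 :=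
    Primrec.nat_le.comp (Primrec.list_length.comp (primrec_eigenvalue (hw.comp .snd) .fst))
      (hlen.comp .snd)
  have h4 : PrimrecRel fun (r : List GaussianInt) (q : List GaussianInt × List ℤ) =>
      ∀ a ∈ listSub q.1 (listMul (toGaussian q.2) r), a = 0 :=
    primrecPred_forall_zero.comp ((primrec_listSub gaussian_add gaussian_mul).comp
      (Primrec.fst.comp .snd) ((primrec_listMul gaussian_add gaussian_mul).comp
        (primrec_toGaussian.comp (Primrec.snd.comp .snd)) .fst))
  have h5 : PrimrecRel fun (f : List GaussianInt) (a : α) => ∃ r ∈ (w a).quotients,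
      ∀ x ∈ listSub f (listMul (toGaussian (w a).modulus) r), x = 0 :=
    h4.exists_mem_list.comp (primrec_quotients.comp (hw.comp .snd))
      (Primrec.pair .fst (hm.comp .snd))
  have h6 : PrimrecPred fun a : α =>
      ∀ l < (w a).size, ((w a).eigenvalue l).length ≤ (w a).modulus.length - 1 :=
    (h3.forall_mem_list.comp (Primrec.list_range.comp (primrec_size.comp hw)) .id).of_eq
      fun a => by simp
  exact ((hpos (primrec_scale.comp hw)).and
    ((hpos (primrec_denA.comp hw)).and (hpos (primrec_denB.comp hw)))).and
    ((h1.and (primrecPred_noFactors.comp hm)).and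
    (((PrimrecPred.forall_mem_list primrecPred_dominantLinear).comp
      (primrec_isolations hd hw)).and
    ((h2.forall_mem_list.comp (primrec_inequalities hd hc hw)
      (Primrec.pair (primrec_center.comp hw) (primrec_scale.comp hw))).and
    (h6.and
    (h5.forall_mem_list.comp (primrec_identities hd hc hw) .id)))))

end primrec

/-! ### Valid certificates are correct -/

theorem forall₂_ofFn {α β : Type*} {R : α → β → Prop} {n : ℕ} {f : Fin n → β} {l : List α}
    (x : α) : List.Forall₂ R l (List.ofFn f) ↔
      l.length = n ∧ ∀ i : Fin n, R (l.getD i x) (f i) := by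
  rw [List.forall₂_iff_get]
  constructor
  · rintro ⟨h1, h2⟩
    have h : l.length = n := by simpa using h1
    refine ⟨h, fun i => ?_⟩
    have h3 := h2 i (by omega) (by simp)
    rw [List.getD_eq_getElem _ _ (by omega)]
    simpa using h3
  · rintro ⟨h1, h2⟩
    refine ⟨by simpa using h1, fun i hi hi' => ?_⟩
    have h3 := h2 ⟨i, by omega⟩
    rw [List.getD_eq_getElem _ _ hi] at h3
    simpa using h3

theorem MatCode.Denotes.entry {d : ℕ} {c : MatCode} {A : Matrix (Fin d) (Fin d) ℝ}
    (h : MatCode.Denotes c A) (i j : Fin d) : RealAlgCode.Denotes (c.entry i j) (A i j) := by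
  have h1 := ((forall₂_ofFn []).1 h).2 i
  exact ((forall₂_ofFn _).1 h1).2 j

theorem denotes_map_range {d : ℕ} {A : Matrix (Fin d) (Fin d) ℝ} (F : ℕ → ℕ → RealAlgCode)
    (h : ∀ i j : Fin d, RealAlgCode.Denotes (F i j) (A i j)) :
    MatCode.Denotes ((List.range d).map fun i => (List.range d).map fun j => F i j) A := by
  refine (forall₂_ofFn []).2 ⟨by simp, fun i => ?_⟩
  have e1 : ((List.range d).map fun i => (List.range d).map fun j => F i j).getD i [] =
      (List.range d).map fun j => F i j := by
    rw [List.getD_eq_getElem _ _ (by simp)]; simp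
  rw [e1]
  refine (forall₂_ofFn ([], (0, 0), (0, 0))).2 ⟨by simp, fun j => ?_⟩
  have e2 : ((List.range d).map fun j => F i j).getD j ([], (0, 0), (0, 0)) = F i j := by
    rw [List.getD_eq_getElem _ _ (by simp)]; simp
  rw [e2]
  exact h i j

theorem polyOfList_eq (l : List ℤ) : polyOfList l = listPoly l := rfl

theorem aeval_polyOfList (l : List ℤ) (y : ℝ) :
    Polynomial.aeval y (polyOfList l) = realEval l y := rfl

theorem realEval_sub (f g : List ℤ) (x : ℝ) :
    realEval (listSub f g) x = realEval f x - realEval g x := by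
  simp [realEval, listPoly_sub, Polynomial.eval₂_sub]

theorem realEval_mul (f g : List ℤ) (x : ℝ) :
    realEval (listMul f g) x = realEval f x * realEval g x := by
  simp [realEval, listPoly_mul, Polynomial.eval₂_mul]

theorem realEval_sum (n : ℕ) (F : ℕ → List ℤ) (x : ℝ) :
    realEval (listSum n F) x = ∑ i ∈ Finset.range n, realEval (F i) x := by
  simp [realEval, listPoly_sum, Polynomial.eval₂_finsetSum]

theorem realEval_scale (a : ℤ) (g : List ℤ) (x : ℝ) :
    realEval (listScale a g) x = a * realEval g x := by
  rw [realEval, listPoly_scale, Polynomial.eval₂_mul, Polynomial.eval₂_C, eq_intCast, realEval]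

theorem realEval_singleton (a : ℤ) (x : ℝ) : realEval [a] x = a := by
  rw [realEval, listPoly_cons, listPoly_nil, mul_zero, add_zero, Polynomial.eval₂_C, eq_intCast]

theorem realEval_listHom_eq_zero_iff {p f : List ℤ} {δ : ℤ} (hδ : 0 < δ) (θ : ℝ) :
    realEval (listHom p f δ) θ = 0 ↔ realEval p (realEval f θ / δ) = 0 := by
  have hδ' : (δ : ℝ) ≠ 0 := by exact_mod_cast hδ.ne'
  have h := eval₂_listHom (Int.castRingHom ℝ) θ (realEval f θ / δ) p f δ
    (by simp only [eq_intCast, realEval]; field_simp)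
  simp only [eq_intCast] at h
  change realEval _ θ * _ = _ * realEval p _ at h
  constructor
  · intro h0
    rw [h0, zero_mul, eq_comm, mul_eq_zero] at h
    exact h.resolve_left (pow_ne_zero _ hδ')
  · intro h0
    rw [h0, mul_zero, mul_eq_zero] at h
    exact h.resolve_right hδ'

theorem realEval_lowerPoly (c : RealAlgCode) (f : List ℤ) {δ : ℤ} (hδ : 0 < δ) (θ : ℝ) :
    0 < realEval (lowerPoly c f δ) θ ↔ (RatCode.val c.2.1 : ℝ) < realEval f θ / δ := by
  have hδ' : (0 : ℝ) < δ := by exact_mod_cast hδ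
  have h : realEval (lowerPoly c f δ) θ = (c.2.1.2 + 1) * realEval f θ - δ * c.2.1.1 := by
    rw [lowerPoly, realEval_sub, realEval_scale, realEval_singleton]
    push_cast
    ring
  rw [h, RatCode.val]
  push_cast
  rw [div_lt_div_iff₀ (by positivity) hδ', sub_pos]
  constructor <;> intro <;> linarith

theorem realEval_upperPoly (c : RealAlgCode) (f : List ℤ) {δ : ℤ} (hδ : 0 < δ) (θ : ℝ) :
    0 < realEval (upperPoly c f δ) θ ↔ realEval f θ / δ < (RatCode.val c.2.2 : ℝ) := by
  have hδ' : (0 : ℝ) < δ := by exact_mod_cast hδ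
  have h : realEval (upperPoly c f δ) θ = δ * c.2.2.1 - (c.2.2.2 + 1) * realEval f θ := by
    rw [upperPoly, realEval_sub, realEval_scale, realEval_singleton]
    push_cast
    ring
  rw [h, RatCode.val]
  push_cast
  rw [div_lt_div_iff₀ hδ' (by positivity), sub_pos]
  constructor <;> intro <;> linarith

theorem listPoly_toGaussian (l : List ℤ) :
    listPoly (toGaussian l) = (listPoly l).map (Int.castRingHom GaussianInt) := by
  rw [map_listPoly]
  rfl

theorem gaussianEval_toGaussian (l : List ℤ) (x : ℝ) :
    gaussianEval (toGaussian l) x = (realEval l x : ℂ) := by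
  rw [gaussianEval, listPoly_toGaussian, Polynomial.eval₂_map, realEval, ← Complex.ofRealHom_eq_coe,
    ← Complex.ofRealHom_eq_coe, Polynomial.hom_eval₂]
  congr 1
  exact RingHom.ext_int _ _

theorem gaussianEval_sub (f g : List GaussianInt) (x : ℝ) :
    gaussianEval (listSub f g) x = gaussianEval f x - gaussianEval g x := by
  simp [gaussianEval, listPoly_sub, Polynomial.eval₂_sub]

theorem gaussianEval_mul (f g : List GaussianInt) (x : ℝ) :
    gaussianEval (listMul f g) x = gaussianEval f x * gaussianEval g x := by
  simp [gaussianEval, listPoly_mul, Polynomial.eval₂_mul]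

theorem gaussianEval_scale (a : GaussianInt) (g : List GaussianInt) (x : ℝ) :
    gaussianEval (listScale a g) x = a * gaussianEval g x := by
  simp [gaussianEval, listPoly_scale, Polynomial.eval₂_mul]

theorem gaussianEval_sum (n : ℕ) (F : ℕ → List GaussianInt) (x : ℝ) :
    gaussianEval (listSum n F) x = ∑ i ∈ Finset.range n, gaussianEval (F i) x := by
  simp [gaussianEval, listPoly_sum, Polynomial.eval₂_finsetSum]

theorem gaussianEval_singleton (a : GaussianInt) (x : ℝ) : gaussianEval [a] x = a := by
  simp [gaussianEval]

theorem toComplex_ofInt (a : ℤ) : ((⟨a, 0⟩ : GaussianInt) : ℂ) = a := by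
  simp [GaussianInt.toComplex_def]

theorem abs_sub_lt_one_iff (ρ : ℤ) (N : ℕ) (y : ℝ) :
    |(((N : ℤ) + 1 : ℤ) : ℝ) * y - ρ| < 1 ↔
      (RatCode.val (ρ - 1, N) : ℝ) < y ∧ y < (RatCode.val (ρ + 1, N) : ℝ) := by
  have h : (0 : ℝ) < (N : ℝ) + 1 := by positivity
  rw [abs_lt, RatCode.val, RatCode.val]
  push_cast
  rw [div_lt_iff₀ h, lt_div_iff₀ h]
  constructor <;> rintro ⟨h1, h2⟩ <;> constructor <;> linarith

theorem isolatedCode_denotes {x : List ℤ × ℤ × ℕ} {b : ℝ}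
    (h : DominantLinear (listHom x.1 [x.2.1, 1] ((x.2.2 : ℤ) + 1)))
    (hb : realEval x.1 b = 0)
    (hlow : (RatCode.val (isolatedCode x).2.1 : ℝ) < b)
    (hup : b < (RatCode.val (isolatedCode x).2.2 : ℝ)) :
    RealAlgCode.Denotes (isolatedCode x) b := by
  obtain ⟨p, ρ, N⟩ := x
  have hN : (0 : ℤ) < (N : ℤ) + 1 := by positivity
  have hu := existsUnique_of_dominantLinear hN h
  simp only [isolatedCode] at *
  have hb' := (abs_sub_lt_one_iff ρ N b).2 ⟨hlow, hup⟩
  refine ⟨fun h0 => ?_, fun y => ?_⟩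
  -- For the zero polynomial, `ρ / (N + 1)` and `(ρ + 1/2) / (N + 1)` would be two roots in the
  -- interval.
  · have hz : ∀ y, realEval p y = 0 := fun y => by
      rw [← aeval_polyOfList, h0, map_zero]
    have hN' : (((N : ℤ) + 1 : ℤ) : ℝ) ≠ 0 := by exact_mod_cast hN.ne'
    have h1 := hu.unique (y₁ := ρ / (((N : ℤ) + 1 : ℤ) : ℝ))
      (y₂ := (ρ + 1 / 2) / (((N : ℤ) + 1 : ℤ) : ℝ))
      ⟨by rw [mul_div_cancel₀ _ hN']; simp, hz _⟩
      ⟨by rw [mul_div_cancel₀ _ hN']; simp; norm_num, hz _⟩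
    rw [div_left_inj' hN'] at h1
    linarith
  · rw [aeval_polyOfList, ← abs_sub_lt_one_iff]
    constructor
    · rintro ⟨h1, h2⟩
      exact hu.unique ⟨h2, h1⟩ ⟨hb', hb⟩
    · rintro rfl
      exact ⟨hb, hb'⟩

theorem RealAlgCode.Denotes.isAlgebraic {c : RealAlgCode} {x : ℝ} (h : RealAlgCode.Denotes c x) :
    IsAlgebraic ℚ x := by
  have h1 : IsAlgebraic ℤ x := ⟨_, h.1, ((h.2 x).2 rfl).1⟩
  exact h1.extendScalars (algebraMap ℤ ℚ).injective_int

theorem MatCode.Denotes.isAlgebraic {d : ℕ} {c : MatCode} {A : Matrix (Fin d) (Fin d) ℝ}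
    (h : MatCode.Denotes c A) : IsAlgebraicMatrix A :=
  fun i j => (h.entry i j).isAlgebraic

/-- Soundness of an arbitrary valid certificate. Evaluation at the isolated root `θ` of the modulus
turns divisibilities into the equations of `SpectralData`, and `NoFactors` supplies the independence
of the powers of `θ`. Since the entries of `B` are integer polynomials in `θ` over an integer, `B`
is real without further conditions. -/
theorem LoopCert.Valid.exists_spectralData {d : ℕ} {c : MatCode} {w : LoopCert}
    (h : w.Valid d c) {A : Matrix (Fin d) (Fin d) ℝ} (hc : MatCode.Denotes c A) :
    ∃ (B : Matrix (Fin d) (Fin d) ℝ) (s : ℕ) (ν μ : Fin s → ℂ)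
      (W : Fin s → ℕ → Matrix (Fin d) (Fin d) ℂ),
      SpectralData A B ν μ W ∧ (∀ l, μ l ≠ 0) ∧ SameRelations ν μ ∧
        MatCode.Denotes (w.output d) B := by
  obtain ⟨⟨hM, hδ, hβ⟩, ⟨hlead, hno⟩, hiso, hineq, hlen, hid⟩ := h
  obtain ⟨θ, ⟨hθ1, hθ2⟩, -⟩ := existsUnique_of_dominantLinear hM
    (hiso _ (List.mem_cons_self ..))
  have hpos : ∀ f ∈ LoopCert.inequalities d c w, 0 < realEval f θ := fun f hf =>
    realEval_pos_of_dominantConst hM (hineq f hf) hθ1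
  have hzero : ∀ f ∈ LoopCert.identities d c w, gaussianEval f θ = 0 := by
    intro f hf
    obtain ⟨r, -, hr⟩ := hid f hf
    have h1 := (listPoly_eq_zero_iff _).2 hr
    have h2 : gaussianEval (listSub f (listMul (toGaussian w.modulus) r)) θ = 0 := by
      rw [gaussianEval, h1, Polynomial.eval₂_zero]
    rw [gaussianEval_sub, gaussianEval_mul, gaussianEval_toGaussian, hθ2] at h2
    simpa using h2
  simp only [LoopCert.inequalities, List.mem_append, or_imp, forall_and,
    forall_mem_allEntries] at hpos
  obtain ⟨hlowA, hupA, hlowB, hupB⟩ := hpos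
  simp only [LoopCert.identities, List.mem_append, or_imp, forall_and,
    forall_mem_allEntries, List.mem_flatMap, List.mem_range, forall_exists_index, and_imp]
    at hzero
  obtain ⟨hrootA, hrootB, hchain, hend, hsum, hact, hcomm⟩ := hzero
  have hchain' : ∀ l < w.size, ∀ k < d, ∀ i < d, ∀ j < d,
      gaussianEval (w.chainPoly d l k i j) θ = 0 := fun l hl k hk i hi j hj =>
    hchain _ l hl k hk (mem_allEntries.2 ⟨i, hi, j, hj, rfl⟩)
  have hend' : ∀ l < w.size, ∀ i < d, ∀ j < d,
      gaussianEval (w.vector l d i j) θ = 0 := fun l hl i hi j hj =>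
    hend _ l hl (mem_allEntries.2 ⟨i, hi, j, hj, rfl⟩)
  have hact' : ∀ l < w.size, ∀ i < d, ∀ j < d,
      gaussianEval (w.actPoly d l i j) θ = 0 := fun l hl i hi j hj =>
    hact _ l hl (mem_allEntries.2 ⟨i, hi, j, hj, rfl⟩)
  have hδ' : (w.denA : ℝ) ≠ 0 := by exact_mod_cast hδ.ne'
  have hβ' : (w.denB : ℝ) ≠ 0 := by exact_mod_cast hβ.ne'
  have hδc : (w.denA : ℂ) ≠ 0 := by exact_mod_cast hδ.ne'
  have hβc : (w.denB : ℂ) ≠ 0 := by exact_mod_cast hβ.ne'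
  -- The certified number is a root of the coded polynomial inside the isolating interval, so it is
  -- the entry of `A`.
  have hA : ∀ i j : Fin d, realEval (w.entryA i j) θ = w.denA * A i j := by
    intro i j
    have h1 := hrootA i i.2 j j.2
    rw [rootPoly, gaussianEval_toGaussian, Complex.ofReal_eq_zero,
      realEval_listHom_eq_zero_iff hδ] at h1
    have h2 := ((hc.entry i j).2 (realEval (w.entryA i j) θ / w.denA)).1
      ⟨h1, (realEval_lowerPoly _ _ hδ θ).1 (hlowA i i.2 j j.2),
        (realEval_upperPoly _ _ hδ θ).1 (hupA i i.2 j j.2)⟩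
    rw [← h2]
    field_simp
  set B : Matrix (Fin d) (Fin d) ℝ := Matrix.of fun i j => realEval (w.entryB i j) θ / w.denB
    with hBdef
  have hB : ∀ i j : Fin d, realEval (w.entryB i j) θ = w.denB * B i j := by
    intro i j
    rw [hBdef, Matrix.of_apply]
    field_simp
  have hν : ∀ l, gaussianEval (w.eigenvalue l) θ =
      w.denA * (gaussianEval (w.eigenvalue l) θ / (w.denA : ℝ)) := by
    intro l; push_cast; field_simp
  set W : Fin w.size → ℕ → Matrix (Fin d) (Fin d) ℂ := fun l k =>
    Matrix.of fun i j => gaussianEval (w.vector l k i j) θ / w.denA with hWdef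
  have hW : ∀ (l : Fin w.size) k (i j : Fin d), gaussianEval (w.vector l k i j) θ =
      w.denA * W l k i j := by
    intro l k i j
    change _ = _ * (gaussianEval (w.vector l k i j) θ / w.denA)
    field_simp
  refine ⟨B, w.size, fun l => gaussianEval (w.eigenvalue l) θ / (w.denA : ℝ),
    fun l => gaussianValue (w.eigenvalue l), W, ⟨?_, ?_, ?_, ?_, ?_⟩,
    fun l => gaussianValue_ne_zero _, ?_, ?_⟩
  · intro l k hk
    ext i j
    have h1 := hchain' l l.2 k hk i i.2 j j.2
    simp only [LoopCert.chainPoly, gaussianEval_sub, gaussianEval_scale, gaussianEval_sum,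
      gaussianEval_mul, gaussianEval_toGaussian, toComplex_ofInt, Finset.sum_range, hA, hW] at h1
    rw [hν] at h1
    rw [Matrix.smul_apply, sub_mul, Matrix.sub_apply, Matrix.smul_mul, one_mul, Matrix.smul_apply,
      Matrix.mul_apply, smul_eq_mul, smul_eq_mul]
    simp only [complexify_apply]
    have h2 : ∑ t : Fin d, ((w.denA * A i t : ℝ) : ℂ) * (w.denA * W l k t j) =
        w.denA * w.denA * ∑ t : Fin d, (A i t : ℂ) * W l k t j := by
      rw [Finset.mul_sum]
      refine Finset.sum_congr rfl fun t _ => ?_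
      push_cast; ring
    rw [h2] at h1
    push_cast at h1
    have h3 : (w.denA : ℂ) * w.denA ≠ 0 := mul_ne_zero hδc hδc
    apply mul_left_cancel₀ h3
    push_cast
    linear_combination h1
  · intro l
    ext i j
    have h1 := hend' l l.2 i i.2 j j.2
    rw [hW] at h1
    simpa using (mul_eq_zero.1 h1).resolve_left hδc
  · ext i j
    have h1 := hsum i i.2 j j.2
    simp only [LoopCert.sumPoly, gaussianEval_sub, gaussianEval_sum, gaussianEval_singleton,
      Finset.sum_range, hW, ← Finset.mul_sum] at h1
    rw [Matrix.sum_apply, Matrix.one_apply]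
    apply mul_left_cancel₀ hδc
    simp only [Fin.val_inj] at h1
    split_ifs at h1 ⊢
    · rw [toComplex_ofInt] at h1
      linear_combination h1
    · rw [map_zero] at h1
      linear_combination h1
  · intro l
    ext i j
    have h1 := hact' l l.2 i i.2 j j.2
    simp only [LoopCert.actPoly, gaussianEval_sub, gaussianEval_scale, gaussianEval_sum,
      gaussianEval_mul, gaussianEval_toGaussian, toComplex_ofInt, map_mul, hW, ← Finset.mul_sum]
      at h1
    simp only [Finset.sum_range (fun t => (realEval (w.entryB i t) θ : ℂ) * _), hB, hW] at h1
    have h2 : ∑ t : Fin d, ((w.denB * B i t : ℝ) : ℂ) * (w.denA * W l 0 t j) =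
        w.denB * w.denA * ∑ t : Fin d, (B i t : ℂ) * W l 0 t j := by
      rw [Finset.mul_sum]
      refine Finset.sum_congr rfl fun t _ => ?_
      push_cast; ring
    rw [h2] at h1
    rw [Matrix.smul_apply, Matrix.mul_apply, Matrix.sum_apply, smul_eq_mul, gaussianValue]
    simp only [complexify_apply]
    have h3 : (gaussianNum (listScale (-1) (w.eigenvalue l)) : ℂ) ≠ 0 :=
      GaussianInt.toComplex_eq_zero.not.2 (gaussianNum_ne_zero _)
    rw [div_mul_eq_mul_div, eq_div_iff h3]
    apply mul_left_cancel₀ (mul_ne_zero hβc hδc)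
    linear_combination h1
  · ext i j
    have h1 := hcomm i i.2 j j.2
    rw [LoopCert.commPoly, gaussianEval_toGaussian, Complex.ofReal_eq_zero, realEval_sub,
      realEval_sum, realEval_sum] at h1
    simp only [realEval_mul, Finset.sum_range, hA, hB] at h1
    rw [Matrix.mul_apply, Matrix.mul_apply]
    apply mul_left_cancel₀ (mul_ne_zero hδ' hβ')
    rw [Finset.mul_sum, Finset.mul_sum]
    rw [sub_eq_zero] at h1
    convert h1 using 2 <;> ring
  · refine sameRelations_gaussianValue (D := w.modulus.length - 1) hδ' (fun g hg hg0 => ?_) _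
      fun l => hlen l l.2
    exact eq_zero_of_noFactors hlead hno hθ2 g hg hg0
  · refine denotes_map_range _ fun i j => isolatedCode_denotes
      (hiso _ (List.mem_cons_of_mem _ (mem_allEntries.2 ⟨i, i.2, j, j.2, rfl⟩))) ?_ ?_ ?_
    · have h1 := hrootB i i.2 j j.2
      rw [rootPoly, gaussianEval_toGaussian, Complex.ofReal_eq_zero,
        realEval_listHom_eq_zero_iff hβ] at h1
      exact h1
    · exact (realEval_lowerPoly _ _ hβ θ).1 (hlowB i i.2 j j.2)
    · exact (realEval_upperPoly _ _ hβ θ).1 (hupB i i.2 j j.2)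

/-! ### Real number fields -/

open IntermediateField in
theorem exists_adjoin_eq_adjoin_simple {F E : Type*} [Field F] [Field E] [Algebra F E]
    [CharZero F] (S : Finset E) (hS : ∀ x ∈ S, IsAlgebraic F x) :
    ∃ α : E, adjoin F (S : Set E) = F⟮α⟯ := by
  have hfin : FiniteDimensional F (adjoin F (S : Set E)) :=
    finiteDimensional_adjoin fun x hx => (hS x hx).isIntegral
  obtain ⟨α, hα⟩ := Field.exists_primitive_element F (adjoin F (S : Set E))
  have := congrArg lift hα
  rw [lift_adjoin_simple, lift_top] at this
  exact ⟨α, this.symm⟩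

open IntermediateField in
-- An integer multiple of a primitive element is integral. Its minimal polynomial is then monic over
-- `ℤ`, and reduction modulo it stays within integer polynomials.
theorem exists_integral_generator (S : Finset ℝ) (hS : ∀ x ∈ S, IsAlgebraic ℚ x) :
    ∃ θ : ℝ, IsIntegral ℤ θ ∧ ∀ x ∈ S, x ∈ ℚ⟮θ⟯ := by
  obtain ⟨α, h⟩ := exists_adjoin_eq_adjoin_simple S hS
  have hα : IsAlgebraic ℚ α := by
    have h1 : Algebra.IsAlgebraic ℚ (adjoin ℚ (S : Set ℝ)) :=
      isAlgebraic_adjoin fun x hx => (hS x hx).isIntegral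
    have h2 : α ∈ adjoin ℚ (S : Set ℝ) := h ▸ mem_adjoin_simple_self ℚ α
    exact (h1.isAlgebraic ⟨α, h2⟩).algebraMap
  have hα'' : IsAlgebraic ℤ α := (IsFractionRing.isAlgebraic_iff ℤ ℚ ℝ).2 hα
  obtain ⟨n, hn, hint⟩ := hα''.exists_integral_multiple
  refine ⟨n • α, hint, fun x hx => ?_⟩
  have h1 : α ∈ ℚ⟮n • α⟯ := by
    have h2 : n • α ∈ ℚ⟮n • α⟯ := mem_adjoin_simple_self ℚ _
    have h3 : α = ((n : ℚ)⁻¹) • (n • α) := by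
      rw [Algebra.smul_def, zsmul_eq_mul]
      have : (n : ℝ) ≠ 0 := by exact_mod_cast hn
      simp [this]
    have h4 := IntermediateField.smul_mem ℚ⟮n • α⟯ (x := (n : ℚ)⁻¹) h2
    rwa [← h3] at h4
  have h3 : x ∈ ℚ⟮α⟯ := h ▸ subset_adjoin ℚ _ hx
  exact (adjoin_simple_le_iff.2 h1) h3

theorem eval₂_intCast_eq_aeval (p : Polynomial ℤ) (θ : ℝ) :
    p.eval₂ (Int.castRingHom ℝ) θ = Polynomial.aeval θ p := rfl

theorem minpoly_map_rat {θ : ℝ} (hθ : IsIntegral ℤ θ) :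
    (minpoly ℤ θ).map (Int.castRingHom ℚ) = minpoly ℚ θ :=
  (minpoly.isIntegrallyClosed_eq_field_fractions' ℚ hθ).symm

theorem minpoly_derivative_ne_zero {θ : ℝ} (hθ : IsIntegral ℤ θ) :
    Polynomial.aeval θ (minpoly ℤ θ).derivative ≠ 0 := by
  have h : IsIntegral ℚ θ := hθ.tower_top
  have h1 := (minpoly.irreducible h).separable.aeval_derivative_ne_zero (minpoly.aeval ℚ θ)
  rw [← minpoly_map_rat hθ, Polynomial.derivative_map] at h1
  rwa [show Int.castRingHom ℚ = algebraMap ℤ ℚ from rfl, Polynomial.aeval_map_algebraMap] at h1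

theorem eq_zero_of_degree_lt_minpoly {θ : ℝ} (hθ : IsIntegral ℤ θ) (g : Polynomial ℤ)
    (hg : g.degree < ((minpoly ℤ θ).natDegree : ℕ))
    (h0 : g.eval₂ (Int.castRingHom ℝ) θ = 0) : g = 0 := by
  have h1 := minpoly.isIntegrallyClosed_dvd hθ (p := g) h0
  by_contra h
  have h2 := Polynomial.degree_le_of_dvd h1 h
  rw [Polynomial.degree_eq_natDegree (minpoly.ne_zero hθ)] at h2
  exact absurd hg (not_lt.2 h2)

theorem exists_realEval_eq_mul {θ x : ℝ} (hθ : IsIntegral ℤ θ)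
    (hx : x ∈ IntermediateField.adjoin ℚ {θ}) :
    ∃ δ : ℤ, 0 < δ ∧ ∃ f : List ℤ, f.length = (minpoly ℤ θ).natDegree ∧ realEval f θ = δ * x := by
  have hθ' : IsIntegral ℚ θ := hθ.tower_top
  rw [← IntermediateField.mem_toSubalgebra,
    IntermediateField.adjoin_simple_toSubalgebra_of_isAlgebraic hθ'.isAlgebraic,
    Algebra.adjoin_singleton_eq_range_aeval] at hx
  obtain ⟨p, rfl⟩ := hx
  obtain ⟨b, hbM, hb⟩ := IsLocalization.integerNormalization_spec (nonZeroDivisors ℤ) p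
  set q := IsLocalization.integerNormalization (nonZeroDivisors ℤ) p
  have hb0 : b ≠ 0 := nonZeroDivisors.ne_zero hbM
  have hpos : 0 < (minpoly ℤ θ).natDegree := minpoly.natDegree_pos hθ
  have hmon := minpoly.monic hθ
  have hq : Polynomial.aeval θ q = (b : ℝ) * Polynomial.aeval θ p := by
    have := congrArg (Polynomial.aeval θ) hb
    rw [Polynomial.aeval_map_algebraMap, map_zsmul] at this
    rw [this, zsmul_eq_mul]
  -- The second factor `b` makes the denominator `b * b`, which is positive whatever the sign of
  -- `b`.
  have hr : Polynomial.aeval θ ((Polynomial.C b * q) %ₘ minpoly ℤ θ) =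
      ((b * b : ℤ) : ℝ) * Polynomial.aeval θ p := by
    rw [Polynomial.aeval_modByMonic_eq_self_of_root (minpoly.aeval ℤ θ), map_mul, hq,
      Polynomial.aeval_C]
    push_cast
    simp
    ring
  obtain ⟨f, hf, hf'⟩ := exists_listPoly ((Polynomial.C b * q) %ₘ minpoly ℤ θ)
    (minpoly ℤ θ).natDegree (Polynomial.natDegree_modByMonic_lt _ hmon
      fun h => by rw [h, Polynomial.natDegree_one] at hpos; exact lt_irrefl _ hpos)
  refine ⟨b * b, by rcases lt_or_gt_of_ne hb0 with h | h <;> nlinarith, f, hf, ?_⟩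
  rw [realEval, hf', eval₂_intCast_eq_aeval, hr]
  rfl

theorem exists_common_denominator {θ : ℝ} (hθ : IsIntegral ℤ θ) (S : Finset ℝ)
    (hS : ∀ x ∈ S, x ∈ IntermediateField.adjoin ℚ {θ}) :
    ∃ δ : ℤ, 0 < δ ∧ ∀ x ∈ S, ∃ f : List ℤ, f.length = (minpoly ℤ θ).natDegree ∧
      realEval f θ = δ * x := by
  have hmul : ∀ (x : ℝ) (a δ : ℤ), (∃ f : List ℤ, f.length = (minpoly ℤ θ).natDegree ∧
      realEval f θ = δ * x) → ∃ f : List ℤ, f.length = (minpoly ℤ θ).natDegree ∧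
      realEval f θ = (a * δ : ℤ) * x := by
    rintro x a δ ⟨f, hf, hf'⟩
    refine ⟨listScale a f, by simpa [listScale] using hf, ?_⟩
    rw [realEval_scale, hf']
    push_cast
    ring
  classical
  induction S using Finset.induction_on with
  | empty => exact ⟨1, one_pos, by simp⟩
  | insert x S _ ih =>
    obtain ⟨δ, hδ, h⟩ := ih fun y hy => hS y (Finset.mem_insert_of_mem hy)
    obtain ⟨ε, hε, h'⟩ := exists_realEval_eq_mul hθ (hS x (Finset.mem_insert_self ..))
    refine ⟨δ * ε, mul_pos hδ hε, fun y hy => ?_⟩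
    rcases Finset.mem_insert.1 hy with rfl | hy
    · exact hmul _ _ _ h'
    · rw [mul_comm δ]
      exact hmul _ _ _ (h y hy)

theorem listPoly_re_im (f : List GaussianInt) :
    listPoly f = (listPoly (f.map Zsqrtd.re)).map (Int.castRingHom GaussianInt) +
      Polynomial.C ⟨0, 1⟩ * (listPoly (f.map Zsqrtd.im)).map (Int.castRingHom GaussianInt) := by
  induction f with
  | nil => simp
  | cons a f ih =>
    have ha : a = (a.re : GaussianInt) + ⟨0, 1⟩ * (a.im : GaussianInt) := by
      ext <;> simp
    simp only [listPoly_cons, List.map_cons, Polynomial.map_add, Polynomial.map_mul,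
      Polynomial.map_C, Polynomial.map_X]
    conv_lhs => rw [ih, ha, Polynomial.C_add, Polynomial.C_mul]
    simp only [eq_intCast]
    ring

theorem gaussianEval_re_im (f : List GaussianInt) (x : ℝ) :
    gaussianEval f x =
      (realEval (f.map Zsqrtd.re) x : ℂ) + Complex.I * (realEval (f.map Zsqrtd.im) x : ℂ) := by
  have h : ∀ l : List ℤ, ((listPoly l).map (Int.castRingHom GaussianInt)).eval₂
      GaussianInt.toComplex (x : ℂ) = (realEval l x : ℂ) := by
    intro l
    rw [← gaussianEval_toGaussian, gaussianEval, listPoly_toGaussian]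
  rw [gaussianEval, listPoly_re_im, Polynomial.eval₂_add, Polynomial.eval₂_mul, h, h,
    Polynomial.eval₂_C]
  simp [GaussianInt.toComplex_def]

/-- Real and imaginary parts of the coefficients give integer polynomials that vanish at `θ`, and
the monic minimal polynomial divides both over `ℤ`. -/
theorem exists_quotient {θ : ℝ} (hθ : IsIntegral ℤ θ) {m : List ℤ}
    (hm : listPoly m = minpoly ℤ θ) {f : List GaussianInt} (hf : gaussianEval f θ = 0) :
    ∃ r, ∀ a ∈ listSub f (listMul (toGaussian m) r), a = 0 := by
  rw [gaussianEval_re_im] at hf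
  have hre := congrArg Complex.re hf
  have him := congrArg Complex.im hf
  simp only [Complex.add_re, Complex.ofReal_re, Complex.mul_re, Complex.I_re, Complex.I_im,
    Complex.ofReal_im, Complex.zero_re] at hre
  simp only [Complex.add_im, Complex.ofReal_re, Complex.mul_im, Complex.I_re, Complex.I_im,
    Complex.ofReal_im, Complex.zero_im] at him
  obtain ⟨p, hp⟩ := minpoly.isIntegrallyClosed_dvd hθ (p := listPoly (f.map Zsqrtd.re))
    (by rw [← eval₂_intCast_eq_aeval]; change realEval _ _ = 0; linarith)
  obtain ⟨q, hq⟩ := minpoly.isIntegrallyClosed_dvd hθ (p := listPoly (f.map Zsqrtd.im))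
    (by rw [← eval₂_intCast_eq_aeval]; change realEval _ _ = 0; linarith)
  obtain ⟨r, -, hr⟩ := exists_listPoly (p.map (Int.castRingHom GaussianInt) +
    Polynomial.C ⟨0, 1⟩ * q.map (Int.castRingHom GaussianInt)) _ (Nat.lt_succ_self _)
  refine ⟨r, (listPoly_eq_zero_iff _).1 ?_⟩
  have hm' : listPoly (toGaussian m) = (minpoly ℤ θ).map (Int.castRingHom GaussianInt) := by
    rw [← hm, listPoly_toGaussian]
  rw [listPoly_sub, listPoly_mul, hr, hm', listPoly_re_im f, hp, hq, Polynomial.map_mul,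
    Polynomial.map_mul]
  ring

theorem exists_isolation {b : ℝ} (hb : IsAlgebraic ℚ b) : ∃ x : List ℤ × ℤ × ℕ,
    DominantLinear (listHom x.1 [x.2.1, 1] ((x.2.2 : ℤ) + 1)) ∧ realEval x.1 b = 0 ∧
      (RatCode.val (isolatedCode x).2.1 : ℝ) < b ∧
      b < (RatCode.val (isolatedCode x).2.2 : ℝ) := by
  have hb' : IsAlgebraic ℤ b := (IsFractionRing.isAlgebraic_iff ℤ ℚ ℝ).2 hb
  obtain ⟨n, hn, hint⟩ := hb'.exists_integral_multiple
  have hn' : (n : ℝ) ≠ 0 := by exact_mod_cast hn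
  -- The minimal polynomial of the integral number `n • b` has simple roots; substituting `n X`
  -- gives an integer polynomial with `b` as a simple root.
  obtain ⟨p, -, hp⟩ := exists_listPoly ((minpoly ℤ (n • b)).comp
    (Polynomial.C n * Polynomial.X)) _ (Nat.lt_succ_self _)
  have e1 : Polynomial.aeval b (Polynomial.C n * Polynomial.X : Polynomial ℤ) = n • b := by
    simp
  have h0 : realEval p b = 0 := by
    rw [realEval, hp, eval₂_intCast_eq_aeval, Polynomial.aeval_comp, e1, minpoly.aeval]
  have h1 : Polynomial.eval b (Polynomial.derivative ((listPoly p).map (Int.castRingHom ℝ)))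
      ≠ 0 := by
    rw [Polynomial.derivative_map, Polynomial.eval_map, eval₂_intCast_eq_aeval, hp,
      Polynomial.derivative_comp, map_mul, Polynomial.aeval_comp, e1]
    refine mul_ne_zero ?_ (minpoly_derivative_ne_zero hint)
    simpa using hn
  obtain ⟨M, hM, hM0⟩ := ((eventually_dominantLinear p b h0 h1).and
    (Filter.eventually_gt_atTop 0)).exists
  -- A `RatCode` stores the denominator minus one.
  obtain ⟨N, rfl⟩ : ∃ N, M = N + 1 := ⟨M - 1, by omega⟩
  refine ⟨(p, round (((N + 1 : ℕ) : ℝ) * b), N), by simpa using hM, h0, ?_⟩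
  have h2 := abs_sub_round (((N + 1 : ℕ) : ℝ) * b)
  refine (abs_sub_lt_one_iff _ _ _).1 ?_
  push_cast at h2 ⊢
  linarith

/-! ### The spectral decomposition over an algebraically closed field -/

open Polynomial in
-- Chinese remainder theorem for the pairwise coprime powers `(X - a)^d`. Evaluated at a matrix, the
-- `e a` become its spectral projections.
theorem exists_partition_of_unity {F : Type*} [Field F] (T : Finset F) (d : ℕ) :
    ∃ e : F → F[X], ∀ a ∈ T, (X - C a) ^ d ∣ e a - 1 ∧
      ∀ b ∈ T, b ≠ a → (X - C b) ^ d ∣ e a := by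
  classical
  have h : ∀ a ∈ T, ∃ e : F[X], (X - C a) ^ d ∣ e - 1 ∧
      ∀ b ∈ T, b ≠ a → (X - C b) ^ d ∣ e := by
    intro a _
    have h1 : IsCoprime ((X - C a) ^ d) (∏ b ∈ T.erase a, (X - C b) ^ d) :=
      IsCoprime.prod_right fun b hb => IsCoprime.pow
        (pairwise_coprime_X_sub_C Function.injective_id (Finset.ne_of_mem_erase hb).symm)
    obtain ⟨u, v, huv⟩ := h1
    refine ⟨v * ∏ b ∈ T.erase a, (X - C b) ^ d, ⟨-u, ?_⟩, fun b hb hba => ?_⟩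
    · rw [← huv]; ring
    · exact Dvd.dvd.mul_left (Finset.dvd_prod_of_mem (fun b => (X - C b) ^ d)
        (Finset.mem_erase.2 ⟨hba, hb⟩)) _
  choose! e he using h
  exact ⟨e, he⟩

open Polynomial in
-- No eigenvalue has multiplicity above `d`, so the characteristic polynomial divides `p`, and the
-- Cayley–Hamilton theorem applies. Using the exponent `d` throughout avoids the true
-- multiplicities.
theorem aeval_eq_zero_of_dvd {F : Type*} [Field F] [IsAlgClosed F] {d : ℕ}
    (A : Matrix (Fin d) (Fin d) F) (p : F[X])
    (h : ∀ a ∈ A.charpoly.roots, (X - C a) ^ d ∣ p) : aeval A p = 0 := by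
  classical
  rcases eq_or_ne p 0 with rfl | hp
  · exact map_zero _
  have h0 : A.charpoly ≠ 0 := A.charpoly_monic.ne_zero
  have h1 : A.charpoly ∣ p := by
    rw [(IsAlgClosed.splits _).dvd_iff_roots_le_roots h0 hp, Multiset.le_iff_count]
    intro a
    by_cases ha : a ∈ A.charpoly.roots
    · rw [count_roots p]
      refine le_trans ?_ ((le_rootMultiplicity_iff hp).2 (h a ha))
      refine (Multiset.count_le_card _ _).trans ((card_roots' _).trans ?_)
      rw [Matrix.charpoly_natDegree_eq_dim, Fintype.card_fin]
    · rw [Multiset.count_eq_zero_of_notMem ha]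
      exact Nat.zero_le _
  obtain ⟨q, rfl⟩ := h1
  rw [map_mul, Matrix.aeval_self_charpoly, zero_mul]

open Polynomial in
theorem aeval_eq_of_dvd {F : Type*} [Field F] [IsAlgClosed F] {d : ℕ}
    (A : Matrix (Fin d) (Fin d) F) {p q : F[X]}
    (h : ∀ a ∈ A.charpoly.roots, (X - C a) ^ d ∣ p - q) : aeval A p = aeval A q := by
  rw [← sub_eq_zero, ← map_sub]
  exact aeval_eq_zero_of_dvd A _ h

open Polynomial in
theorem map_aeval_matrix {F G : Type*} [Field F] [Field G] {d : ℕ} (c : F →+* G)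
    (A : Matrix (Fin d) (Fin d) F) (p : F[X]) :
    (aeval A p).map c = aeval (A.map c) (p.map c) := by
  have h := Polynomial.hom_eval₂ p (algebraMap F (Matrix (Fin d) (Fin d) F)) c.mapMatrix A
  rw [RingHom.mapMatrix_apply, RingHom.mapMatrix_apply] at h
  rw [aeval_def, aeval_def, eval₂_map, h]
  congr 1
  ext a i j
  simp [Matrix.algebraMap_matrix_apply, apply_ite c]

/-- A decomposition of the identity into chains of generalized eigenvectors of `A`; the
involution `σ` of the indices describes the action of a field automorphism `c`. -/
structure SpectralDecomposition {F : Type*} [Field F] {d s : ℕ} (c : F →+* F)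
    (A : Matrix (Fin d) (Fin d) F) (ν : Fin s → F) (σ : Fin s → Fin s)
    (W : Fin s → ℕ → Matrix (Fin d) (Fin d) F) : Prop where
  value_conj : ∀ l, ν (σ l) = c (ν l)
  involutive : Function.Involutive σ
  vector_conj : ∀ l k, W (σ l) k = (W l k).map c
  chain : ∀ l, ∀ k : ℕ, ((k : F) + 1) • W l (k + 1) = (A - ν l • 1) * W l k
  chain_end : ∀ l, W l d = 0
  sum_eq : ∑ l, W l 0 = 1
  mul_eq : ∀ l l' k, W l k * W l' 0 = if l = l' then W l k else 0
  comm : ∀ l k, Commute A (W l k)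

open Polynomial in
-- The `W l k` are the polynomials `(X - ν_l)^k e_{ν_l} / k!` at `A`. Each required identity follows
-- from an identity of polynomials or from congruences modulo all `(X - b)^d`. The field is general
-- so that it can be the field of algebraic numbers.
theorem exists_spectralDecomposition {F : Type*} [Field F] [IsAlgClosed F] [CharZero F] {d : ℕ}
    (c : F →+* F) (hc : ∀ x, c (c x) = x) (A : Matrix (Fin d) (Fin d) F) (hA : A.map c = A) :
    ∃ (s : ℕ) (ν : Fin s → F) (σ : Fin s → Fin s) (W : Fin s → ℕ → Matrix (Fin d) (Fin d) F),
      SpectralDecomposition c A ν σ W := by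
  classical
  set T := A.charpoly.roots.toFinset with hT
  have hmem : ∀ a, a ∈ T ↔ A.charpoly.IsRoot a := fun a => by
    rw [hT, Multiset.mem_toFinset, mem_roots A.charpoly_monic.ne_zero]
  have hcT : ∀ a ∈ T, c a ∈ T := by
    intro a ha
    rw [hmem] at ha ⊢
    have h1 := ha.map (f := c)
    rwa [← Matrix.charpoly_map, hA] at h1
  have hzero : ∀ {p q : F[X]}, (∀ a ∈ T, (X - C a) ^ d ∣ p - q) → aeval A p = aeval A q :=
    fun h => aeval_eq_of_dvd A fun a ha => h a (Multiset.mem_toFinset.2 ha)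
  obtain ⟨e, he⟩ := exists_partition_of_unity T d
  have hother : ∀ a ∈ T, ∀ b ∈ T, b ≠ a → (X - C b) ^ d ∣ e a := fun a ha => (he a ha).2
  set P : F → ℕ → F[X] := fun a k => C ((k.factorial : F)⁻¹) * (X - C a) ^ k * e a with hP
  have hdvdP : ∀ a k, e a ∣ P a k := fun a k => Dvd.intro_left _ rfl
  set ι := T.equivFin with hι
  set ν : Fin T.card → F := fun l => (ι.symm l : F) with hν
  have hνT : ∀ l, ν l ∈ T := fun l => (ι.symm l).2
  have hνinj : Function.Injective ν := Subtype.val_injective.comp ι.symm.injective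
  set σ : Fin T.card → Fin T.card := fun l => ι ⟨c (ν l), hcT _ (hνT l)⟩ with hσ
  have hνσ : ∀ l, ν (σ l) = c (ν l) := fun l => by simp [hν, hσ]
  refine ⟨T.card, ν, σ, fun l k => aeval A (P (ν l) k), hνσ, ?_, ?_, ?_, ?_, ?_, ?_, ?_⟩
  · intro l
    apply hνinj
    rw [hνσ, hνσ, hc]
  · intro l k
    rw [map_aeval_matrix, hA, hνσ]
    -- As `c` fixes `A`, it permutes the eigenvalues; hence `e (c a)` and the image of `e a` under
    -- `c` satisfy the same congruences.
    refine hzero fun b hb => ?_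
    have hsurj : ∀ {b}, b ∈ T → (X - C b) ^ d = ((X - C (c b)) ^ d).map c := fun {b} _ => by
      simp [hc]
    have e1 : P (c (ν l)) k - (P (ν l) k).map c =
        (C ((k.factorial : F)⁻¹) * (X - C (c (ν l))) ^ k) *
          (e (c (ν l)) - (e (ν l)).map c) := by
      simp only [hP, Polynomial.map_mul, Polynomial.map_pow, Polynomial.map_sub, map_X, map_C,
        map_inv₀, map_natCast]
      ring
    rw [e1]
    refine Dvd.dvd.mul_left ?_ _
    by_cases hbl : b = c (ν l)
    · have h1 : (X - C b) ^ d ∣ (e (ν l)).map c - 1 := by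
        have := map_dvd c (he _ (hνT l)).1
        rw [hsurj hb, hbl, hc]
        simpa using this
      have h2 := (he _ (hcT _ (hνT l))).1
      rw [← hbl] at h2 ⊢
      have := dvd_sub h2 h1
      rwa [sub_sub_sub_cancel_right] at this
    · refine dvd_sub (hother _ (hcT _ (hνT l)) b hb hbl) ?_
      rw [hsurj hb]
      refine map_dvd c (hother _ (hνT l) _ (hcT b hb) fun h => hbl ?_)
      rw [← h, hc]
  · intro l k
    have h1 : A - ν l • (1 : Matrix (Fin d) (Fin d) F) = aeval A (X - C (ν l)) := by
      rw [map_sub, aeval_X, aeval_C, Algebra.algebraMap_eq_smul_one]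
    rw [h1, ← map_mul, ← map_smul]
    congr 1
    simp only [hP, smul_eq_C_mul]
    have h2 : ((k + 1).factorial : F) ≠ 0 := by exact_mod_cast (k + 1).factorial_ne_zero
    have h4 : (k.factorial : F) ≠ 0 := by exact_mod_cast k.factorial_ne_zero
    have h3 : C ((k : F) + 1) * C (((k + 1).factorial : F)⁻¹) = C ((k.factorial : F)⁻¹) := by
      rw [← C_mul, Nat.factorial_succ]
      congr 1
      have : (k : F) + 1 ≠ 0 := by exact_mod_cast k.succ_ne_zero
      push_cast
      field_simp
    rw [← h3]
    ring
  · intro l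
    rw [← map_zero (aeval (R := F) A)]
    refine hzero fun b hb => ?_
    rw [sub_zero]
    by_cases hbl : b = ν l
    · rw [hbl]
      exact (Dvd.intro_left _ rfl : (X - C (ν l)) ^ d ∣ C _ * (X - C (ν l)) ^ d).mul_right _
    · exact (hother _ (hνT l) b hb hbl).trans (hdvdP _ _)
  · rw [← map_sum, ← map_one (aeval (R := F) A)]
    refine hzero fun b hb => ?_
    have h0 : ∀ a, P a 0 = e a := fun a => by simp [hP]
    simp only [h0]
    obtain ⟨l, rfl⟩ : ∃ l, ν l = b := ⟨ι ⟨b, hb⟩, by simp [hν]⟩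
    rw [← Finset.add_sum_erase _ _ (Finset.mem_univ l), add_sub_right_comm]
    refine dvd_add (he _ hb).1 (Finset.dvd_sum fun l' hl' => ?_)
    exact hother _ (hνT l') _ hb fun h => (Finset.ne_of_mem_erase hl') (hνinj h).symm
  · intro l l' k
    have h0 : ∀ a, P a 0 = e a := fun a => by simp [hP]
    rw [← map_mul, h0]
    split_ifs with h
    · subst h
      refine hzero fun b hb => ?_
      have e1 : P (ν l) k * e (ν l) - P (ν l) k = P (ν l) k * (e (ν l) - 1) := by ring
      rw [e1]
      by_cases hbl : b = ν l
      · rw [hbl]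
        exact (he _ (hνT l)).1.mul_left _
      · exact ((hother _ (hνT l) b hb hbl).trans (hdvdP _ _)).mul_right _
    · rw [← map_zero (aeval (R := F) A)]
      refine hzero fun b hb => ?_
      rw [sub_zero]
      by_cases hbl : b = ν l
      · refine (hother _ (hνT l') b hb fun hb' => h (hνinj ?_)).mul_left _
        rw [← hbl, hb']
      · exact ((hother _ (hνT l) b hb hbl).trans (hdvdP _ _)).mul_right _
  · intro l k
    have h1 : A = aeval A (X : F[X]) := (aeval_X A).symm
    conv_lhs => rw [h1]
    exact Commute.map (Commute.all _ _) (aeval A)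

/-- Complex conjugation of algebraic numbers. -/
def algebraicConj : algebraicClosure ℚ ℂ →+* algebraicClosure ℚ ℂ :=
  RingHom.codRestrict ((starRingEnd ℂ).comp (algebraMap (algebraicClosure ℚ ℂ) ℂ))
    (algebraicClosure ℚ ℂ) fun x =>
      mem_algebraicClosure_iff.2 ((mem_algebraicClosure_iff.1 x.2).algHom
        (Complex.conjAe.restrictScalars ℚ).toAlgHom)

/-- The decomposition is made over the algebraic numbers and then mapped to `ℂ`, which makes all its
entries algebraic. -/
theorem exists_complex_spectralDecomposition {d : ℕ} (A : Matrix (Fin d) (Fin d) ℝ)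
    (hA : IsAlgebraicMatrix A) :
    ∃ (s : ℕ) (ν : Fin s → ℂ) (σ : Fin s → Fin s) (W : Fin s → ℕ → Matrix (Fin d) (Fin d) ℂ),
      SpectralDecomposition (starRingEnd ℂ) (complexify A) ν σ W ∧
      (∀ l, IsAlgebraic ℚ (ν l)) ∧ ∀ l k i j, IsAlgebraic ℚ (W l k i j) := by
  set F := algebraicClosure ℚ ℂ
  set φ := algebraMap F ℂ
  have hφ : Function.Injective φ := φ.injective
  have hconj : ∀ x : F, φ (algebraicConj x) = starRingEnd ℂ (φ x) := fun x => rfl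
  have hAF : ∀ i j, ((A i j : ℝ) : ℂ) ∈ F := fun i j =>
    mem_algebraicClosure_iff.2 ((hA i j).algebraMap (A := ℂ))
  set A' : Matrix (Fin d) (Fin d) F := Matrix.of fun i j => ⟨(A i j : ℂ), hAF i j⟩
  have hA' : A'.map φ = complexify A := rfl
  have hfix : A'.map algebraicConj = A' := by
    ext i j
    exact Complex.conj_ofReal _
  have hcl : IsAlgClosed F := (algebraicClosure.isAlgClosure ℚ ℂ).isAlgClosed
  obtain ⟨s, ν, σ, W, h⟩ := exists_spectralDecomposition algebraicConj
    (fun x => hφ (by rw [hconj, hconj, Complex.conj_conj])) A' hfix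
  have halg : ∀ x : F, IsAlgebraic ℚ (φ x) := fun x => mem_algebraicClosure_iff.1 x.2
  have hm : ∀ M : Matrix (Fin d) (Fin d) F, M.map φ = φ.mapMatrix M := fun M => rfl
  have hsm : ∀ (a : F) (M : Matrix (Fin d) (Fin d) F), φ.mapMatrix (a • M) =
      φ a • φ.mapMatrix M := by
    intro a M
    ext i j
    simp
  refine ⟨s, fun l => φ (ν l), σ, fun l k => φ.mapMatrix (W l k), ⟨?_, h.involutive, ?_, ?_, ?_,
    ?_, ?_, ?_⟩, fun l => halg _, fun l k i j => halg _⟩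
  · intro l
    rw [h.value_conj, hconj]
  · intro l k
    rw [h.vector_conj]
    ext i j
    exact hconj _
  · intro l k
    have h1 := congrArg φ.mapMatrix (h.chain l k)
    rw [hsm, map_mul, map_sub, hsm, map_one, ← hm A', hA'] at h1
    simpa using h1
  · intro l
    rw [h.chain_end, map_zero]
  · rw [← map_sum, h.sum_eq, map_one]
  · intro l l' k
    rw [← map_mul, h.mul_eq]
    split_ifs
    · rfl
    · exact map_zero _
  · intro l k
    rw [← hA', hm]
    exact (h.comm l k).map φ.mapMatrix

/-- Conjugation permutes the summands of `∑ μ_l W_{l,k}` according to `σ`, so the sum is real.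
Orthogonality of the projections isolates the summand that acts on `W l 0`. -/
theorem SpectralDecomposition.exists_spectralData {d s : ℕ} {A : Matrix (Fin d) (Fin d) ℝ}
    {ν : Fin s → ℂ} {σ : Fin s → Fin s} {W : Fin s → ℕ → Matrix (Fin d) (Fin d) ℂ}
    (h : SpectralDecomposition (starRingEnd ℂ) (complexify A) ν σ W) (μ : Fin s → ℂ)
    (hμ : ∀ l, μ (σ l) = starRingEnd ℂ (μ l)) :
    ∃ B : Matrix (Fin d) (Fin d) ℝ, SpectralData A B ν μ W ∧
      complexify B = ∑ l, μ l • ∑ k ∈ Finset.range d, W l k := by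
  set M : Matrix (Fin d) (Fin d) ℂ := ∑ l, μ l • ∑ k ∈ Finset.range d, W l k with hM
  have hreal : ∀ i j, starRingEnd ℂ (M i j) = M i j := by
    intro i j
    have e1 : ∀ μ : Fin s → ℂ, ∀ W : Fin s → ℕ → Matrix (Fin d) (Fin d) ℂ,
        (∑ l, μ l • ∑ k ∈ Finset.range d, W l k) i j =
        ∑ l, μ l * ∑ k ∈ Finset.range d, W l k i j := by
      intro μ W
      rw [Matrix.sum_apply]
      refine Finset.sum_congr rfl fun l _ => ?_
      rw [Matrix.smul_apply, Matrix.sum_apply, smul_eq_mul]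
    rw [hM, e1, map_sum, ← Equiv.sum_comp h.involutive.toPerm]
    refine Finset.sum_congr rfl fun l _ => ?_
    rw [Function.Involutive.coe_toPerm, map_mul, map_sum, hμ, Complex.conj_conj]
    congr 1
    refine Finset.sum_congr rfl fun k _ => ?_
    rw [h.vector_conj, Matrix.map_apply, Complex.conj_conj]
  set B : Matrix (Fin d) (Fin d) ℝ := Matrix.of fun i j => (M i j).re with hB
  have hBM : complexify B = M := by
    ext i j
    rw [complexify_apply]
    exact Complex.conj_eq_iff_re.1 (hreal i j)
  refine ⟨B, ⟨fun l k _ => h.chain l k, h.chain_end, h.sum_eq, fun l => ?_, ?_⟩, hBM⟩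
  · rw [hBM, hM, Finset.sum_mul, Finset.sum_eq_single l]
    · rw [Matrix.smul_mul, Finset.sum_mul]
      simp only [h.mul_eq, if_true]
    · intro l' _ hl'
      rw [Matrix.smul_mul, Finset.sum_mul]
      simp only [h.mul_eq, if_neg hl', Finset.sum_const_zero, smul_zero]
    · simp
  · apply complexify_injective
    rw [map_mul, map_mul, hBM, hM]
    exact (Commute.sum_right _ _ _ fun l _ =>
      (Commute.sum_right _ _ _ fun k _ => h.comm l k).smul_right _).eq

/-! ### Every matrix with algebraic entries has a certificate -/

theorem listEntry_ofFn {α : Type*} (x : α) {d : ℕ} (F : Fin d → Fin d → α) (i j : Fin d) :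
    listEntry x (List.ofFn fun i => List.ofFn fun j => F i j) i j = F i j := by
  simp [listEntry]

/-- Conjugating the coefficients exchanges `re + im` with `re - im`, which has the same effect as
exchanging each `gaussianBase j` with its conjugate. -/
theorem gaussianValue_conj {ν ν' : List GaussianInt} {D : ℕ} (hν : ν.length ≤ D)
    (hν' : ν'.length ≤ D) (h : ∀ j < D, ν'.getD j 0 = star (ν.getD j 0)) :
    gaussianValue ν' = starRingEnd ℂ (gaussianValue ν) := by
  rw [gaussianValue_eq ν D hν, gaussianValue_eq ν' D hν', map_prod]
  refine Finset.prod_nbij' (fun x => (x.1, !x.2)) (fun x => (x.1, !x.2)) ?_ ?_ ?_ ?_ ?_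
  · simp [gaussianIndex]
  · simp [gaussianIndex]
  · simp
  · simp
  · rintro ⟨j, b⟩ hj
    have hj' : j < D := by simpa [gaussianIndex] using hj
    rw [map_zpow₀, ← GaussianInt.toComplex_star]
    cases b
    · simp only [gaussianFamily, gaussianExponent, if_true, Bool.false_eq_true, if_false,
        Bool.not_false, h j hj', Zsqrtd.re_star, Zsqrtd.im_star, sub_neg_eq_add]
    · simp only [gaussianFamily, gaussianExponent, if_true, Bool.false_eq_true, if_false,
        Bool.not_true, h j hj', Zsqrtd.re_star, Zsqrtd.im_star, star_star, sub_eq_add_neg]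

/-- The list of Gaussian integers with given real and imaginary parts. -/
def gaussianZip (f g : List ℤ) : List GaussianInt := List.zipWith (fun a b => ⟨a, b⟩) f g

theorem gaussianEval_gaussianZip {f g : List ℤ} (h : f.length = g.length) (x : ℝ) :
    gaussianEval (gaussianZip f g) x = (realEval f x : ℂ) + Complex.I * (realEval g x : ℂ) := by
  have h1 : (gaussianZip f g).map Zsqrtd.re = f ∧ (gaussianZip f g).map Zsqrtd.im = g := by
    induction f generalizing g with
    | nil => cases g <;> simp_all [gaussianZip]
    | cons a f ih => cases g <;> simp_all [gaussianZip]
  rw [gaussianEval_re_im, h1.1, h1.2]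

/-- The complex numbers with real and imaginary part in a subfield of the real numbers. -/
def complexSubfield (K : Subfield ℝ) : Subfield ℂ where
  carrier := {z | z.re ∈ K ∧ z.im ∈ K}
  zero_mem' := ⟨K.zero_mem, K.zero_mem⟩
  one_mem' := ⟨K.one_mem, K.zero_mem⟩
  add_mem' h h' := ⟨K.add_mem h.1 h'.1, K.add_mem h.2 h'.2⟩
  neg_mem' h := ⟨K.neg_mem h.1, K.neg_mem h.2⟩
  mul_mem' h h' := ⟨K.sub_mem (K.mul_mem h.1 h'.1) (K.mul_mem h.2 h'.2),
    K.add_mem (K.mul_mem h.1 h'.2) (K.mul_mem h.2 h'.1)⟩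
  inv_mem' z h := by
    have h1 : Complex.normSq z ∈ K := by
      rw [Complex.normSq_apply]
      exact K.add_mem (K.mul_mem h.1 h.1) (K.mul_mem h.2 h.2)
    refine ⟨?_, ?_⟩
    · rw [Complex.inv_re]
      exact K.div_mem h.1 h1
    · rw [Complex.inv_im]
      exact K.div_mem (K.neg_mem h.2) h1

theorem mem_complexSubfield {K : Subfield ℝ} {z : ℂ} :
    z ∈ complexSubfield K ↔ z.re ∈ K ∧ z.im ∈ K := Iff.rfl

theorem toComplex_mem_complexSubfield (K : Subfield ℝ) (z : GaussianInt) :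
    (z : ℂ) ∈ complexSubfield K := by
  rw [mem_complexSubfield, ← GaussianInt.intCast_re, ← GaussianInt.intCast_im]
  exact ⟨intCast_mem K _, intCast_mem K _⟩

theorem isAlgebraic_re_im {z : ℂ} (hz : IsAlgebraic ℚ z) :
    IsAlgebraic ℚ z.re ∧ IsAlgebraic ℚ z.im := by
  have hinj : Function.Injective (algebraMap ℝ ℂ) := (algebraMap ℝ ℂ).injective
  have hI : IsAlgebraic ℚ Complex.I :=
    (Complex.isIntegral_rat_I).isAlgebraic
  have hc : IsAlgebraic ℚ (starRingEnd ℂ z) :=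
    hz.algHom (Complex.conjAe.restrictScalars ℚ).toAlgHom
  have h2 : IsAlgebraic ℚ (2⁻¹ : ℂ) := by
    have := isAlgebraic_algebraMap (R := ℚ) (A := ℂ) (2⁻¹ : ℚ)
    simpa using this
  constructor
  · rw [← isAlgebraic_algebraMap_iff hinj]
    have : (algebraMap ℝ ℂ) z.re = (z + starRingEnd ℂ z) * 2⁻¹ := by
      rw [Complex.add_conj]
      simp only [Complex.coe_algebraMap]
      push_cast
      ring
    rw [this]
    exact (hz.add hc).mul h2
  · rw [← isAlgebraic_algebraMap_iff hinj]
    have : (algebraMap ℝ ℂ) z.im = -((z - starRingEnd ℂ z) * 2⁻¹ * Complex.I) := by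
      rw [Complex.sub_conj]
      simp only [Complex.coe_algebraMap]
      push_cast
      linear_combination (z.im : ℂ) * Complex.I_mul_I
    rw [this]
    exact (((hz.sub hc).mul h2).mul hI).neg

/-- Converse of the computation in `LoopCert.Valid.exists_spectralData`: true spectral data satisfy
all the identities after multiplication by the denominators. -/
theorem LoopCert.gaussianEval_identities {d s : ℕ} {c : MatCode} {w : LoopCert} {θ : ℝ}
    {A B : Matrix (Fin d) (Fin d) ℝ} {ν : Fin s → ℂ}
    {W : Fin s → ℕ → Matrix (Fin d) (Fin d) ℂ} (hs : w.size = s)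
    (h : SpectralData A B ν (fun l => gaussianValue (w.eigenvalue l)) W)
    (hδ : 0 < w.denA) (hβ : 0 < w.denB)
    (hA : ∀ i j : Fin d, realEval (w.entryA i j) θ = w.denA * A i j)
    (hB : ∀ i j : Fin d, realEval (w.entryB i j) θ = w.denB * B i j)
    (hν : ∀ l : Fin s, gaussianEval (w.eigenvalue l) θ = w.denA * ν l)
    (hW : ∀ (l : Fin s), ∀ k ≤ d, ∀ i j : Fin d,
      gaussianEval (w.vector l k i j) θ = w.denA * W l k i j)
    (hrootA : ∀ i j : Fin d, realEval (c.entry i j).1 (A i j) = 0)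
    (hrootB : ∀ i j : Fin d, realEval (w.codeB i j).1 (B i j) = 0) :
    ∀ f ∈ w.identities d c, gaussianEval f θ = 0 := by
  have hδ' : (w.denA : ℝ) ≠ 0 := by exact_mod_cast hδ.ne'
  have hβ' : (w.denB : ℝ) ≠ 0 := by exact_mod_cast hβ.ne'
  simp only [LoopCert.identities, List.mem_append, or_imp, forall_and,
    forall_mem_allEntries, List.mem_flatMap, List.mem_range, forall_exists_index, and_imp, hs]
  refine ⟨?_, ?_, ?_, ?_, ?_, ?_, ?_⟩
  · intro i hi j hj
    lift i to Fin d using hi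
    lift j to Fin d using hj
    rw [rootPoly, gaussianEval_toGaussian, Complex.ofReal_eq_zero,
      realEval_listHom_eq_zero_iff hδ, hA, mul_div_cancel_left₀ _ hδ', hrootA]
  · intro i hi j hj
    lift i to Fin d using hi
    lift j to Fin d using hj
    rw [rootPoly, gaussianEval_toGaussian, Complex.ofReal_eq_zero,
      realEval_listHom_eq_zero_iff hβ, hB, mul_div_cancel_left₀ _ hβ']
    exact hrootB i j
  · intro f l hl k hk hf
    obtain ⟨i, hi, j, hj, rfl⟩ := mem_allEntries.1 hf
    lift l to Fin s using hl
    lift i to Fin d using hi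
    lift j to Fin d using hj
    have h1 := congrFun (congrFun (h.chain l k hk) i) j
    rw [Matrix.smul_apply, sub_mul, Matrix.sub_apply, Matrix.smul_mul, one_mul, Matrix.smul_apply,
      Matrix.mul_apply, smul_eq_mul, smul_eq_mul] at h1
    simp only [complexify_apply] at h1
    simp only [LoopCert.chainPoly, gaussianEval_sub, gaussianEval_scale, gaussianEval_sum,
      gaussianEval_mul, gaussianEval_toGaussian, toComplex_ofInt, Finset.sum_range, hA,
      hW l k hk.le, hW l (k + 1) hk, hν]
    have h2 : ∑ t : Fin d, ((w.denA * A i t : ℝ) : ℂ) * (w.denA * W l k t j) =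
        w.denA * w.denA * ∑ t : Fin d, (A i t : ℂ) * W l k t j := by
      rw [Finset.mul_sum]
      refine Finset.sum_congr rfl fun t _ => ?_
      push_cast; ring
    rw [h2]
    push_cast
    linear_combination (w.denA : ℂ) * w.denA * h1
  · intro f l hl hf
    obtain ⟨i, hi, j, hj, rfl⟩ := mem_allEntries.1 hf
    lift l to Fin s using hl
    lift i to Fin d using hi
    lift j to Fin d using hj
    rw [hW l d le_rfl, h.chain_end, Matrix.zero_apply, mul_zero]
  · intro i hi j hj
    lift i to Fin d using hi
    lift j to Fin d using hj
    have h1 := congrFun (congrFun h.sum_eq i) j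
    rw [Matrix.sum_apply, Matrix.one_apply] at h1
    simp only [LoopCert.sumPoly, gaussianEval_sub, gaussianEval_sum, gaussianEval_singleton, hs,
      Finset.sum_range, hW _ 0 (Nat.zero_le d), ← Finset.mul_sum, h1, Fin.val_inj]
    split_ifs
    · rw [toComplex_ofInt, mul_one, sub_self]
    · rw [map_zero, mul_zero, sub_zero]
  · intro f l hl hf
    obtain ⟨i, hi, j, hj, rfl⟩ := mem_allEntries.1 hf
    lift l to Fin s using hl
    lift i to Fin d using hi
    lift j to Fin d using hj
    have h1 := congrFun (congrFun (h.act l) i) j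
    have h3 : (gaussianNum (listScale (-1) (w.eigenvalue l)) : ℂ) ≠ 0 :=
      GaussianInt.toComplex_eq_zero.not.2 (gaussianNum_ne_zero _)
    rw [Matrix.smul_apply, Matrix.mul_apply, Matrix.sum_apply, smul_eq_mul, gaussianValue,
      div_mul_eq_mul_div, eq_div_iff h3] at h1
    simp only [complexify_apply] at h1
    simp only [LoopCert.actPoly, gaussianEval_sub, gaussianEval_scale, gaussianEval_sum,
      gaussianEval_mul, gaussianEval_toGaussian, toComplex_ofInt, map_mul]
    have h4 : ∑ k ∈ Finset.range d, gaussianEval (w.vector l k i j) θ =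
        w.denA * ∑ k ∈ Finset.range d, W l k i j := by
      rw [Finset.mul_sum]
      exact Finset.sum_congr rfl fun k hk => hW l k (Finset.mem_range.1 hk).le i j
    have h2 : ∑ t ∈ Finset.range d,
        (realEval (w.entryB i t) θ : ℂ) * gaussianEval (w.vector l 0 t j) θ =
        w.denB * w.denA * ∑ t : Fin d, (B i t : ℂ) * W l 0 t j := by
      rw [Finset.mul_sum, Finset.sum_range]
      refine Finset.sum_congr rfl fun t _ => ?_
      rw [hB, hW l 0 (Nat.zero_le d)]
      push_cast; ring
    rw [h2, h4]
    linear_combination (w.denB : ℂ) * w.denA * h1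
  · intro i hi j hj
    lift i to Fin d using hi
    lift j to Fin d using hj
    have h1 := congrFun (congrFun h.comm i) j
    rw [Matrix.mul_apply, Matrix.mul_apply] at h1
    rw [LoopCert.commPoly, gaussianEval_toGaussian, Complex.ofReal_eq_zero, realEval_sub,
      realEval_sum, realEval_sum]
    simp only [realEval_mul, Finset.sum_range, hA, hB]
    have e1 : ∑ t : Fin d, (w.denA : ℝ) * A i t * (w.denB * B t j) =
        w.denA * w.denB * ∑ t, A i t * B t j := by
      rw [Finset.mul_sum]
      exact Finset.sum_congr rfl fun t _ => by ring
    have e2 : ∑ t : Fin d, (w.denB : ℝ) * B i t * (w.denA * A t j) =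
        w.denA * w.denB * ∑ t, B i t * A t j := by
      rw [Finset.mul_sum]
      exact Finset.sum_congr rfl fun t _ => by ring
    rw [e1, e2, h1, sub_self]

theorem LoopCert.realEval_inequalities_pos {d : ℕ} {c : MatCode} {w : LoopCert} {θ : ℝ}
    {A B : Matrix (Fin d) (Fin d) ℝ} (hδ : 0 < w.denA) (hβ : 0 < w.denB)
    (hA : ∀ i j : Fin d, realEval (w.entryA i j) θ = w.denA * A i j)
    (hB : ∀ i j : Fin d, realEval (w.entryB i j) θ = w.denB * B i j)
    (hc : ∀ i j : Fin d, (RatCode.val (c.entry i j).2.1 : ℝ) < A i j ∧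
      A i j < (RatCode.val (c.entry i j).2.2 : ℝ))
    (hcB : ∀ i j : Fin d, (RatCode.val (isolatedCode (w.codeB i j)).2.1 : ℝ) < B i j ∧
      B i j < (RatCode.val (isolatedCode (w.codeB i j)).2.2 : ℝ)) :
    ∀ f ∈ w.inequalities d c, 0 < realEval f θ := by
  have hδ' : (w.denA : ℝ) ≠ 0 := by exact_mod_cast hδ.ne'
  have hβ' : (w.denB : ℝ) ≠ 0 := by exact_mod_cast hβ.ne'
  simp only [LoopCert.inequalities, List.mem_append, or_imp, forall_and, forall_mem_allEntries]
  refine ⟨?_, ?_, ?_, ?_⟩ <;> intro i hi j hj <;> lift i to Fin d using hi <;>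
    lift j to Fin d using hj
  · rw [realEval_lowerPoly _ _ hδ, hA, mul_div_cancel_left₀ _ hδ']
    exact (hc i j).1
  · rw [realEval_upperPoly _ _ hδ, hA, mul_div_cancel_left₀ _ hδ']
    exact (hc i j).2
  · rw [realEval_lowerPoly _ _ hβ, hB, mul_div_cancel_left₀ _ hβ']
    exact (hcB i j).1
  · rw [realEval_upperPoly _ _ hβ, hB, mul_div_cancel_left₀ _ hβ']
    exact (hcB i j).2

theorem getD_ofFn {α : Type*} (x : α) {n : ℕ} (f : Fin n → α) (i : Fin n) :
    (List.ofFn f).getD i x = f i := by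
  simp

/-- The certificate with the given data. -/
def LoopCert.ofData {d s : ℕ} (m : List ℤ) (ρ M δ β : ℤ) (a b : Fin d → Fin d → List ℤ)
    (x : Fin d → Fin d → List ℤ × ℤ × ℕ) (ν : Fin s → List GaussianInt)
    (W : Fin s → ℕ → Fin d → Fin d → List GaussianInt) (q : List (List GaussianInt)) : LoopCert :=
  (m, (ρ, M), (δ, β), List.ofFn fun i => List.ofFn fun j => a i j,
    List.ofFn fun i => List.ofFn fun j => b i j, List.ofFn fun i => List.ofFn fun j => x i j,
    List.ofFn fun l => (ν l, List.ofFn fun k : Fin (d + 1) =>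
      List.ofFn fun i => List.ofFn fun j => W l k i j), q)

section ofData

variable {d s : ℕ} (m : List ℤ) (ρ M δ β : ℤ) (a b : Fin d → Fin d → List ℤ)
  (x : Fin d → Fin d → List ℤ × ℤ × ℕ) (ν : Fin s → List GaussianInt)
  (W : Fin s → ℕ → Fin d → Fin d → List GaussianInt) (q : List (List GaussianInt))

theorem LoopCert.entryA_ofData (i j : Fin d) :
    (ofData m ρ M δ β a b x ν W q).entryA i j = a i j := listEntry_ofFn _ _ i j

theorem LoopCert.entryB_ofData (i j : Fin d) :
    (ofData m ρ M δ β a b x ν W q).entryB i j = b i j := listEntry_ofFn _ _ i j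

theorem LoopCert.codeB_ofData (i j : Fin d) :
    (ofData m ρ M δ β a b x ν W q).codeB i j = x i j := listEntry_ofFn _ _ i j

theorem LoopCert.size_ofData : (ofData m ρ M δ β a b x ν W q).size = s := by
  simp [ofData, LoopCert.size]

theorem LoopCert.eigenvalue_ofData (l : Fin s) :
    (ofData m ρ M δ β a b x ν W q).eigenvalue l = ν l := by
  simp [ofData, LoopCert.eigenvalue]

theorem LoopCert.vector_ofData (l : Fin s) {k : ℕ} (hk : k ≤ d) (i j : Fin d) :
    (ofData m ρ M δ β a b x ν W q).vector l k i j = W l k i j := by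
  obtain ⟨k, rfl⟩ : ∃ k' : Fin (d + 1), (k' : ℕ) = k := ⟨⟨k, Nat.lt_succ_of_le hk⟩, rfl⟩
  rw [LoopCert.vector, ofData]
  dsimp only
  rw [getD_ofFn, getD_ofFn, listEntry_ofFn]

end ofData

theorem finite_setOf_representation {d s : ℕ} (A : Matrix (Fin d) (Fin d) ℝ) (ν : Fin s → ℂ)
    (W : Fin s → ℕ → Matrix (Fin d) (Fin d) ℂ) : ∃ S : Finset ℝ, ∀ x, x ∈ S ↔
      (∃ i j, x = A i j) ∨ (∃ l, x = (ν l).re ∨ x = (ν l).im) ∨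
      ∃ l, ∃ k : Fin (d + 1), ∃ i j, x = (W l k i j).re ∨ x = (W l k i j).im := by
  have h : ({x | (∃ i j, x = A i j) ∨ (∃ l, x = (ν l).re ∨ x = (ν l).im) ∨
      ∃ l, ∃ k : Fin (d + 1), ∃ i j, x = (W l k i j).re ∨ x = (W l k i j).im} : Set ℝ).Finite := by
    simp only [Set.ofPred_or, Set.ofPred_exists]
    refine Set.Finite.union (Set.finite_iUnion fun i => Set.finite_iUnion fun j =>
      Set.finite_singleton _) (Set.Finite.union (Set.finite_iUnion fun l =>
        (Set.finite_singleton _).union (Set.finite_singleton _)) ?_)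
    exact Set.finite_iUnion fun l => Set.finite_iUnion fun k => Set.finite_iUnion fun i =>
      Set.finite_iUnion fun j => (Set.finite_singleton _).union (Set.finite_singleton _)
  exact ⟨h.toFinset, fun x => by simp⟩

/-- Completeness of the search: the data of the mathematical construction, written in terms of one
real generator `θ` and a sufficiently fine approximation of it, form a valid certificate. -/
theorem LoopCert.exists_valid {d : ℕ} {c : MatCode} {A : Matrix (Fin d) (Fin d) ℝ}
    (hc : MatCode.Denotes c A) : ∃ w : LoopCert, w.Valid d c := by
  classical
  obtain ⟨s, ν, σ, W, hdec, hνalg, hWalg⟩ :=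
    exists_complex_spectralDecomposition A hc.isAlgebraic
  obtain ⟨S, hS⟩ := finite_setOf_representation A ν W
  obtain ⟨θ, hθ, hSθ⟩ := exists_integral_generator S (by
    intro x hx
    rcases (hS x).1 hx with ⟨i, j, rfl⟩ | ⟨l, rfl | rfl⟩ | ⟨l, k, i, j, rfl | rfl⟩
    · exact hc.isAlgebraic i j
    · exact (isAlgebraic_re_im (hνalg l)).1
    · exact (isAlgebraic_re_im (hνalg l)).2
    · exact (isAlgebraic_re_im (hWalg l k i j)).1
    · exact (isAlgebraic_re_im (hWalg l k i j)).2)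
  obtain ⟨δ, hδ, hr⟩ := exists_common_denominator hθ S hSθ
  choose! r hrlen hr using hr
  set D := (minpoly ℤ θ).natDegree with hD
  set G : ℂ → List GaussianInt := fun z => gaussianZip (r z.re) (r z.im) with hG
  have hGlen : ∀ z : ℂ, z.re ∈ S → z.im ∈ S → (G z).length = D := fun z h1 h2 => by
    simp [hG, gaussianZip, hrlen _ h1, hrlen _ h2]
  have hGeval : ∀ z : ℂ, z.re ∈ S → z.im ∈ S → gaussianEval (G z) θ = δ * z := by
    intro z h1 h2
    rw [hG, gaussianEval_gaussianZip ((hrlen _ h1).trans (hrlen _ h2).symm), hr _ h1, hr _ h2]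
    push_cast
    linear_combination (δ : ℂ) * Complex.re_add_im z
  have hAS : ∀ i j, A i j ∈ S := fun i j => (hS _).2 (Or.inl ⟨i, j, rfl⟩)
  have hνS : ∀ l, (ν l).re ∈ S ∧ (ν l).im ∈ S := fun l =>
    ⟨(hS _).2 (Or.inr (Or.inl ⟨l, Or.inl rfl⟩)), (hS _).2 (Or.inr (Or.inl ⟨l, Or.inr rfl⟩))⟩
  have hWS : ∀ l, ∀ k ≤ d, ∀ i j, (W l k i j).re ∈ S ∧ (W l k i j).im ∈ S := fun l k hk i j =>
    ⟨(hS _).2 (Or.inr (Or.inr ⟨l, ⟨k, Nat.lt_succ_of_le hk⟩, i, j, Or.inl rfl⟩)),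
      (hS _).2 (Or.inr (Or.inr ⟨l, ⟨k, Nat.lt_succ_of_le hk⟩, i, j, Or.inr rfl⟩))⟩
  have hνlen : ∀ l, (G (ν l)).length = D := fun l => hGlen _ (hνS l).1 (hνS l).2
  have hνeval : ∀ l, gaussianEval (G (ν l)) θ = δ * ν l := fun l =>
    hGeval _ (hνS l).1 (hνS l).2
  -- Representations in powers of the real number `θ` are unique, so the coefficients for `ν (σ l)`
  -- are the conjugates of those for `ν l`, and the `μ`-values are conjugate too.
  obtain ⟨B, hB, hBsum⟩ := hdec.exists_spectralData (fun l => gaussianValue (G (ν l))) (by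
    intro l
    refine gaussianValue_conj (hνlen l).le (hνlen _).le (gaussian_eq_of_sum_eq
      (fun g hg h0 => eq_zero_of_degree_lt_minpoly hθ g hg h0)
      (fun j => (G (ν (σ l))).getD j 0) (fun j => star ((G (ν l)).getD j 0)) ?_)
    rw [← gaussianEval_eq_sum _ _ _ (hνlen _).le, hνeval, hdec.value_conj]
    have h1 := congrArg (starRingEnd ℂ) (hνeval l)
    rw [gaussianEval_eq_sum _ _ _ (hνlen _).le, map_sum, map_mul] at h1
    simp only [map_mul, map_pow, Complex.conj_ofReal, ← GaussianInt.toComplex_star] at h1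
    rw [h1, ← Complex.ofReal_intCast, Complex.conj_ofReal])
  set K : Subfield ℝ := (IntermediateField.adjoin ℚ {θ}).toSubfield with hK
  have hBK : ∀ i j, B i j ∈ K := by
    intro i j
    -- The `μ`-values lie in `ℚ(i)`, and the entries of `W` have real and imaginary parts in `K`; so
    -- the real entries of `B` lie in `K` and need no larger generator.
    have h1 : (B i j : ℂ) ∈ complexSubfield K := by
      rw [← complexify_apply, hBsum, Matrix.sum_apply]
      refine sum_mem fun l _ => ?_
      rw [Matrix.smul_apply, Matrix.sum_apply, smul_eq_mul]
      refine mul_mem (div_mem (toComplex_mem_complexSubfield K _)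
        (toComplex_mem_complexSubfield K _)) (sum_mem fun k hk => ?_)
      have h2 := hWS l k (Finset.mem_range.1 hk).le i j
      exact ⟨hSθ _ h2.1, hSθ _ h2.2⟩
    exact h1.1
  obtain ⟨β, hβ, hb⟩ := exists_common_denominator hθ
    (Finset.univ.image fun p : Fin d × Fin d => B p.1 p.2) (by
      intro x hx
      obtain ⟨p, -, rfl⟩ := Finset.mem_image.1 hx
      exact hBK _ _)
  have hb' : ∀ i j, ∃ f : List ℤ, realEval f θ = β * B i j := fun i j => by
    obtain ⟨f, -, hf⟩ := hb (B i j) (Finset.mem_image.2 ⟨(i, j), Finset.mem_univ _, rfl⟩)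
    exact ⟨f, hf⟩
  choose b hb using hb'
  have hBalg : ∀ i j, IsAlgebraic ℚ (B i j) := by
    intro i j
    have h1 := IntermediateField.isAlgebraic_adjoin_simple (K := ℚ)
      (hθ.tower_top : IsIntegral ℚ θ)
    exact (h1.isAlgebraic ⟨B i j, hBK i j⟩).algebraMap
  choose x hx1 hx2 hx3 using fun i j => exists_isolation (hBalg i j)
  obtain ⟨m, hmlen, hm⟩ := exists_listPoly (minpoly ℤ θ) (D + 1) (Nat.lt_succ_self _)
  have hm0 : realEval m θ = 0 := by
    rw [realEval, hm, eval₂_intCast_eq_aeval, minpoly.aeval]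
  have hlead : m.getD (m.length - 1) 0 ≠ 0 := by
    rw [← coeff_listPoly, hmlen, hm, Nat.add_sub_cancel, Polynomial.coeff_natDegree]
    exact Polynomial.leadingCoeff_ne_zero.2 (minpoly.ne_zero hθ)
  -- The identities and inequalities do not involve `ρ`, `M` and `q`, so they are established with
  -- placeholders; the quotients and the approximation are chosen afterwards.
  set w : ℤ → ℤ → List (List GaussianInt) → LoopCert := fun ρ M q =>
    LoopCert.ofData m ρ M δ β (fun i j => r (A i j)) b x (fun l => G (ν l))
      (fun l k i j => G (W l k i j)) q with hw
  have hwA : ∀ ρ M q, ∀ i j : Fin d, realEval ((w ρ M q).entryA i j) θ = δ * A i j := by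
    intro ρ M q i j
    rw [hw, LoopCert.entryA_ofData, hr _ (hAS i j)]
  have hwB : ∀ ρ M q, ∀ i j : Fin d, realEval ((w ρ M q).entryB i j) θ = β * B i j := by
    intro ρ M q i j
    rw [hw, LoopCert.entryB_ofData, hb]
  have hcode := fun i j => (hc.entry i j).2 (A i j)
  have hids : ∀ f ∈ (w 0 0 []).identities d c, gaussianEval f θ = 0 := by
    refine LoopCert.gaussianEval_identities (A := A) (B := B) (ν := ν) (W := W)
      (LoopCert.size_ofData ..) ?_ hδ hβ (hwA _ _ _) (hwB _ _ _) ?_ ?_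
      (fun i j => ((hcode i j).2 rfl).1) ?_
    · convert hB using 2 with l
      exact congrArg gaussianValue (LoopCert.eigenvalue_ofData ..)
    · intro l
      rw [hw, LoopCert.eigenvalue_ofData, hνeval]
      rfl
    · intro l k hk i j
      rw [hw, LoopCert.vector_ofData _ _ _ _ _ _ _ _ _ _ _ l hk,
        hGeval _ (hWS l k hk i j).1 (hWS l k hk i j).2]
      rfl
    · intro i j
      rw [hw, LoopCert.codeB_ofData]
      exact hx2 i j
  have hineq : ∀ f ∈ (w 0 0 []).inequalities d c, 0 < realEval f θ := by
    refine LoopCert.realEval_inequalities_pos (A := A) (B := B) hδ hβ (hwA _ _ _) (hwB _ _ _)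
      (fun i j => ((hcode i j).2 rfl).2) ?_
    intro i j
    rw [hw, LoopCert.codeB_ofData]
    exact hx3 i j
  have hquot : ∀ f ∈ (w 0 0 []).identities d c, ∃ q,
      ∀ a ∈ listSub f (listMul (toGaussian m) q), a = 0 := fun f hf =>
    exists_quotient hθ hm (hids f hf)
  choose! q hq using hquot
  have hev1 := eventually_dominantLinear m θ hm0 (by
    rw [Polynomial.derivative_map, Polynomial.eval_map, eval₂_intCast_eq_aeval, hm]
    exact minpoly_derivative_ne_zero hθ)
  -- One denominator `M` has to serve for the isolation of `θ` and for all of the finitely many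
  -- inequalities.
  have hev2 := (Filter.eventually_all_finite (List.finite_toSet ((w 0 0 []).inequalities d c))).2
    fun f hf => eventually_dominantConst f θ (hineq f hf)
  obtain ⟨M, ⟨hM1, hM2⟩, hM⟩ := ((hev1.and hev2).and (Filter.eventually_gt_atTop 0)).exists
  refine ⟨w (round ((M : ℝ) * θ)) M (((w 0 0 []).identities d c).map q),
    ⟨Int.natCast_pos.2 hM, hδ, hβ⟩, ⟨hlead, noFactors_of_irreducible hlead ?_⟩, ?_, hM2, ?_, ?_⟩
  · change Irreducible ((listPoly m).map _)
    rw [hm, minpoly_map_rat hθ]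
    exact minpoly.irreducible hθ.tower_top
  · intro f hf
    rcases List.mem_cons.1 hf with rfl | hf
    · exact hM1
    · obtain ⟨i, hi, j, hj, rfl⟩ := mem_allEntries.1 hf
      lift i to Fin d using hi
      lift j to Fin d using hj
      rw [hw, LoopCert.codeB_ofData]
      exact hx1 i j
  · intro l hl
    rw [hw, LoopCert.size_ofData] at hl
    lift l to Fin s using hl
    rw [hw, LoopCert.eigenvalue_ofData, hνlen]
    change D ≤ m.length - 1
    rw [hmlen, Nat.add_sub_cancel]
  · intro f hf
    exact ⟨q f, List.mem_map.2 ⟨f, hf, rfl⟩, hq f hf⟩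

/-! ### Every automaton with finitely many edges has a code -/

theorem exists_realAlgCode {x : ℝ} (hx : IsAlgebraic ℚ x) : ∃ c, RealAlgCode.Denotes c x := by
  obtain ⟨y, h1, h2, h3, h4⟩ := exists_isolation hx
  exact ⟨_, isolatedCode_denotes h1 h2 h3 h4⟩

theorem exists_forall₂ {α β : Type*} {R : α → β → Prop} (l : List β) (h : ∀ b ∈ l, ∃ a, R a b) :
    ∃ l', List.Forall₂ R l' l := by
  induction l with
  | nil => exact ⟨[], .nil⟩
  | cons b l ih =>
    obtain ⟨a, ha⟩ := h b (List.mem_cons_self ..)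
    obtain ⟨l', hl'⟩ := ih fun b hb => h b (List.mem_cons_of_mem _ hb)
    exact ⟨a :: l', .cons ha hl'⟩

theorem exists_forall₂_ofFn {α β : Type*} {R : α → β → Prop} {n : ℕ} (f : Fin n → β)
    (h : ∀ i, ∃ a, R a (f i)) : ∃ l', List.Forall₂ R l' (List.ofFn f) :=
  exists_forall₂ _ fun _ hb => by
    obtain ⟨i, rfl⟩ := List.mem_ofFn.1 hb
    exact h i

theorem exists_matCode {d : ℕ} {A : Matrix (Fin d) (Fin d) ℝ} (hA : IsAlgebraicMatrix A) :
    ∃ c, MatCode.Denotes c A :=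
  exists_forall₂_ofFn _ fun i => exists_forall₂_ofFn _ fun j => exists_realAlgCode (hA i j)

theorem exists_polyCode {d : ℕ} {p : MvPolynomial (Fin d) ℝ}
    (hp : ∀ m, IsAlgebraic ℚ (p.coeff m)) : ∃ c, PolyCode.Denotes c p := by
  have h := exists_forall₂ (R := fun (t : List ℕ × RealAlgCode) (m : (Fin d →₀ ℕ) × ℝ) =>
    t.1 = List.ofFn (fun i => m.1 i) ∧ RealAlgCode.Denotes t.2 m.2)
    (p.support.toList.map fun m => (m, p.coeff m)) (by
      intro b hb
      obtain ⟨m, -, rfl⟩ := List.mem_map.1 hb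
      obtain ⟨c, hc⟩ := exists_realAlgCode (hp m)
      exact ⟨(List.ofFn fun i => m i, c), rfl, hc⟩)
  obtain ⟨c, hc⟩ := h
  refine ⟨c, _, hc, ?_⟩
  rw [List.map_map]
  conv_lhs => rw [← p.support_sum_monomial_coeff]
  exact (Finset.sum_map_toList _ _).symm

/-- By Hilbert's basis theorem a finite subset of the given equations generates the same ideal;
being a subset, it keeps algebraic coefficients. -/
theorem exists_setCode {d : ℕ} {X : Set (Fin d → ℝ)} (hX : IsAlgebraicSet X) :
    ∃ c, SetCode.Denotes c X := by
  obtain ⟨P, hP, rfl⟩ := hX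
  obtain ⟨T, hTP, hT⟩ := (Submodule.fg_span_iff_fg_span_finset_subset P).1
    (IsNoetherian.noetherian (Submodule.span (MvPolynomial (Fin d) ℝ) P))
  obtain ⟨c, hc⟩ := exists_forall₂ (R := PolyCode.Denotes) T.toList fun p hp =>
    exists_polyCode (hP p (hTP (Finset.mem_toList.1 hp)))
  refine ⟨c, _, hc, Set.ext fun x => ⟨fun h p hp => h p (hTP (Finset.mem_toList.1 hp)),
    fun h p hp => ?_⟩⟩
  have h1 : p ∈ Ideal.span (T : Set (MvPolynomial (Fin d) ℝ)) := by
    rw [Ideal.span, ← hT]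
    exact Submodule.subset_span hp
  have h2 : Ideal.span (T : Set (MvPolynomial (Fin d) ℝ)) ≤
      RingHom.ker (MvPolynomial.eval x) :=
    Ideal.span_le.2 fun q hq => h q (Finset.mem_toList.2 hq)
  exact h2 h1

theorem exists_automatonCode {Q : Type*} {n d : ℕ} (e : Q ≃ Fin n) {𝒜 : HybridAutomaton Q d}
    (h : 𝒜.IsLinear) : ∃ c, AutomatonCode.Denotes e c 𝒜 := by
  obtain ⟨flows, hf⟩ := exists_forall₂_ofFn (R := MatCode.Denotes)
    (fun i => 𝒜.flow (e.symm i)) fun i => exists_matCode (𝒜.flow_algebraic _)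
  obtain ⟨inits, hi⟩ := exists_forall₂_ofFn (R := SetCode.Denotes)
    (fun i => 𝒜.init (e.symm i)) fun i => exists_setCode (𝒜.init_algebraic _)
  have hE : 𝒜.edges.Finite := h
  obtain ⟨edges, he⟩ := exists_forall₂
    (R := fun (t : ℕ × MatCode × ℕ) (s : Q × Matrix (Fin d) (Fin d) ℝ × Q) =>
      t.1 = (e s.1 : ℕ) ∧ MatCode.Denotes t.2.1 s.2.1 ∧ t.2.2 = (e s.2.2 : ℕ))
    hE.toFinset.toList (by
      intro s hs
      obtain ⟨c, hc⟩ := exists_matCode (𝒜.edges_algebraic s (by simpa using hs))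
      exact ⟨(e s.1, c, e s.2.2), rfl, hc, rfl⟩)
  refine ⟨(n, d, flows, edges, inits), rfl, rfl, hf, ⟨_, he, ?_⟩, hi⟩
  ext s
  simp

/-! ### The algorithm -/

/-- The code of the zero matrix. -/
def zeroCode (d : ℕ) : MatCode :=
  (List.range d).map fun _ => (List.range d).map fun _ => ([0, 1], (-1, 0), (1, 0))

theorem zeroCode_denotes (d : ℕ) :
    MatCode.Denotes (zeroCode d) (0 : Matrix (Fin d) (Fin d) ℝ) := by
  have h : listPoly [0, 1] = (Polynomial.X : Polynomial ℤ) := by simp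
  refine denotes_map_range (fun _ _ => ([0, 1], (-1, 0), (1, 0))) fun i j => ⟨?_, fun y => ?_⟩
  · rw [polyOfList_eq, h]
    exact Polynomial.X_ne_zero
  · rw [polyOfList_eq, h, Polynomial.aeval_X, RatCode.val, RatCode.val, Matrix.zero_apply]
    constructor
    · exact fun h => h.1
    · rintro rfl
      norm_num

/-- The certificates `w` are valid for the locations of the automaton with code `c`. -/
def AutomatonCode.Valid (c : AutomatonCode) (w : List LoopCert) : Prop :=
  ∀ i ∈ List.range c.1, (w.getD i default).Valid c.2.1 (c.2.2.1.getD i [])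

/-- The code of the affine program obtained from the automaton with code `c` and the
certificates `w`. -/
def AutomatonCode.output (c : AutomatonCode) (w : List LoopCert) : AutomatonCode :=
  (c.1, c.2.1, (List.range c.1).map fun _ => zeroCode c.2.1,
    c.2.2.2.1 ++ (List.range c.1).map fun i => (i, (w.getD i default).output c.2.1, i), c.2.2.2.2)

open Classical in
/-- Decode a number as a list of certificates, and compute the output if it is valid. -/
def AutomatonCode.search (c : AutomatonCode) (k : ℕ) : Option AutomatonCode :=
  (Encodable.decode (α := List LoopCert) k).bind fun w =>
    if c.Valid w then some (c.output w) else none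

theorem primrec_zeroCode : Primrec zeroCode :=
  Primrec.list_map Primrec.list_range
    (Primrec.list_map (Primrec.list_range.comp .fst) (.const _ : Primrec₂ fun _ _ => _))

section primrec

variable {α : Type*} [Primcodable α] {c : α → AutomatonCode} {w : α → List LoopCert}

theorem primrecPred_automatonValid (hc : Primrec c) (hw : Primrec w) :
    PrimrecPred fun a => (c a).Valid (w a) := by
  have hc' : Primrec fun x : ℕ × α => (c x.2).2 := Primrec.snd.comp (hc.comp .snd)
  have h : PrimrecRel fun (i : ℕ) (a : α) =>
      ((w a).getD i default).Valid (c a).2.1 ((c a).2.2.1.getD i []) :=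
    primrecPred_valid (Primrec.fst.comp hc')
      ((Primrec.list_getD []).comp (Primrec.fst.comp (Primrec.snd.comp hc')) .fst)
      ((Primrec.list_getD default).comp (hw.comp .snd) .fst)
  exact h.forall_mem_list.comp (Primrec.list_range.comp (Primrec.fst.comp hc)) .id

theorem primrec_automatonOutput (hc : Primrec c) (hw : Primrec w) :
    Primrec fun a => (c a).output (w a) := by
  have hn : Primrec fun a => List.range (c a).1 := Primrec.list_range.comp (Primrec.fst.comp hc)
  have hd : Primrec fun a => (c a).2.1 := Primrec.fst.comp (Primrec.snd.comp hc)
  have h1 : Primrec₂ fun (a : α) (i : ℕ) => (i, ((w a).getD i default).output (c a).2.1, i) :=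
    Primrec.pair .snd (Primrec.pair (primrec_output (hd.comp .fst)
      ((Primrec.list_getD default).comp (hw.comp .fst) .snd)) .snd)
  have h2 : Primrec₂ fun (a : α) (_ : ℕ) => zeroCode (c a).2.1 :=
    primrec_zeroCode.comp (hd.comp .fst)
  have hrest : Primrec fun a => (c a).2.2.2 :=
    Primrec.snd.comp (Primrec.snd.comp (Primrec.snd.comp hc))
  exact Primrec.pair (Primrec.fst.comp hc) (Primrec.pair hd (Primrec.pair
    (Primrec.list_map hn h2) (Primrec.pair
      (Primrec.list_append.comp (Primrec.fst.comp hrest) (Primrec.list_map hn h1))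
      (Primrec.snd.comp hrest))))

open Classical in
theorem primrec_bind_decode {β γ : Type*} [Primcodable β] [Primcodable γ] {p : α → β → Prop}
    {g : α → β → γ} (hp : PrimrecRel p) (hg : Primrec₂ g) :
    Primrec₂ fun (a : α) (k : ℕ) => (Encodable.decode (α := β) k).bind fun b =>
      if p a b then some (g a b) else none :=
  Primrec.option_bind (Primrec.decode.comp .snd)
    (Primrec.ite (hp.comp (Primrec.fst.comp .fst) .snd)
      (Primrec.option_some.comp (hg.comp (Primrec.fst.comp .fst) .snd)) (.const none))

end primrec

theorem primrec_search : Primrec₂ AutomatonCode.search :=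
  primrec_bind_decode (primrecPred_automatonValid .fst .snd) (primrec_automatonOutput .fst .snd)

theorem AutomatonCode.Denotes.flow {Q : Type*} {n d : ℕ} {e : Q ≃ Fin n} {c : AutomatonCode}
    {𝒜 : HybridAutomaton Q d} (h : AutomatonCode.Denotes e c 𝒜) (q : Q) :
    MatCode.Denotes (c.2.2.1.getD (e q) []) (𝒜.flow q) := by
  have h1 := ((forall₂_ofFn []).1 h.2.2.1).2 (e q)
  rwa [e.symm_apply_apply] at h1

theorem AutomatonCode.exists_valid {Q : Type*} {n d : ℕ} {e : Q ≃ Fin n} {c : AutomatonCode}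
    {𝒜 : HybridAutomaton Q d} (h : AutomatonCode.Denotes e c 𝒜) : ∃ w, c.Valid w := by
  choose w hw using fun q => LoopCert.exists_valid (h.flow q)
  refine ⟨List.ofFn fun i => w (e.symm i), fun i hi => ?_⟩
  rw [List.mem_range, h.1] at hi
  lift i to Fin n using hi
  rw [getD_ofFn, h.2.1]
  have h1 := hw (e.symm i)
  rwa [e.apply_symm_apply] at h1

theorem SpectralData.strongestInvariant_eq {Q : Type*} {d : ℕ} (𝒜 𝒜' : HybridAutomaton Q d)
    (B : Q → Matrix (Fin d) (Fin d) ℝ) (hflow : ∀ q, 𝒜'.flow q = 0) (hinit : 𝒜'.init = 𝒜.init)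
    (hedges : 𝒜'.edges = 𝒜.edges ∪ Set.range fun q => (q, B q, q))
    (s : Q → ℕ) (ν μ : ∀ q, Fin (s q) → ℂ) (W : ∀ q, Fin (s q) → ℕ → Matrix (Fin d) (Fin d) ℂ)
    (h : ∀ q, SpectralData (𝒜.flow q) (B q) (ν q) (μ q) (W q)) (hμ : ∀ q l, μ q l ≠ 0)
    (hr : ∀ q, SameRelations (ν q) (μ q)) :
    𝒜'.strongestInvariant = 𝒜.strongestInvariant := by
  choose U hU using fun q => (h q).isUnit (hμ q)
  refine HybridAutomaton.strongestInvariant_eq_of_loops 𝒜 𝒜' B hflow hinit hedges ?_ ?_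
  · exact fun q p x hx => (h q).eval_pow_mulVec (hμ q) (hr q) (U q) (hU q) p x hx
  · exact fun q p x hx => (h q).eval_exp_mulVec (hμ q) (hr q) (U q) (hU q) p x hx

end

theorem mainTheorem2 :
    ∃ F : AutomatonCode →. AutomatonCode, Partrec F ∧
      ∀ (Q : Type*) (n d : ℕ) (e : Q ≃ Fin n) (𝒜 : HybridAutomaton Q d), 𝒜.IsLinear →
        (∃ c : AutomatonCode, AutomatonCode.Denotes e c 𝒜) ∧
        ∀ c : AutomatonCode, AutomatonCode.Denotes e c 𝒜 →
          ∃ c' ∈ F c, ∃ 𝒜' : HybridAutomaton Q d,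
            AutomatonCode.Denotes e c' 𝒜' ∧
            𝒜'.IsFiniteAffineProgram ∧
            𝒜'.strongestInvariant = 𝒜.strongestInvariant ∧
            𝒜'.init = 𝒜.init ∧
            ∃ B : Q → GL (Fin d) ℝ,
              𝒜'.edges = 𝒜.edges ∪
                Set.range (fun q => (q, (B q : Matrix (Fin d) (Fin d) ℝ), q)) ∧
              ∀ q, IsAlgebraicMatrix (B q : Matrix (Fin d) (Fin d) ℝ) ∧
                complexMatrixClosure (cyclicGroup (B q)) =
                  complexMatrixClosure (flowGroup (𝒜.flow q)) := by
  -- Unbounded search over the codes of lists of certificates, one for each location.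
  refine ⟨fun c => Nat.rfindOpt c.search, Partrec.rfindOpt primrec_search.to_comp, ?_⟩
  intro Q n d e 𝒜 hlin
  refine ⟨exists_automatonCode e hlin, fun c hc => ?_⟩
  have hdom : (Nat.rfindOpt c.search).Dom := by
    obtain ⟨w, hw⟩ := AutomatonCode.exists_valid hc
    refine Nat.rfindOpt_dom.2 ⟨Encodable.encode w, c.output w, ?_⟩
    simp [AutomatonCode.search, hw]
  obtain ⟨c', hc'⟩ := Part.dom_iff_mem.1 hdom
  refine ⟨c', hc', ?_⟩
  -- The list that is found need not be the one whose existence proves termination; soundness for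
  -- all valid certificates covers it.
  obtain ⟨k, hk⟩ := Nat.rfindOpt_spec hc'
  obtain ⟨w, -, hw⟩ := Option.bind_eq_some_iff.1 hk
  split_ifs at hw with hvalid
  obtain rfl := Option.some.inj hw
  have hcert : ∀ q, ((w.getD (e q) default).Valid d (c.2.2.1.getD (e q) [])) := fun q => by
    have := hvalid (e q) (List.mem_range.2 (hc.1 ▸ (e q).2))
    rwa [hc.2.1] at this
  choose B s ν μ W hdata hμ hrel hB using fun q => (hcert q).exists_spectralData (hc.flow q)
  have hBalg : ∀ q, IsAlgebraicMatrix (B q) := fun q => (hB q).isAlgebraic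
  have hunit : ∀ q, IsUnit (B q) := fun q => (hdata q).isUnit (hμ q)
  choose U hU using hunit
  set 𝒜' : HybridAutomaton Q d :=
    { flow := fun _ => 0
      edges := 𝒜.edges ∪ Set.range fun q => (q, B q, q)
      init := 𝒜.init
      flow_algebraic := fun _ _ _ => isAlgebraic_zero
      edges_algebraic := by
        rintro _ (he | ⟨q, rfl⟩)
        · exact 𝒜.edges_algebraic _ he
        · exact hBalg q
      init_algebraic := 𝒜.init_algebraic } with h𝒜'
  have hfinQ : Finite Q := Finite.of_equiv _ e.symm
  refine ⟨𝒜', ⟨hc.1, hc.2.1, ?_, ?_, hc.2.2.2.2⟩,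
    ⟨fun _ => rfl, Set.Finite.union hlin (Set.finite_range _)⟩,
    SpectralData.strongestInvariant_eq 𝒜 𝒜' B (fun _ => rfl) rfl rfl s ν μ W hdata hμ hrel,
    rfl, U, ?_, fun q => ⟨?_, ?_⟩⟩
  · refine (forall₂_ofFn []).2 ⟨by simp [AutomatonCode.output, hc.1], fun i => ?_⟩
    have h1 : (c.output w).2.2.1.getD i [] = zeroCode d := by
      have hi : (i : ℕ) < c.1 := hc.1 ▸ i.2
      simp [AutomatonCode.output, hc.2.1, hi]
    rw [h1]
    exact zeroCode_denotes d
  · obtain ⟨l, hl, hl'⟩ := hc.2.2.2.1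
    refine ⟨l ++ List.ofFn fun i => (e.symm i, B (e.symm i), e.symm i),
      List.rel_append hl ((forall₂_ofFn (0, [], 0)).2 ⟨by simp [hc.1], fun i => ?_⟩), ?_⟩
    · have hi : (i : ℕ) < c.1 := hc.1 ▸ i.2
      have h1 := hB (e.symm i)
      rw [e.apply_symm_apply] at h1
      simpa [hc.2.1, hi] using h1
    · ext x
      rw [h𝒜']
      simp only [hl', Set.mem_union, Set.mem_ofPred_eq, Set.mem_range, List.mem_append,
        List.mem_ofFn]
      exact or_congr Iff.rfl ⟨fun ⟨q, hq⟩ => ⟨e q, by simpa using hq⟩, fun ⟨i, hi⟩ => ⟨_, hi⟩⟩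
  · simp only [hU]
    rfl
  · rw [hU]
    exact hBalg q
  · exact (hdata q).complexMatrixClosure_eq (hμ q) (hrel q) (U q) (hU q)
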